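/- **The system $\mathcal V^\omega$.** The finite types are generated from the base types $0$ (natural numbers) and $X$ (an abstract space) by forming, from types $\rho,\tau$, the type $\tau(\rho)$ of functionals from $\rho$ to $\tau$; type $1$ is $0(0)$. Let $\mathcal A^\omega$ be classical many-sorted logic over these types, with $=_0$ as the only relation symbol (equality $=_\rho$ at higher types is defined pointwise), the usual axioms for $=_0$, zero and successor, full induction, the defining axioms of the combinators $\Pi,\Sigma$ and of the simultaneous primitive recursors in all finite types, the schemata of quantifier-free choice $\mathrm{QF}\text{-}\mathrm{AC}$ and of dependent choice $\mathrm{DC}$ for tuples of arbitrary types, and only the weak rule of quantifier-free extensionality: from a theorem $A_0\to s=_\rho t$ with $A_0$ quantifier-free infer $A_0\to r[s/x^\rho]=_\tau r[t/x^\rho]$. Reals are represented by type-$1$ objects, read as Cauchy sequences of rationals with rate $2^{-n}$, with defined relations $=_{\mathbb R},<_{\mathbb R},\le_{\mathbb R}$ and closed terms for $+,-,\cdot,|\cdot|$ and for a reciprocal $(\gamma)^{-1}_l$, which is correct when $|\gamma|>2^{-l}$; a formula with $\gamma>_{\mathbb R}0$ and $\gamma^{-1}$ abbreviates the one that has an additional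 universally quantified $l^0$, the premise $\gamma>_{\mathbb R}2^{-l}$, and $(\gamma)^{-1}_l$ in place of $\gamma^{-1}$. Add constants $0_X,1_X,+_X,-_X,\cdot_X,\|\cdot\|_X$ with axioms saying that $X$ is a real normed space and $\|1_X\|=_{\mathbb R}1$; $x=_Xy$ is defined as $\|x-_Xy\|=_{\mathbb R}0$. Finally add constants $\chi_A$ of type $0(X)(X)$ (write $u\in Ax$ for $\chi_Axu=_00$), $J$ of type $X(X)(1)$ (write $J^A_\gamma x$ for $J\gamma x$), $\tilde\gamma$ of type $1$, $m$ of type $0$ and $c$ of type $X$, with the axioms - (I) $\forall x,y\,(\chi_Axy\le_01)$; - (II) $\forall\gamma^1,x\,(\gamma>_{\mathbb R}0\to\gamma^{-1}(x-J^A_\gamma x)\in A(J^A_\gamma x))$; - (III) $\forall x,y,u,v,\lambda^1\,(u\in Ax\land v\in Ay\to\|x-y+|\lambda|(u-v)\|\ge_{\mathbb R}\|x-y\|)$; - (IV) $\tilde\gamma\ge_{\mathbb R}2^{-m}$. The resulting system is $\mathcal V^\omega$. **Theorem.** For any two of the following sentences, their equivalence is provable in $\mathcal V^\omega$ (variables without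 a type have type $X$). 1. Extensionality of $A$: $\forall x,y,x',y'\,(x=_Xx'\land y=_Xy'\to\chi_Axy=_0\chi_Ax'y')$. 2. The strong resolvent axiom: $\forall x,p,\gamma^1\,(\gamma>_{\mathbb R}0\land p=_XJ^A_\gamma x\to\gamma^{-1}(x-p)\in Ap)$. 3. Maximal accretivity of $A$: $\forall x,u\,\bigl(\forall y,v,\lambda^1\,(v\in Ay\to\|x-y+|\lambda|(u-v)\|\ge_{\mathbb R}\|x-y\|)\to u\in Ax\bigr)$. 4. The strong resolvent axiom for $\gamma=1$: $\forall x,p\,(p=_XJ^A_1x\to x-p\in Ap)$. 5. Maximal accretivity of $A$ for $\lambda=1$: $\forall x,u\,\bigl(\forall y,v\,(v\in Ay\to\|x-y+(u-v)\|\ge_{\mathbb R}\|x-y\|)\to u\in Ax\bigr)$. 6. Closedness of the graph of $A$: $\forall x,y,x_{(\cdot)}^{X(0)},y_{(\cdot)}^{X(0)}\,\bigl(x_n\to x\land y_n\to y\land\forall n^0(y_n\in Ax_n)\to y\in Ax\bigr)$, where $x_n\to x$ stands for $\forall k^0\exists N^0\forall m\ge_0N\,(\|x_m-x\|\le_{\mathbb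 R}2^{-k})$. -/

import Mathlib

/- The formal system `V^ω` of m-accretive operators with total resolvents: a many-sorted
classical theory in all finite types over `ℕ` and an abstract normed space `X`.
Syntax is well-scoped and well-typed (de Bruijn): `Tm Γ ρ` are the terms of type `ρ` and
`Fm Γ` the formulas whose free variables are listed, with their types, in `Γ`. -/

namespace AccretiveSystem

/-! ### Types, variables, constants, terms -/

/-- Finite types over the base types `0` (here `nat`) and `X`;
`arr ρ τ` is the type, written `τ(ρ)`, of functionals from `ρ` to `τ`. -/
inductive Ty : Type
  | nat : Ty
  | X : Ty
  | arr : Ty → Ty → Ty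

infixr:60 " ⇾ " => Ty.arr

/-- The type `1` of number-theoretic functions. -/
abbrev Ty.one : Ty := Ty.nat ⇾ Ty.nat

/-- `arrows [ρ₁, …, ρₖ] τ` is `ρ₁ ⇾ … ⇾ ρₖ ⇾ τ`. -/
def arrows : List Ty → Ty → Ty
  | [], τ => τ
  | ρ :: ρs, τ => ρ ⇾ arrows ρs τ

/-- `Var Γ ρ` is the type of positions in the list `Γ` that carry the entry `ρ`. -/
inductive Var : List Ty → Ty → Type
  | zero {Γ : List Ty} {ρ : Ty} : Var (ρ :: Γ) ρ
  | succ {Γ : List Ty} {ρ σ : Ty} : Var Γ ρ → Var (σ :: Γ) ρ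

namespace Var

def map (F : Ty → Ty) : {Γ : List Ty} → {ρ : Ty} → Var Γ ρ → Var (Γ.map F) (F ρ)
  | _, _, .zero => .zero
  | _, _, .succ v => .succ (map F v)

def inl (Δ : List Ty) : {Γ : List Ty} → {ρ : Ty} → Var Γ ρ → Var (Γ ++ Δ) ρ
  | _, _, .zero => .zero
  | _, _, .succ v => .succ (inl Δ v)

def inr {Δ : List Ty} {ρ : Ty} : (Γ : List Ty) → Var Δ ρ → Var (Γ ++ Δ) ρ
  | [], v => v
  | _ :: Γ, v => .succ (inr Γ v)

end Var

/-- Type of the step functional for the component of type `σ` of a simultaneous recursion. -/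
abbrev stepTy (ρs : List Ty) (σ : Ty) : Ty := arrows ρs (Ty.nat ⇾ σ)

/-- Type of the component of result type `ρ` of the simultaneous recursor for the tuple `ρs`. -/
def recTy (ρs : List Ty) (ρ : Ty) : Ty :=
  Ty.nat ⇾ arrows ρs (arrows (ρs.map (stepTy ρs)) ρ)

/-- The constants of the language. -/
inductive Con : Ty → Type
  | zero : Con Ty.nat
  | succ : Con (Ty.nat ⇾ Ty.nat)
  | proj (ρ τ : Ty) : Con (ρ ⇾ τ ⇾ ρ)
  | sigma (δ ρ τ : Ty) : Con ((δ ⇾ ρ ⇾ τ) ⇾ (δ ⇾ ρ) ⇾ δ ⇾ τ)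
  | recr (ρs : List Ty) {ρ : Ty} (i : Var ρs ρ) : Con (recTy ρs ρ)
  | zeroX : Con Ty.X
  | oneX : Con Ty.X
  | addX : Con (Ty.X ⇾ Ty.X ⇾ Ty.X)
  | negX : Con (Ty.X ⇾ Ty.X)
  | smulX : Con (Ty.one ⇾ Ty.X ⇾ Ty.X)
  | normX : Con (Ty.X ⇾ Ty.one)
  /-- The characteristic function `χ_A` of the operator `A`. -/
  | chi : Con (Ty.X ⇾ Ty.X ⇾ Ty.nat)
  /-- The resolvent `(γ, x) ↦ J^A_γ x`. -/
  | res : Con (Ty.one ⇾ Ty.X ⇾ Ty.X)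
  /-- The index `γ̃`. -/
  | gam : Con Ty.one
  /-- The number `m_γ̃`. -/
  | mGam : Con Ty.nat
  /-- The designated point `c_X`. -/
  | cX : Con Ty.X

/-- Terms: built from variables and constants by application only. -/
inductive Tm (Γ : List Ty) : Ty → Type
  | var {ρ : Ty} : Var Γ ρ → Tm Γ ρ
  | con {ρ : Ty} : Con ρ → Tm Γ ρ
  | app {ρ τ : Ty} : Tm Γ (ρ ⇾ τ) → Tm Γ ρ → Tm Γ τ

infixl:90 " ⬝ " => Tm.app

/-- A simultaneous substitution, or equivalently a tuple of terms of types `Γ`. -/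
abbrev Sub (Γ Δ : List Ty) : Type := ∀ ⦃ρ : Ty⦄, Var Γ ρ → Tm Δ ρ

def Tm.subst {Γ Δ : List Ty} (σ : Sub Γ Δ) : {ρ : Ty} → Tm Γ ρ → Tm Δ ρ
  | _, .var v => σ v
  | _, .con c => .con c
  | _, .app f a => .app (f.subst σ) (a.subst σ)

/-- Weakening by one fresh variable. -/
def Tm.wk {Γ : List Ty} {ρ σ : Ty} (t : Tm Γ ρ) : Tm (σ :: Γ) ρ :=
  t.subst fun _ v => .var v.succ

/-- The empty substitution. -/
def Sub.nil {Δ : List Ty} : Sub [] Δ := fun _ v => nomatch v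

/-- A closed term, seen in any context. -/
def Tm.emb {Γ : List Ty} {ρ : Ty} (t : Tm [] ρ) : Tm Γ ρ := t.subst Sub.nil

namespace Sub

def cons {Γ Δ : List Ty} {ρ : Ty} (t : Tm Δ ρ) (σ : Sub Γ Δ) : Sub (ρ :: Γ) Δ
  | _, .zero => t
  | _, .succ v => σ v

/-- Extension of a substitution under one binder. -/
def lift {Γ Δ : List Ty} {ρ : Ty} (σ : Sub Γ Δ) : Sub (ρ :: Γ) (ρ :: Δ) :=
  cons (.var .zero) fun _ v => (σ v).wk

def append {Γ Δ : List Ty} : {Ξ : List Ty} → Sub Ξ Δ → Sub Γ Δ → Sub (Ξ ++ Γ) Δ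
  | [], _, τ => τ
  | _ :: _, σ, τ => cons (σ .zero) (append (fun _ v => σ v.succ) τ)

end Sub

/-- Replacement of the last variable by `t`. -/
def Tm.inst {Γ : List Ty} {ρ τ : Ty} (r : Tm (ρ :: Γ) τ) (t : Tm Γ ρ) : Tm Γ τ :=
  r.subst (Sub.cons t fun _ v => .var v)

/-- Application of `f` to a tuple of arguments. -/
def Tm.apps {Γ : List Ty} : {ρs : List Ty} → {τ : Ty} → Tm Γ (arrows ρs τ) → Sub ρs Γ → Tm Γ τ
  | [], _, f, _ => f
  | ρ :: ρs, τ, f, a =>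
      Tm.apps (ρs := ρs) (τ := τ) (Tm.app (τ := arrows ρs τ) f (a (ρ := ρ) .zero))
        fun _ v => a v.succ

/-- The term `(R_i) x y z` of a simultaneous recursion. -/
def recTm {Γ : List Ty} (ρs : List Ty) {ρ : Ty} (i : Var ρs ρ) (x : Tm Γ Ty.nat)
    (y : Sub ρs Γ) (z : Sub (ρs.map (stepTy ρs)) Γ) : Tm Γ ρ :=
  Tm.apps (ρs := ρs.map (stepTy ρs))
    (Tm.apps (ρs := ρs) (τ := arrows (ρs.map (stepTy ρs)) ρ)
      (Tm.app (ρ := Ty.nat) (τ := arrows ρs (arrows (ρs.map (stepTy ρs)) ρ))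
        (.con (.recr ρs i)) x) y) z

/-- The abstraction `λ x. t`, defined through the combinators. -/
def Tm.lam {Γ : List Ty} {ρ : Ty} : {τ : Ty} → Tm (ρ :: Γ) τ → Tm Γ (ρ ⇾ τ)
  | _, .var .zero => .con (.sigma ρ (ρ ⇾ ρ) ρ) ⬝ .con (.proj ρ (ρ ⇾ ρ)) ⬝ .con (.proj ρ ρ)
  | _, .var (.succ v) => .con (.proj _ ρ) ⬝ .var v
  | _, .con c => .con (.proj _ ρ) ⬝ .con c
  | _, .app f a => .con (.sigma ρ _ _) ⬝ f.lam ⬝ a.lam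

section Variables

/-! The variables of a context, the innermost one first. -/

variable {Γ : List Ty} {a b c d e f : Ty}

def v0 : Tm (a :: Γ) a := .var .zero
def v1 : Tm (b :: a :: Γ) a := .var (.succ .zero)
def v2 : Tm (c :: b :: a :: Γ) a := .var (.succ (.succ .zero))
def v3 : Tm (d :: c :: b :: a :: Γ) a := .var (.succ (.succ (.succ .zero)))
def v4 : Tm (e :: d :: c :: b :: a :: Γ) a := .var (.succ (.succ (.succ (.succ .zero))))

end Variables

open Ty Tm

/-! ### Primitive recursive arithmetic as closed terms -/

section Arithmetic

variable {Γ : List Ty}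

def zero : Tm Γ nat := .con .zero
def succ (t : Tm Γ nat) : Tm Γ nat := .con .succ ⬝ t
def nOne : Tm Γ nat := succ zero
def nTwo : Tm Γ nat := succ nOne

/-- Recursion at type `0`: value `y` at `0`, and `z p i` at `i + 1` if `p` is the value at `i`. -/
def recN (x y : Tm Γ nat) (z : Tm Γ (nat ⇾ nat ⇾ nat)) : Tm Γ nat :=
  Tm.app (ρ := nat ⇾ nat ⇾ nat) (Tm.app (ρ := nat) (τ := (nat ⇾ nat ⇾ nat) ⇾ nat)
    (Tm.app (ρ := nat) (τ := nat ⇾ (nat ⇾ nat ⇾ nat) ⇾ nat)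
      (.con (.recr [nat] .zero)) x) y) z

def addC : Tm [] (nat ⇾ nat ⇾ nat) := lam (lam (recN v0 v1 (lam (lam (succ v1)))))
def add (s t : Tm Γ nat) : Tm Γ nat := addC.emb ⬝ s ⬝ t

def predC : Tm [] (nat ⇾ nat) := lam (recN v0 zero (lam (lam v0)))
def pred (s : Tm Γ nat) : Tm Γ nat := predC.emb ⬝ s

/-- Truncated subtraction. -/
def subC : Tm [] (nat ⇾ nat ⇾ nat) := lam (lam (recN v0 v1 (lam (lam (pred v1)))))
def sub (s t : Tm Γ nat) : Tm Γ nat := subC.emb ⬝ s ⬝ t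

def mulC : Tm [] (nat ⇾ nat ⇾ nat) := lam (lam (recN v0 zero (lam (lam (add v1 v3)))))
def mul (s t : Tm Γ nat) : Tm Γ nat := mulC.emb ⬝ s ⬝ t

/-- `2 ^ x`. -/
def powC : Tm [] (nat ⇾ nat) := lam (recN v0 nOne (lam (lam (add v1 v1))))
def pow (s : Tm Γ nat) : Tm Γ nat := powC.emb ⬝ s

/-- `caseZ c s t` is `s` if `c = 0` and `t` otherwise. -/
def caseC : Tm [] (nat ⇾ nat ⇾ nat ⇾ nat) := lam (lam (lam (recN v2 v1 (lam (lam v2)))))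
def caseZ (c s t : Tm Γ nat) : Tm Γ nat := caseC.emb ⬝ c ⬝ s ⬝ t

/-- `bmin P n` is the least `k < n` with `P k = 0`, and `n` if there is none. -/
def bminC : Tm [] (Ty.one ⇾ nat ⇾ nat) :=
  lam (lam (recN v0 zero (lam (lam (caseZ (v3 ⬝ v1) v1 (succ v1))))))
def bmin (P : Tm Γ Ty.one) (n : Tm Γ nat) : Tm Γ nat := bminC.emb ⬝ P ⬝ n

/-- `x (x + 1) / 2`. -/
def triC : Tm [] (nat ⇾ nat) := lam (recN v0 zero (lam (lam (add v1 (succ v0)))))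
def tri (s : Tm Γ nat) : Tm Γ nat := triC.emb ⬝ s

/-- The Cantor pairing `j (n, m) = ((n + m) ^ 2 + 3 n + m) / 2 = (n + m) (n + m + 1) / 2 + n`. -/
def pairC : Tm [] (nat ⇾ nat ⇾ nat) := lam (lam (add (tri (add v1 v0)) v1))
def pair (s t : Tm Γ nat) : Tm Γ nat := pairC.emb ⬝ s ⬝ t

/-- The sum of the nTwo components of the pair coded by `x`. -/
def diagC : Tm [] (nat ⇾ nat) := lam (bmin (lam (sub (succ v1) (tri (succ v0)))) v0)
def diag (s : Tm Γ nat) : Tm Γ nat := diagC.emb ⬝ s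

def fstC : Tm [] (nat ⇾ nat) := lam (sub v0 (tri (diag v0)))
def fst (s : Tm Γ nat) : Tm Γ nat := fstC.emb ⬝ s

def sndC : Tm [] (nat ⇾ nat) := lam (sub (diag v0) (fst v0))
def snd (s : Tm Γ nat) : Tm Γ nat := sndC.emb ⬝ s

/-- The remainder modulo `2`. -/
def parC : Tm [] (nat ⇾ nat) := lam (recN v0 zero (lam (lam (sub nOne v1))))
def par (s : Tm Γ nat) : Tm Γ nat := parC.emb ⬝ s

/-- The quotient by `2`, rounded down. -/
def halfC : Tm [] (nat ⇾ nat) := lam (recN v0 zero (lam (lam (add v1 (par v0)))))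
def half (s : Tm Γ nat) : Tm Γ nat := halfC.emb ⬝ s

/-! Rational numbers: `j (n, m)` codes `(n / 2) / (m + 1)` if `n` is even and
`- ((n + 1) / 2) / (m + 1)` if `n` is odd. The rational coded by `c` is thus
`(qpos c - qnegPart c) / qden c`. -/

def qposC : Tm [] (nat ⇾ nat) := lam (mul (half (fst v0)) (sub nOne (par (fst v0))))
def qpos (s : Tm Γ nat) : Tm Γ nat := qposC.emb ⬝ s

def qnegPartC : Tm [] (nat ⇾ nat) := lam (mul (succ (half (fst v0))) (par (fst v0)))
def qnegPart (s : Tm Γ nat) : Tm Γ nat := qnegPartC.emb ⬝ s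

def qden (s : Tm Γ nat) : Tm Γ nat := succ (snd s)

/-- A code of the rational number `(p - n) / d`, for `d > 0`. -/
def qencC : Tm [] (nat ⇾ nat ⇾ nat ⇾ nat) :=
  lam (lam (lam (pair
    (caseZ (sub v1 v2) (mul nTwo (sub v2 v1)) (pred (mul nTwo (sub v1 v2)))) (pred v0))))
def qenc (p n d : Tm Γ nat) : Tm Γ nat := qencC.emb ⬝ p ⬝ n ⬝ d

def qaddC : Tm [] (nat ⇾ nat ⇾ nat) :=
  lam (lam (qenc (add (mul (qpos v1) (qden v0)) (mul (qpos v0) (qden v1)))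
    (add (mul (qnegPart v1) (qden v0)) (mul (qnegPart v0) (qden v1)))
    (mul (qden v1) (qden v0))))
def qadd (s t : Tm Γ nat) : Tm Γ nat := qaddC.emb ⬝ s ⬝ t

def qnegC : Tm [] (nat ⇾ nat) := lam (qenc (qnegPart v0) (qpos v0) (qden v0))
def qneg (s : Tm Γ nat) : Tm Γ nat := qnegC.emb ⬝ s

def qsub (s t : Tm Γ nat) : Tm Γ nat := qadd s (qneg t)

def qmulC : Tm [] (nat ⇾ nat ⇾ nat) :=
  lam (lam (qenc (add (mul (qpos v1) (qpos v0)) (mul (qnegPart v1) (qnegPart v0)))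
    (add (mul (qpos v1) (qnegPart v0)) (mul (qnegPart v1) (qpos v0)))
    (mul (qden v1) (qden v0))))
def qmul (s t : Tm Γ nat) : Tm Γ nat := qmulC.emb ⬝ s ⬝ t

def qabsC : Tm [] (nat ⇾ nat) := lam (qenc (add (qpos v0) (qnegPart v0)) zero (qden v0))
def qabs (s : Tm Γ nat) : Tm Γ nat := qabsC.emb ⬝ s

/-- The reciprocal, with value `0` at `0`; one of `qpos c`, `qnegPart c` is always `0`. -/
def qinvC : Tm [] (nat ⇾ nat) :=
  lam (qenc (caseZ (qpos v0) zero (qden v0)) (caseZ (qnegPart v0) zero (qden v0))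
    (add (qpos v0) (qnegPart v0)))
def qinv (s : Tm Γ nat) : Tm Γ nat := qinvC.emb ⬝ s

/-- Characteristic term of `≤` on the rationals: its value is `0` iff `s ≤ t`. -/
def qleC : Tm [] (nat ⇾ nat ⇾ nat) :=
  lam (lam (sub (add (mul (qpos v1) (qden v0)) (mul (qnegPart v0) (qden v1)))
    (add (mul (qpos v0) (qden v1)) (mul (qnegPart v1) (qden v0)))))
def qle (s t : Tm Γ nat) : Tm Γ nat := qleC.emb ⬝ s ⬝ t

/-- The natural number `s` as a rational. -/
def qnat (s : Tm Γ nat) : Tm Γ nat := pair (mul nTwo s) zero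

/-- The rational `2 ^ (-s)`. -/
def qtwoC : Tm [] (nat ⇾ nat) := lam (pair nTwo (pred (pow v0)))
def qtwo (s : Tm Γ nat) : Tm Γ nat := qtwoC.emb ⬝ s

/-! Real numbers, represented by functions `f` of type `1`, are the limits of the sequences of
(codes of) rationals `hat f`; here `hat f = f` if `|f k - f (k+1)| < 2 ^ (-(k+1))` for all `k`,
and otherwise `hat f` is constant from the first `k` on at which this fails. -/

def hatC : Tm [] (Ty.one ⇾ Ty.one) :=
  lam (lam (v1 ⬝ bmin (lam (qle (qtwo (succ v0)) (qabs (qsub (v2 ⬝ v0) (v2 ⬝ succ v0))))) v0))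
def hat (f : Tm Γ Ty.one) (n : Tm Γ nat) : Tm Γ nat := hatC.emb ⬝ f ⬝ n

/-- The rational `q` as a real. -/
def rratC : Tm [] (nat ⇾ Ty.one) := lam (lam v1)
def rrat (q : Tm Γ nat) : Tm Γ Ty.one := rratC.emb ⬝ q

def rzero : Tm Γ Ty.one := rrat (qnat zero)
def rone : Tm Γ Ty.one := rrat (qnat nOne)

/-- The real `2 ^ (-s)`. -/
def rtwo (s : Tm Γ nat) : Tm Γ Ty.one := rrat (qtwo s)

def raddC : Tm [] (Ty.one ⇾ Ty.one ⇾ Ty.one) :=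
  lam (lam (lam (qadd (hat v2 (succ v0)) (hat v1 (succ v0)))))
def radd (s t : Tm Γ Ty.one) : Tm Γ Ty.one := raddC.emb ⬝ s ⬝ t

def rsubC : Tm [] (Ty.one ⇾ Ty.one ⇾ Ty.one) :=
  lam (lam (lam (qsub (hat v2 (succ v0)) (hat v1 (succ v0)))))
def rsub (s t : Tm Γ Ty.one) : Tm Γ Ty.one := rsubC.emb ⬝ s ⬝ t

def rabsC : Tm [] (Ty.one ⇾ Ty.one) := lam (lam (qabs (hat v1 v0)))
def rabs (s : Tm Γ Ty.one) : Tm Γ Ty.one := rabsC.emb ⬝ s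

/-- An index shift `k` that makes products of fast converging sequences fast converging:
`2 ^ k ≥ |f 0| + |g 0| + 2`. -/
def shiftC : Tm [] (Ty.one ⇾ Ty.one ⇾ nat) :=
  lam (lam (add (add (fst (v1 ⬝ zero)) (fst (v0 ⬝ zero))) nTwo))
def shift (f g : Tm Γ Ty.one) : Tm Γ nat := shiftC.emb ⬝ f ⬝ g

def rmulC : Tm [] (Ty.one ⇾ Ty.one ⇾ Ty.one) :=
  lam (lam (lam (qmul (hat v2 (add v0 (shift v2 v1))) (hat v1 (add v0 (shift v2 v1))))))
def rmul (s t : Tm Γ Ty.one) : Tm Γ Ty.one := rmulC.emb ⬝ s ⬝ t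

/-- `rinv l f` represents the reciprocal of the real `f` whenever `|f| > 2 ^ (-l)`. -/
def rinvC : Tm [] (nat ⇾ Ty.one ⇾ Ty.one) :=
  lam (lam (lam (qinv (hat v1 (add v0 (add (mul nTwo v2) nTwo))))))
def rinv (l : Tm Γ nat) (f : Tm Γ Ty.one) : Tm Γ Ty.one := rinvC.emb ⬝ l ⬝ f

end Arithmetic

/-! ### Formulas -/

/-- Formulas; equality at type `0` is the only relation symbol. -/
inductive Fm : List Ty → Type
  | eq {Γ : List Ty} : Tm Γ Ty.nat → Tm Γ Ty.nat → Fm Γ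
  | and {Γ : List Ty} : Fm Γ → Fm Γ → Fm Γ
  | or {Γ : List Ty} : Fm Γ → Fm Γ → Fm Γ
  | imp {Γ : List Ty} : Fm Γ → Fm Γ → Fm Γ
  | all {Γ : List Ty} (ρ : Ty) : Fm (ρ :: Γ) → Fm Γ
  | ex {Γ : List Ty} (ρ : Ty) : Fm (ρ :: Γ) → Fm Γ

infix:50 " ≐ " => Fm.eq
infixr:35 " ⩑ " => Fm.and
infixr:25 " ⟹' " => Fm.imp

namespace Fm

def subst : {Γ Δ : List Ty} → Sub Γ Δ → Fm Γ → Fm Δ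
  | _, _, σ, .eq s t => .eq (s.subst σ) (t.subst σ)
  | _, _, σ, .and φ ψ => .and (subst σ φ) (subst σ ψ)
  | _, _, σ, .or φ ψ => .or (subst σ φ) (subst σ ψ)
  | _, _, σ, .imp φ ψ => .imp (subst σ φ) (subst σ ψ)
  | _, _, σ, .all ρ φ => .all ρ (subst σ.lift φ)
  | _, _, σ, .ex ρ φ => .ex ρ (subst σ.lift φ)

def wk {Γ : List Ty} {σ : Ty} (φ : Fm Γ) : Fm (σ :: Γ) := φ.subst fun _ v => .var v.succ

def inst {Γ : List Ty} {ρ : Ty} (φ : Fm (ρ :: Γ)) (t : Tm Γ ρ) : Fm Γ :=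
  φ.subst (Sub.cons t fun _ v => .var v)

/-- Falsity is `0 = 1`. -/
def bot {Γ : List Ty} : Fm Γ := zero ≐ nOne

def neg {Γ : List Ty} (φ : Fm Γ) : Fm Γ := φ ⟹' bot

def iff {Γ : List Ty} (φ ψ : Fm Γ) : Fm Γ := (φ ⟹' ψ) ⩑ (ψ ⟹' φ)

/-- Quantifier-free formulas. -/
def QF : {Γ : List Ty} → Fm Γ → Prop
  | _, .eq _ _ => True
  | _, .and φ ψ => φ.QF ∧ ψ.QF
  | _, .or φ ψ => φ.QF ∧ ψ.QF
  | _, .imp φ ψ => φ.QF ∧ ψ.QF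
  | _, .all _ _ => False
  | _, .ex _ _ => False

/-- Universal quantification over a tuple of variables. -/
def alls {Γ : List Ty} : (ρs : List Ty) → Fm (ρs ++ Γ) → Fm Γ
  | [], φ => φ
  | ρ :: ρs, φ => alls ρs (.all ρ φ)

/-- Existential quantification over a tuple of variables. -/
def exs {Γ : List Ty} : (ρs : List Ty) → Fm (ρs ++ Γ) → Fm Γ
  | [], φ => φ
  | ρ :: ρs, φ => exs ρs (.ex ρ φ)

end Fm

section DefinedRelations

variable {Γ : List Ty}

def leN (s t : Tm Γ nat) : Fm Γ := sub s t ≐ zero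

def leQ (s t : Tm Γ nat) : Fm Γ := qle s t ≐ zero
def ltQ (s t : Tm Γ nat) : Fm Γ := (leQ t s).neg

/-- `s =_ℝ t`: for all `n`, `|hat s (n+1) - hat t (n+1)| < 2 ^ (-n)`. -/
def eqR (s t : Tm Γ Ty.one) : Fm Γ :=
  .all nat (ltQ (qabs (qsub (hat s.wk (succ v0)) (hat t.wk (succ v0)))) (qtwo v0))

/-- `s <_ℝ t`: for some `n`, `hat t (n+1) - hat s (n+1) ≥ 2 ^ (-n)`. -/
def ltR (s t : Tm Γ Ty.one) : Fm Γ :=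
  .ex nat (leQ (qtwo v0) (qsub (hat t.wk (succ v0)) (hat s.wk (succ v0))))

def leR (s t : Tm Γ Ty.one) : Fm Γ := (ltR t s).neg

def zeroX : Tm Γ X := .con .zeroX
def oneX : Tm Γ X := .con .oneX
def addX (x y : Tm Γ X) : Tm Γ X := .con .addX ⬝ x ⬝ y
def negX (x : Tm Γ X) : Tm Γ X := .con .negX ⬝ x
def subX (x y : Tm Γ X) : Tm Γ X := addX x (negX y)
def smulX (r : Tm Γ Ty.one) (x : Tm Γ X) : Tm Γ X := .con .smulX ⬝ r ⬝ x
def normX (x : Tm Γ X) : Tm Γ Ty.one := .con .normX ⬝ x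

/-- `x =_X y`: `‖x - y‖ =_ℝ 0`. -/
def eqX (x y : Tm Γ X) : Fm Γ := eqR (normX (subX x y)) rzero

/-- `u ∈ A x`. -/
def memA (u x : Tm Γ X) : Fm Γ := .con .chi ⬝ x ⬝ u ≐ zero

/-- `J^A_γ x`. -/
def resA (γ : Tm Γ Ty.one) (x : Tm Γ X) : Tm Γ X := .con .res ⬝ γ ⬝ x

end DefinedRelations

/-- Equality at an arbitrary type: pointwise equality down to the base types. -/
def eqT : {Γ : List Ty} → (ρ : Ty) → Tm Γ ρ → Tm Γ ρ → Fm Γ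
  | _, .nat, s, t => s ≐ t
  | _, .X, s, t => eqX s t
  | _, .arr ρ τ, s, t => .all ρ (eqT τ (s.wk ⬝ v0) (t.wk ⬝ v0))

/-! ### Axioms

Universal axioms are given by all their instances, in every context of free variables. -/

/-- Arithmetic in all finite types: `=_0`, successor, induction, combinators, recursors. -/
inductive ArithAx : {Γ : List Ty} → Fm Γ → Prop
  | eqRefl {Γ : List Ty} (s : Tm Γ nat) : ArithAx (s ≐ s)
  | eqSymm {Γ : List Ty} (s t : Tm Γ nat) : ArithAx (s ≐ t ⟹' t ≐ s)
  | eqTrans {Γ : List Ty} (s t r : Tm Γ nat) : ArithAx (s ≐ t ⩑ t ≐ r ⟹' s ≐ r)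
  | succNe {Γ : List Ty} (s : Tm Γ nat) : ArithAx (succ s ≐ zero).neg
  | succInj {Γ : List Ty} (s t : Tm Γ nat) : ArithAx (succ s ≐ succ t ⟹' s ≐ t)
  | induction {Γ : List Ty} (φ : Fm (nat :: Γ)) :
      ArithAx (φ.inst zero ⩑
        .all nat (φ ⟹' φ.subst (Sub.cons (succ v0) fun _ v => .var v.succ)) ⟹' .all nat φ)
  | proj {Γ : List Ty} {ρ τ : Ty} (s : Tm Γ ρ) (t : Tm Γ τ) :
      ArithAx (eqT ρ (.con (.proj ρ τ) ⬝ s ⬝ t) s)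
  | sigma {Γ : List Ty} {δ ρ τ : Ty} (s : Tm Γ (δ ⇾ ρ ⇾ τ)) (t : Tm Γ (δ ⇾ ρ)) (r : Tm Γ δ) :
      ArithAx (eqT τ (.con (.sigma δ ρ τ) ⬝ s ⬝ t ⬝ r) (s ⬝ r ⬝ (t ⬝ r)))
  | recZero {Γ : List Ty} (ρs : List Ty) {ρ : Ty} (i : Var ρs ρ)
      (y : Sub ρs Γ) (z : Sub (ρs.map (stepTy ρs)) Γ) :
      ArithAx (eqT ρ (recTm ρs i zero y z) (y i))
  | recSucc {Γ : List Ty} (ρs : List Ty) {ρ : Ty} (i : Var ρs ρ) (x : Tm Γ nat)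
      (y : Sub ρs Γ) (z : Sub (ρs.map (stepTy ρs)) Γ) :
      ArithAx (eqT ρ (recTm ρs i (succ x) y z)
        (Tm.apps (ρs := ρs) (τ := nat ⇾ ρ) (z (i.map (stepTy ρs)))
          (fun _ k => recTm ρs k x y z) ⬝ x))

/-- For formulas `φ (x̲, y̲)`: the substitution `y̲ ↦ Y̲ x̲`. -/
def choiceSub (Γ xs ys : List Ty) :
    Sub (ys ++ (xs ++ Γ)) (xs ++ (ys.map (arrows xs) ++ Γ)) :=
  Sub.append
    (fun _ i => Tm.apps (ρs := xs) (.var ((((i.map (arrows xs)).inl Γ)).inr xs))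
      fun _ k => .var (k.inl _))
    (Sub.append (fun _ k => .var (k.inl _)) fun _ v => .var ((v.inr (ys.map (arrows xs))).inr xs))

/-- For formulas `φ (x, y̲, z̲)`: the substitution `y̲ ↦ f̲ x`, `z̲ ↦ f̲ (S x)`. -/
def depSub (Γ ρs : List Ty) :
    Sub (ρs ++ (ρs ++ (nat :: Γ))) (nat :: (ρs.map (Ty.arr nat) ++ Γ)) :=
  Sub.append
    (fun _ i => .var ((i.map (Ty.arr nat)).inl Γ).succ ⬝ succ v0)
    (Sub.append
      (fun _ i => .var ((i.map (Ty.arr nat)).inl Γ).succ ⬝ v0)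
      (Sub.cons v0 fun _ v => .var (v.inr (ρs.map (Ty.arr nat))).succ))

/-- The schemata of quantifier-free choice and of dependent choice, for tuples of all types. -/
inductive ChoiceAx : {Γ : List Ty} → Fm Γ → Prop
  | qfAC {Γ : List Ty} (xs ys : List Ty) (φ : Fm (ys ++ (xs ++ Γ))) (hφ : φ.QF) :
      ChoiceAx (.alls xs (.exs ys φ) ⟹'
        .exs (ys.map (arrows xs)) (.alls xs (φ.subst (choiceSub Γ xs ys))))
  | dc {Γ : List Ty} (ρs : List Ty) (φ : Fm (ρs ++ (ρs ++ (nat :: Γ)))) :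
      ChoiceAx (.all nat (.alls ρs (.exs ρs φ)) ⟹'
        .exs (ρs.map (Ty.arr nat)) (.all nat (φ.subst (depSub Γ ρs))))

/-- `X` is a real normed space with a vector `1_X` of norm `1`. -/
inductive NormAx : {Γ : List Ty} → Fm Γ → Prop
  | addComm {Γ : List Ty} (x y : Tm Γ X) : NormAx (eqX (addX x y) (addX y x))
  | addAssoc {Γ : List Ty} (x y z : Tm Γ X) :
      NormAx (eqX (addX (addX x y) z) (addX x (addX y z)))
  | addZero {Γ : List Ty} (x : Tm Γ X) : NormAx (eqX (addX x zeroX) x)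
  | addNeg {Γ : List Ty} (x : Tm Γ X) : NormAx (eqX (addX x (negX x)) zeroX)
  | oneSmul {Γ : List Ty} (x : Tm Γ X) : NormAx (eqX (smulX rone x) x)
  | mulSmul {Γ : List Ty} (r s : Tm Γ Ty.one) (x : Tm Γ X) :
      NormAx (eqX (smulX (rmul r s) x) (smulX r (smulX s x)))
  | addSmul {Γ : List Ty} (r s : Tm Γ Ty.one) (x : Tm Γ X) :
      NormAx (eqX (smulX (radd r s) x) (addX (smulX r x) (smulX s x)))
  | smulAdd {Γ : List Ty} (r : Tm Γ Ty.one) (x y : Tm Γ X) :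
      NormAx (eqX (smulX r (addX x y)) (addX (smulX r x) (smulX r y)))
  | normSelf {Γ : List Ty} (x : Tm Γ X) : NormAx (eqR (normX (subX x x)) rzero)
  | normSymm {Γ : List Ty} (x y : Tm Γ X) :
      NormAx (eqR (normX (subX x y)) (normX (subX y x)))
  | normTriangle {Γ : List Ty} (x y z : Tm Γ X) :
      NormAx (leR (normX (subX x z)) (radd (normX (subX x y)) (normX (subX y z))))
  | normSmul {Γ : List Ty} (r : Tm Γ Ty.one) (x y : Tm Γ X) :
      NormAx (eqR (normX (subX (smulX r x) (smulX r y))) (rmul (rabs r) (normX (subX x y))))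
  | normSmulSub {Γ : List Ty} (r s : Tm Γ Ty.one) (x : Tm Γ X) :
      NormAx (eqR (normX (subX (smulX r x) (smulX s x))) (rmul (rabs (rsub r s)) (normX x)))
  | normAdd {Γ : List Ty} (x y u v : Tm Γ X) :
      NormAx (leR (normX (subX (addX x y) (addX u v)))
        (radd (normX (subX x u)) (normX (subX y v))))
  | normNeg {Γ : List Ty} (x y : Tm Γ X) :
      NormAx (eqR (normX (subX (negX x) (negX y))) (normX (subX x y)))
  | normSub {Γ : List Ty} (x y : Tm Γ X) :
      NormAx (leR (rabs (rsub (normX x) (normX y))) (normX (subX x y)))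
  | normOne {Γ : List Ty} : NormAx (eqR (normX (oneX (Γ := Γ))) rone)

/-- The axioms on the operator and its resolvent. A reciprocal `γ⁻¹` of a real `γ > 0`
is treated, as everywhere, through a parameter `l` with `γ > 2 ^ (-l)`. -/
inductive OperatorAx : {Γ : List Ty} → Fm Γ → Prop
  | chiLe {Γ : List Ty} (x y : Tm Γ X) : OperatorAx (leN (.con .chi ⬝ x ⬝ y) nOne)
  | resolvent {Γ : List Ty} (γ : Tm Γ Ty.one) (x : Tm Γ X) (l : Tm Γ nat) :
      OperatorAx (ltR (rtwo l) γ ⟹'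
        memA (smulX (rinv l γ) (subX x (resA γ x))) (resA γ x))
  | accretive {Γ : List Ty} (x y u v : Tm Γ X) (r : Tm Γ Ty.one) :
      OperatorAx (memA u x ⩑ memA v y ⟹'
        leR (normX (subX x y)) (normX (addX (subX x y) (smulX (rabs r) (subX u v)))))
  | gamGe {Γ : List Ty} : OperatorAx (Γ := Γ) (leR (rtwo (.con .mGam)) (.con .gam))

/-! ### Provability -/

/-- Derivability of a formula from a list of open assumptions in the system `V^ω`: natural deduction
for classical many-sorted logic, the axioms above, and the quantifier-free rule of extensionality,
which applies to theorems only (no open assumptions). -/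
inductive Derives : {Γ : List Ty} → List (Fm Γ) → Fm Γ → Prop
  | arith {Γ : List Ty} {H : List (Fm Γ)} {φ : Fm Γ} : ArithAx φ → Derives H φ
  | choice {Γ : List Ty} {H : List (Fm Γ)} {φ : Fm Γ} : ChoiceAx φ → Derives H φ
  | norm {Γ : List Ty} {H : List (Fm Γ)} {φ : Fm Γ} : NormAx φ → Derives H φ
  | operator {Γ : List Ty} {H : List (Fm Γ)} {φ : Fm Γ} : OperatorAx φ → Derives H φ
  | qfER {Γ : List Ty} {H : List (Fm Γ)} {ρ τ : Ty} (φ : Fm Γ) (s t : Tm Γ ρ)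
      (r : Tm (ρ :: Γ) τ) (hφ : φ.QF) : Derives [] (φ ⟹' eqT ρ s t) →
      Derives H (φ ⟹' eqT τ (r.inst s) (r.inst t))
  | hyp {Γ : List Ty} {H : List (Fm Γ)} {φ : Fm Γ} : φ ∈ H → Derives H φ
  | andI {Γ : List Ty} {H : List (Fm Γ)} {φ ψ : Fm Γ} :
      Derives H φ → Derives H ψ → Derives H (φ.and ψ)
  | andL {Γ : List Ty} {H : List (Fm Γ)} {φ ψ : Fm Γ} : Derives H (φ.and ψ) → Derives H φ
  | andR {Γ : List Ty} {H : List (Fm Γ)} {φ ψ : Fm Γ} : Derives H (φ.and ψ) → Derives H ψ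
  | orL {Γ : List Ty} {H : List (Fm Γ)} {φ ψ : Fm Γ} : Derives H φ → Derives H (φ.or ψ)
  | orR {Γ : List Ty} {H : List (Fm Γ)} {φ ψ : Fm Γ} : Derives H ψ → Derives H (φ.or ψ)
  | orE {Γ : List Ty} {H : List (Fm Γ)} {φ ψ χ : Fm Γ} : Derives H (φ.or ψ) →
      Derives (φ :: H) χ → Derives (ψ :: H) χ → Derives H χ
  | impI {Γ : List Ty} {H : List (Fm Γ)} {φ ψ : Fm Γ} :
      Derives (φ :: H) ψ → Derives H (φ.imp ψ)
  | impE {Γ : List Ty} {H : List (Fm Γ)} {φ ψ : Fm Γ} :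
      Derives H (φ.imp ψ) → Derives H φ → Derives H ψ
  | allI {Γ : List Ty} {H : List (Fm Γ)} {ρ : Ty} {φ : Fm (ρ :: Γ)} :
      Derives (H.map Fm.wk) φ → Derives H (.all ρ φ)
  | allE {Γ : List Ty} {H : List (Fm Γ)} {ρ : Ty} {φ : Fm (ρ :: Γ)} (t : Tm Γ ρ) :
      Derives H (.all ρ φ) → Derives H (φ.inst t)
  | exI {Γ : List Ty} {H : List (Fm Γ)} {ρ : Ty} {φ : Fm (ρ :: Γ)} (t : Tm Γ ρ) :
      Derives H (φ.inst t) → Derives H (.ex ρ φ)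
  | exE {Γ : List Ty} {H : List (Fm Γ)} {ρ : Ty} {φ : Fm (ρ :: Γ)} {ψ : Fm Γ} :
      Derives H (.ex ρ φ) → Derives (φ :: H.map Fm.wk) ψ.wk → Derives H ψ
  | botE {Γ : List Ty} {H : List (Fm Γ)} {φ : Fm Γ} : Derives H Fm.bot → Derives H φ
  | em {Γ : List Ty} {H : List (Fm Γ)} (φ : Fm Γ) : Derives H (φ.or φ.neg)

/-- Theorems of `V^ω`. -/
def Provable (φ : Fm []) : Prop := Derives [] φ

/-! ### The six principles

The comments name the bound variables from the outermost one on; the innermost is `v0`. -/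

/-- `∀ x y x' y' (x = x' ∧ y = y' → χ_A x y = χ_A x' y')`. -/
def extensionality : Fm [] :=
  .all X <| .all X <| .all X <| .all X <|
    eqX v3 v1 ⩑ eqX v2 v0 ⟹' (.con .chi ⬝ v3 ⬝ v2 ≐ .con .chi ⬝ v1 ⬝ v0)

/-- `∀ x p γ l (γ > 2 ^ (-l) ∧ p = J_γ x → γ⁻¹ (x - p) ∈ A p)`. -/
def strongResolvent : Fm [] :=
  .all X <| .all X <| .all Ty.one <| .all nat <|
    ltR (rtwo v0) v1 ⩑ eqX v2 (resA v1 v3) ⟹' memA (smulX (rinv v0 v1) (subX v3 v2)) v2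

/-- `∀ x u (∀ y v λ (v ∈ A y → ‖x - y + |λ| (u - v)‖ ≥ ‖x - y‖) → u ∈ A x)`. -/
def maximalAccretivity : Fm [] :=
  .all X <| .all X <|
    (.all X <| .all X <| .all Ty.one <|
      memA v1 v2 ⟹'
        leR (normX (subX v4 v2)) (normX (addX (subX v4 v2) (smulX (rabs v0) (subX v3 v1)))))
    ⟹' memA v0 v1

/-- `∀ x p (p = J_1 x → x - p ∈ A p)`. -/
def strongResolventOne : Fm [] :=
  .all X <| .all X <| eqX v0 (resA rone v1) ⟹' memA (subX v1 v0) v0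

/-- `∀ x u (∀ y v (v ∈ A y → ‖x - y + (u - v)‖ ≥ ‖x - y‖) → u ∈ A x)`. -/
def maximalAccretivityOne : Fm [] :=
  .all X <| .all X <|
    (.all X <| .all X <|
      memA v0 v1 ⟹' leR (normX (subX v3 v1)) (normX (addX (subX v3 v1) (subX v2 v0))))
    ⟹' memA v0 v1

/-- `z n → x`, i.e. `∀ k ∃ N ∀ m ≥ N (‖z m - x‖ ≤ 2 ^ (-k))`. -/
def converges {Γ : List Ty} (z : Tm Γ (nat ⇾ X)) (x : Tm Γ X) : Fm Γ :=
  .all nat <| .ex nat <| .all nat <|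
    leN v1 v0 ⟹' leR (normX (subX (z.wk.wk.wk ⬝ v0) x.wk.wk.wk)) (rtwo v2)

/-- `∀ x y (x_n) (y_n) (x_n → x ∧ y_n → y ∧ ∀ n (y_n ∈ A x_n) → y ∈ A x)`. -/
def closedGraph : Fm [] :=
  .all X <| .all X <| .all (nat ⇾ X) <| .all (nat ⇾ X) <|
    converges v1 v3 ⩑ converges v0 v2 ⩑ .all nat (memA (v1 ⬝ v0) (v2 ⬝ v0)) ⟹' memA v2 v3

/-- The six principles, in the order listed above. -/
def principle : Fin 6 → Fm [] :=
  ![extensionality, strongResolvent, maximalAccretivity, strongResolventOne,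
    maximalAccretivityOne, closedGraph]

end AccretiveSystem

/-! Instead of writing formal derivations, the proof shows a completeness theorem
(`derives_of_valid`) and then argues in models as an analyst would. The models are Henkin term
models, and the delicate point is equality. Only the weak rule of extensionality is available, so
pointwise equality at higher types, and likewise `=_X`, is no congruence. The term model therefore
identifies two terms when the theory makes them interchangeable in every term of type `0`. At type
`0` this is provable equality; at any type, terms that are provably equal without assumptions become
literally identical. The last fact is the field `ext` of `Str.IsModel`, and both follow from the
extensionality rule (`cl_eq_nat`, `cl_eq_of_derives`).

In such a model the combinator equations and the vector space laws are identities of elements and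
can be used under `χ_A`, whereas `x =_X y`, read as `NormLe (x - y) 0`, only says that the distance
is zero. The six principles are about this gap. The natural numbers of a model may be nonstandard,
so its rationals are built as a field of fractions over them, and a real becomes a sequence in that
field, compared up to arbitrary positive errors.

The principles are then linked in one cycle. Extensionality gives the strong resolvent axiom, since
`γ⁻¹ (x - p)` and `γ⁻¹ (x - J_γ x)` are at distance zero. The case `γ = 1` is an instance. It gives
maximal accretivity for `λ = 1`: testing the premise against `J_1 (x + u)` forces `x =_X J_1 (x +
u)`, hence `u = (x + u) - x ∈ A x`. Maximal accretivity for all `λ` has a stronger premise, so it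
follows. It gives closedness of the graph, because the accretivity inequality passes to limits.
Closedness gives extensionality by way of constant sequences. Completeness turns these implications,
valid in every model, into derivations. -/

namespace AccretiveSystem

open Ty Tm

/-! ### Calculus of substitutions -/

section Substitution

variable {Γ Δ Ξ : List Ty} {ρ τ : Ty}

/-- The identity substitution. -/
abbrev Sub.id (Γ : List Ty) : Sub Γ Γ := fun _ v => .var v

/-- The substitution that weakens by one variable. -/
abbrev Sub.shift (ρ : Ty) (Γ : List Ty) : Sub Γ (ρ :: Γ) := fun _ v => .var v.succ

abbrev Sub.comp (σ : Sub Γ Δ) (τ : Sub Δ Ξ) : Sub Γ Ξ := fun _ v => (σ v).subst τ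

theorem Tm.subst_subst (σ : Sub Γ Δ) (τ : Sub Δ Ξ) {ρ : Ty} (t : Tm Γ ρ) :
    (t.subst σ).subst τ = t.subst (σ.comp τ) := by
  induction t with
  | var v => rfl
  | con c => rfl
  | app f a hf ha => simp only [Tm.subst, hf, ha]

theorem Tm.subst_id {ρ : Ty} (t : Tm Γ ρ) : t.subst (Sub.id Γ) = t := by
  induction t with
  | var v => rfl
  | con c => rfl
  | app f a hf ha => simp only [Tm.subst, hf, ha]

theorem Sub.cons_zero (t : Tm Δ ρ) (σ : Sub Γ Δ) : Sub.cons t σ .zero = t := rfl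

theorem Sub.cons_succ (t : Tm Δ ρ) (σ : Sub Γ Δ) (v : Var Γ τ) :
    Sub.cons t σ v.succ = σ v := rfl

theorem Sub.ext_cons {σ τ : Sub (ρ :: Γ) Δ} (h0 : σ .zero = τ .zero)
    (h1 : ∀ ⦃α : Ty⦄ (v : Var Γ α), σ v.succ = τ v.succ) : σ = τ := by
  funext α v
  cases v with
  | zero => exact h0
  | succ v => exact h1 v

theorem Tm.wk_subst_cons (t : Tm Γ τ) (s : Tm Δ ρ) (σ : Sub Γ Δ) :
    t.wk.subst (Sub.cons s σ) = t.subst σ := by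
  rw [Tm.wk, Tm.subst_subst]; rfl

theorem Tm.wk_subst_lift (t : Tm Γ τ) (σ : Sub Γ Δ) :
    (t.wk (σ := ρ)).subst σ.lift = (t.subst σ).wk := by
  rw [Sub.lift, Tm.wk_subst_cons, Tm.wk, Tm.subst_subst]; rfl

theorem Sub.lift_comp_lift (σ : Sub Γ Δ) (τ : Sub Δ Ξ) :
    Sub.comp (Sub.lift (ρ := ρ) σ) τ.lift = (σ.comp τ).lift :=
  Sub.ext_cons rfl fun _ v => Tm.wk_subst_lift (σ v) τ

theorem Sub.lift_id : (Sub.id Γ).lift = Sub.id (ρ :: Γ) :=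
  Sub.ext_cons rfl fun _ _ => rfl

theorem Sub.lift_comp_cons (σ : Sub Γ Δ) (t : Tm Ξ ρ) (τ : Sub Δ Ξ) :
    Sub.comp σ.lift (Sub.cons t τ) = Sub.cons t (σ.comp τ) :=
  Sub.ext_cons rfl fun _ v => Tm.wk_subst_cons (σ v) t τ

theorem Sub.cons_comp (σ : Sub Γ Δ) (t : Tm Δ ρ) (τ : Sub Δ Ξ) :
    Sub.comp (Sub.cons t σ) τ = Sub.cons (t.subst τ) (σ.comp τ) :=
  Sub.ext_cons rfl fun _ _ => rfl

theorem Sub.id_comp (σ : Sub Γ Δ) : (Sub.id Γ).comp σ = σ := rfl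

theorem Sub.comp_id (σ : Sub Γ Δ) : σ.comp (Sub.id Δ) = σ := by
  funext α v; exact Tm.subst_id _

theorem Sub.shift_comp_cons (t : Tm Δ ρ) (σ : Sub Γ Δ) :
    Sub.comp (Sub.shift ρ Γ) (Sub.cons t σ) = σ := rfl

theorem Fm.subst_subst (φ : Fm Γ) : ∀ {Δ Ξ : List Ty} (σ : Sub Γ Δ) (τ : Sub Δ Ξ),
    (φ.subst σ).subst τ = φ.subst (σ.comp τ) := by
  induction φ with
  | eq s t => intros; simp only [Fm.subst, Tm.subst_subst]
  | and φ ψ h1 h2 => intros; simp only [Fm.subst, h1, h2]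
  | or φ ψ h1 h2 => intros; simp only [Fm.subst, h1, h2]
  | imp φ ψ h1 h2 => intros; simp only [Fm.subst, h1, h2]
  | all ρ φ h => intros; simp only [Fm.subst, h, Sub.lift_comp_lift]
  | ex ρ φ h => intros; simp only [Fm.subst, h, Sub.lift_comp_lift]

theorem Fm.subst_id (φ : Fm Γ) : φ.subst (Sub.id Γ) = φ := by
  induction φ with
  | eq s t => simp only [Fm.subst, Tm.subst_id]
  | and φ ψ h1 h2 => simp only [Fm.subst, h1, h2]
  | or φ ψ h1 h2 => simp only [Fm.subst, h1, h2]
  | imp φ ψ h1 h2 => simp only [Fm.subst, h1, h2]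
  | all ρ φ h => simp only [Fm.subst, Sub.lift_id, h]
  | ex ρ φ h => simp only [Fm.subst, Sub.lift_id, h]

theorem Fm.wk_subst_cons (φ : Fm Γ) (t : Tm Δ ρ) (σ : Sub Γ Δ) :
    φ.wk.subst (Sub.cons t σ) = φ.subst σ := by
  rw [Fm.wk, Fm.subst_subst]; rfl

theorem Fm.wk_subst_lift (φ : Fm Γ) (σ : Sub Γ Δ) :
    (φ.wk (σ := ρ)).subst σ.lift = (φ.subst σ).wk := by
  rw [Sub.lift, Fm.wk_subst_cons, Fm.wk, Fm.subst_subst]; rfl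

theorem Fm.wk_inst (φ : Fm Γ) (t : Tm Γ ρ) : φ.wk.inst t = φ := by
  rw [Fm.inst, Fm.wk_subst_cons, Fm.subst_id]

theorem Fm.inst_subst (φ : Fm (ρ :: Γ)) (t : Tm Γ ρ) (σ : Sub Γ Δ) :
    (φ.inst t).subst σ = (φ.subst σ.lift).inst (t.subst σ) := by
  simp only [Fm.inst, Fm.subst_subst, Sub.cons_comp, Sub.lift_comp_cons, Sub.comp_id, Sub.id_comp]

theorem Fm.subst_lift_inst (φ : Fm (ρ :: Γ)) (t : Tm Δ ρ) (σ : Sub Γ Δ) :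
    (φ.subst σ.lift).inst t = φ.subst (Sub.cons t σ) := by
  simp only [Fm.inst, Fm.subst_subst, Sub.lift_comp_cons, Sub.comp_id]

theorem Tm.inst_subst (r : Tm (ρ :: Γ) τ) (t : Tm Γ ρ) (σ : Sub Γ Δ) :
    (r.inst t).subst σ = (r.subst σ.lift).inst (t.subst σ) := by
  simp only [Tm.inst, Tm.subst_subst, Sub.cons_comp, Sub.lift_comp_cons, Sub.comp_id, Sub.id_comp]

theorem Fm.subst_map_wk (H : List (Fm Γ)) (σ : Sub Γ Δ) :
    (H.map (Fm.wk (σ := ρ))).map (Fm.subst σ.lift) = (H.map (Fm.subst σ)).map Fm.wk := by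
  simp only [List.map_map]
  congr 1
  funext φ
  exact Fm.wk_subst_lift φ σ

theorem Fm.QF.subst {φ : Fm Γ} (h : φ.QF) : ∀ {Δ : List Ty} (σ : Sub Γ Δ), (φ.subst σ).QF := by
  induction φ with
  | eq s t => intros; trivial
  | and φ ψ h1 h2 => exact fun σ => ⟨h1 h.1 σ, h2 h.2 σ⟩
  | or φ ψ h1 h2 => exact fun σ => ⟨h1 h.1 σ, h2 h.2 σ⟩
  | imp φ ψ h1 h2 => exact fun σ => ⟨h1 h.1 σ, h2 h.2 σ⟩
  | all ρ φ _ => exact h.elim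
  | ex ρ φ _ => exact h.elim

theorem Tm.emb_subst (t : Tm [] ρ) (σ : Sub Γ Δ) : (t.emb (Γ := Γ)).subst σ = t.emb := by
  rw [Tm.emb, Tm.subst_subst, Tm.emb]
  congr 1
  funext α v
  cases v

theorem apps_subst : ∀ {ρs : List Ty} {τ : Ty} (f : Tm Γ (arrows ρs τ)) (a : Sub ρs Γ)
    (σ : Sub Γ Δ), (Tm.apps f a).subst σ = Tm.apps (f.subst σ) (a.comp σ)
  | [], _, _, _, _ => rfl
  | _ :: ρs, τ, f, a, σ => by
    simp only [Tm.apps]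
    rw [apps_subst]
    rfl

theorem recTm_subst (ρs : List Ty) (i : Var ρs ρ) (x : Tm Γ nat) (y : Sub ρs Γ)
    (z : Sub (ρs.map (stepTy ρs)) Γ) (σ : Sub Γ Δ) :
    (recTm ρs i x y z).subst σ = recTm ρs i (x.subst σ) (y.comp σ) (z.comp σ) := by
  simp only [recTm]
  rw [apps_subst, apps_subst]
  rfl

end Substitution

/-! ### Substitutions on concatenated contexts and the choice schemata -/

section Append

variable {Γ Δ Ξ : List Ty} {ρ τ : Ty}

@[elab_as_elim]
theorem Var.append_cases {Ξ Γ : List Ty} {motive : ∀ ⦃ρ⦄, Var (Ξ ++ Γ) ρ → Prop}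
    (inl : ∀ ⦃ρ⦄ (v : Var Ξ ρ), motive (v.inl Γ)) (inr : ∀ ⦃ρ⦄ (v : Var Γ ρ), motive (v.inr Ξ))
    {ρ : Ty} (v : Var (Ξ ++ Γ) ρ) : motive v := by
  induction Ξ generalizing ρ with
  | nil => exact inr v
  | cons α Ξ ih =>
    cases v with
    | zero => exact inl .zero
    | succ v =>
      exact ih (motive := fun ρ v => motive (ρ := ρ) (Var.succ v)) (fun ρ v => inl v.succ)
        (fun ρ v => inr v) v

theorem Sub.append_inl (σ : Sub Ξ Δ) (τ : Sub Γ Δ) {ρ : Ty} (v : Var Ξ ρ) :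
    Sub.append σ τ (v.inl Γ) = σ v := by
  induction v with
  | zero => rfl
  | succ v ih => exact ih _

theorem Sub.append_inr : ∀ {Ξ : List Ty} (σ : Sub Ξ Δ) (τ : Sub Γ Δ) {ρ : Ty} (v : Var Γ ρ),
    Sub.append σ τ (v.inr Ξ) = τ v
  | [], _, _, _, _ => rfl
  | _ :: _, σ, τ, _, v => Sub.append_inr (fun _ v => σ v.succ) τ v

/-- Extension of a substitution under a list of binders. -/
def Sub.lifts : (ρs : List Ty) → Sub Γ Δ → Sub (ρs ++ Γ) (ρs ++ Δ)
  | [], σ => σ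
  | _ :: ρs, σ => Sub.lift (Sub.lifts ρs σ)

theorem Sub.lifts_inl (σ : Sub Γ Δ) {ρs : List Ty} {ρ : Ty} (v : Var ρs ρ) :
    Sub.lifts ρs σ (v.inl Γ) = .var (v.inl Δ) := by
  induction v with
  | zero => rfl
  | succ v ih =>
    change (Sub.lifts _ σ (v.inl Γ)).wk = _
    rw [ih]; rfl

/-- Weakening by a list of variables. -/
def Tm.wks : (ρs : List Ty) → Tm Γ ρ → Tm (ρs ++ Γ) ρ :=
  fun ρs t => t.subst fun _ v => .var (v.inr ρs)

theorem Sub.lifts_inr (σ : Sub Γ Δ) : ∀ (ρs : List Ty) {ρ : Ty} (v : Var Γ ρ),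
    Sub.lifts ρs σ (v.inr ρs) = (σ v).wks ρs
  | [], _, v => (Tm.subst_id (σ v)).symm
  | α :: ρs, _, v => by
    change (Sub.lifts ρs σ (v.inr ρs)).wk = _
    rw [Sub.lifts_inr σ ρs v, Tm.wks, Tm.wk, Tm.subst_subst]; rfl

theorem alls_subst : ∀ (ρs : List Ty) (φ : Fm (ρs ++ Γ)) (σ : Sub Γ Δ),
    (Fm.alls ρs φ).subst σ = Fm.alls ρs (φ.subst (Sub.lifts ρs σ))
  | [], _, _ => rfl
  | _ :: ρs, φ, σ => alls_subst ρs (.all _ φ) σ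

theorem exs_subst : ∀ (ρs : List Ty) (φ : Fm (ρs ++ Γ)) (σ : Sub Γ Δ),
    (Fm.exs ρs φ).subst σ = Fm.exs ρs (φ.subst (Sub.lifts ρs σ))
  | [], _, _ => rfl
  | _ :: ρs, φ, σ => exs_subst ρs (.ex _ φ) σ

theorem Tm.wks_subst_append (t : Tm Γ ρ) (a : Sub Ξ Δ) (b : Sub Γ Δ) :
    (t.wks Ξ).subst (Sub.append a b) = t.subst b := by
  rw [Tm.wks, Tm.subst_subst]
  congr 1
  funext α v
  exact Sub.append_inr a b v

/-- The bound functionals and their arguments are untouched by `σ`, which only acts on the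
parameters in `Γ`. This is what makes a substituted instance of choice an instance again. -/
theorem choiceSub_comp (xs ys : List Ty) (σ : Sub Γ Δ) :
    (choiceSub Γ xs ys).comp (Sub.lifts xs (Sub.lifts (ys.map (arrows xs)) σ)) =
      (Sub.lifts ys (Sub.lifts xs σ)).comp (choiceSub Δ xs ys) := by
  funext ρ v
  refine Var.append_cases (fun ρ v => ?_) (fun ρ v => ?_) v
  · simp only [Sub.comp, Sub.lifts_inl, Tm.subst, choiceSub, Sub.append_inl, apps_subst]
    congr 1
    · simp only [Tm.subst, Sub.lifts_inr, Sub.lifts_inl, Tm.wks]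
    · funext α k
      simp only [Sub.comp, Tm.subst, Sub.lifts_inl]
  · refine Var.append_cases (fun ρ v => ?_) (fun ρ v => ?_) v
    · simp only [Sub.comp, Sub.lifts_inr, Sub.lifts_inl, Tm.subst, choiceSub, Sub.append_inr,
        Sub.append_inl, Tm.wks]
    · simp only [Sub.comp, Sub.lifts_inr, choiceSub, Tm.wks_subst_append, Sub.append_inr, Tm.subst]
      simp only [Tm.wks, Tm.subst_subst]
      rfl

theorem depSub_comp (ρs : List Ty) (σ : Sub Γ Δ) :
    (depSub Γ ρs).comp (Sub.lift (Sub.lifts (ρs.map (Ty.arr nat)) σ)) =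
      (Sub.lifts ρs (Sub.lifts ρs (Sub.lift (ρ := nat) σ))).comp (depSub Δ ρs) := by
  funext ρ v
  refine Var.append_cases (fun ρ v => ?_) (fun ρ v => ?_) v
  · simp only [Sub.comp, Sub.lifts_inl, Tm.subst, depSub, Sub.append_inl, succ]
    simp only [Sub.lift, Sub.cons_succ, Sub.lifts_inl, v0, Tm.subst, Sub.cons_zero]
    rfl
  · refine Var.append_cases (fun ρ v => ?_) (fun ρ v => ?_) v
    · simp only [Sub.comp, Sub.lifts_inl, Sub.lifts_inr, Tm.wks, Tm.subst, depSub, Sub.append_inl,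
        Sub.append_inr]
      simp only [Sub.lift, Sub.cons_succ, Sub.lifts_inl, v0, Tm.subst, Sub.cons_zero]
      rfl
    · simp only [Sub.comp, Sub.lifts_inr, depSub, Tm.wks_subst_append, Sub.append_inr]
      cases v with
      | zero => rfl
      | succ v =>
        simp only [Sub.lift, Sub.cons_succ, Tm.subst, Sub.lifts_inr, Tm.wk_subst_cons]
        simp only [Tm.wks, Tm.wk, Tm.subst_subst]
        rfl

end Append

/-! ### Substitution in defined notions; closure of the axioms under substitution -/

section SubstitutionOfDefined

variable {Γ Δ : List Ty} {ρ τ : Ty}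

theorem rmul_subst (s t : Tm Γ Ty.one) (σ : Sub Γ Δ) :
    (rmul s t).subst σ = rmul (s.subst σ) (t.subst σ) := by
  simp only [rmul, Tm.subst, Tm.emb_subst]

theorem radd_subst (s t : Tm Γ Ty.one) (σ : Sub Γ Δ) :
    (radd s t).subst σ = radd (s.subst σ) (t.subst σ) := by
  simp only [radd, Tm.subst, Tm.emb_subst]

theorem rsub_subst (s t : Tm Γ Ty.one) (σ : Sub Γ Δ) :
    (rsub s t).subst σ = rsub (s.subst σ) (t.subst σ) := by
  simp only [rsub, Tm.subst, Tm.emb_subst]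

theorem rabs_subst (s : Tm Γ Ty.one) (σ : Sub Γ Δ) :
    (rabs s).subst σ = rabs (s.subst σ) := by
  simp only [rabs, Tm.subst, Tm.emb_subst]

theorem rinv_subst (l : Tm Γ nat) (s : Tm Γ Ty.one) (σ : Sub Γ Δ) :
    (rinv l s).subst σ = rinv (l.subst σ) (s.subst σ) := by
  simp only [rinv, Tm.subst, Tm.emb_subst]

theorem rtwo_subst (l : Tm Γ nat) (σ : Sub Γ Δ) : (rtwo l).subst σ = rtwo (l.subst σ) := by
  simp only [rtwo, rrat, qtwo, Tm.subst, Tm.emb_subst]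

theorem rzero_subst (σ : Sub Γ Δ) : (rzero : Tm Γ Ty.one).subst σ = rzero := by
  simp only [rzero, rrat, qnat, pair, mul, nTwo, nOne, succ, zero, Tm.subst, Tm.emb_subst]

theorem rone_subst (σ : Sub Γ Δ) : (rone : Tm Γ Ty.one).subst σ = rone := by
  simp only [rone, rrat, qnat, pair, mul, nTwo, nOne, succ, zero, Tm.subst, Tm.emb_subst]

theorem eqR_subst (s t : Tm Γ Ty.one) (σ : Sub Γ Δ) :
    (eqR s t).subst σ = eqR (s.subst σ) (t.subst σ) := by
  simp only [eqR, ltQ, leQ, Fm.neg, Fm.bot, Fm.subst, qle, qabs, qsub, qadd, qneg, hat, qtwo, succ,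
    nOne, zero, Tm.subst, Tm.emb_subst, Tm.wk_subst_lift, v0]
  rfl

theorem ltR_subst (s t : Tm Γ Ty.one) (σ : Sub Γ Δ) :
    (ltR s t).subst σ = ltR (s.subst σ) (t.subst σ) := by
  simp only [ltR, leQ, Fm.subst, qle, qsub, qadd, qneg, hat, qtwo, succ, zero, Tm.subst, Tm.emb_subst, Tm.wk_subst_lift, v0]
  rfl

theorem leR_subst (s t : Tm Γ Ty.one) (σ : Sub Γ Δ) :
    (leR s t).subst σ = leR (s.subst σ) (t.subst σ) := by
  simp only [leR, Fm.neg, Fm.subst, ltR_subst]; rfl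

theorem eqX_subst (s t : Tm Γ X) (σ : Sub Γ Δ) :
    (eqX s t).subst σ = eqX (s.subst σ) (t.subst σ) := by
  simp only [eqX, eqR_subst, rzero_subst]; rfl

theorem eqT_subst : ∀ {Γ Δ : List Ty} (ρ : Ty) (s t : Tm Γ ρ) (σ : Sub Γ Δ),
    (eqT ρ s t).subst σ = eqT ρ (s.subst σ) (t.subst σ)
  | _, _, .nat, _, _, _ => rfl
  | _, _, .X, s, t, σ => eqX_subst s t σ
  | _, _, .arr ρ τ, s, t, σ => by
    simp only [eqT, Fm.subst, eqT_subst, Tm.subst, Tm.wk_subst_lift]; rfl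

theorem leN_subst (s t : Tm Γ nat) (σ : Sub Γ Δ) :
    (leN s t).subst σ = leN (s.subst σ) (t.subst σ) := by
  simp only [leN, Fm.subst, sub, Tm.subst, Tm.emb_subst]; rfl

theorem ArithAx.subst {φ : Fm Γ} (h : ArithAx φ) (σ : Sub Γ Δ) : ArithAx (φ.subst σ) := by
  cases h with
  | eqRefl s => exact .eqRefl _
  | eqSymm s t => exact .eqSymm _ _
  | eqTrans s t r => exact .eqTrans _ _ _
  | succNe s => exact .succNe _
  | succInj s t => exact .succInj _ _
  | induction φ =>
    convert ArithAx.induction (φ.subst σ.lift) using 1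
    simp only [Fm.subst, Fm.inst_subst, Fm.subst_subst, Sub.cons_comp, Sub.lift_comp_cons]
    rfl
  | proj s t => rw [eqT_subst]; exact .proj _ _
  | sigma s t r => rw [eqT_subst]; exact .sigma _ _ _
  | recZero ρs i y z => rw [eqT_subst, recTm_subst]; exact .recZero ρs i (y.comp σ) (z.comp σ)
  | recSucc ρs i x y z =>
    rw [eqT_subst, recTm_subst]
    convert ArithAx.recSucc ρs i (x.subst σ) (y.comp σ) (z.comp σ) using 1
    congr 1
    simp only [Tm.subst]
    rw [apps_subst]
    congr 2
    funext α k
    exact recTm_subst _ _ _ _ _ _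

theorem ChoiceAx.subst {φ : Fm Γ} (h : ChoiceAx φ) (σ : Sub Γ Δ) : ChoiceAx (φ.subst σ) := by
  cases h with
  | qfAC xs ys φ hφ =>
    simp only [Fm.subst, alls_subst, exs_subst, Fm.subst_subst]
    rw [choiceSub_comp, ← Fm.subst_subst]
    exact .qfAC xs ys _ (hφ.subst _)
  | dc ρs φ =>
    simp only [Fm.subst, alls_subst, exs_subst, Fm.subst_subst]
    rw [depSub_comp, ← Fm.subst_subst]
    exact .dc ρs _

theorem NormAx.subst {φ : Fm Γ} (h : NormAx φ) (σ : Sub Γ Δ) : NormAx (φ.subst σ) := by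
  cases h <;>
    simp only [eqX_subst, eqR_subst, leR_subst, addX, subX, negX, smulX, normX, zeroX, oneX,
      Tm.subst, radd_subst, rmul_subst, rsub_subst, rabs_subst, rzero_subst, rone_subst]
  · exact .addComm _ _
  · exact .addAssoc _ _ _
  · exact .addZero _
  · exact .addNeg _
  · exact .oneSmul _
  · exact .mulSmul _ _ _
  · exact .addSmul _ _ _
  · exact .smulAdd _ _ _
  · exact .normSelf _
  · exact .normSymm _ _
  · exact .normTriangle _ _ _
  · exact .normSmul _ _ _
  · exact .normSmulSub _ _ _
  · exact .normAdd _ _ _ _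
  · exact .normNeg _ _
  · exact .normSub _ _
  · exact .normOne

theorem OperatorAx.subst {φ : Fm Γ} (h : OperatorAx φ) (σ : Sub Γ Δ) :
    OperatorAx (φ.subst σ) := by
  cases h with
  | chiLe x y => rw [leN_subst]; exact .chiLe _ _
  | resolvent γ x l =>
    simp only [Fm.subst, ltR_subst, rtwo_subst, memA, smulX, subX, addX, negX, resA, zero,
      Tm.subst, rinv_subst]
    exact .resolvent _ _ _
  | accretive x y u v r =>
    simp only [Fm.subst, leR_subst, memA, smulX, subX, addX, negX, normX, zero,
      Tm.subst, rabs_subst]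
    exact .accretive _ _ _ _ _
  | gamGe => rw [leR_subst, rtwo_subst]; exact .gamGe

end SubstitutionOfDefined

/-! ### Admissible rules -/

section Rules

variable {Γ Δ : List Ty} {ρ : Ty} {H : List (Fm Γ)} {φ ψ : Fm Γ}

/-- The extensionality rule is no obstacle: its premise has no assumptions and its conclusion is
available over every list. -/
theorem Derives.mono (h : Derives H φ) : ∀ {H' : List (Fm Γ)}, H ⊆ H' → Derives H' φ := by
  induction h with
  | arith h => exact fun _ => .arith h
  | choice h => exact fun _ => .choice h
  | norm h => exact fun _ => .norm h
  | operator h => exact fun _ => .operator h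
  | qfER φ s t r hφ h _ => exact fun _ => .qfER φ s t r hφ h
  | hyp h => exact fun hs => .hyp (hs h)
  | andI _ _ h1 h2 => exact fun hs => .andI (h1 hs) (h2 hs)
  | andL _ h => exact fun hs => .andL (h hs)
  | andR _ h => exact fun hs => .andR (h hs)
  | orL _ h => exact fun hs => .orL (h hs)
  | orR _ h => exact fun hs => .orR (h hs)
  | orE _ _ _ h h1 h2 =>
    exact fun hs => .orE (h hs) (h1 (List.cons_subset_cons _ hs)) (h2 (List.cons_subset_cons _ hs))
  | impI _ h => exact fun hs => .impI (h (List.cons_subset_cons _ hs))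
  | impE _ _ h1 h2 => exact fun hs => .impE (h1 hs) (h2 hs)
  | allI _ h => exact fun hs => .allI (h (List.map_subset _ hs))
  | allE t _ h => exact fun hs => .allE t (h hs)
  | exI t _ h => exact fun hs => .exI t (h hs)
  | exE _ _ h1 h2 =>
    exact fun hs => .exE (h1 hs) (h2 (List.cons_subset_cons _ (List.map_subset _ hs)))
  | botE _ h => exact fun hs => .botE (h hs)
  | em φ => exact fun _ => .em φ

/-- Since all axioms are schemata over every context, derivations can be moved between contexts. The
Henkin construction depends on this, because its new constants are fresh variables. -/
theorem Derives.subst (h : Derives H φ) :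
    ∀ {Δ : List Ty} (σ : Sub Γ Δ), Derives (H.map (Fm.subst σ)) (φ.subst σ) := by
  induction h with
  | arith h => exact fun σ => .arith (h.subst σ)
  | choice h => exact fun σ => .choice (h.subst σ)
  | norm h => exact fun σ => .norm (h.subst σ)
  | operator h => exact fun σ => .operator (h.subst σ)
  | qfER φ s t r hφ h ih =>
    intro Δ σ
    have := ih σ
    simp only [Fm.subst, eqT_subst, Tm.inst_subst, List.map_nil] at this ⊢
    exact .qfER _ _ _ _ (hφ.subst σ) this
  | hyp h => exact fun σ => .hyp (List.mem_map_of_mem h)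
  | andI _ _ h1 h2 => exact fun σ => .andI (h1 σ) (h2 σ)
  | andL _ h => exact fun σ => .andL (h σ)
  | andR _ h => exact fun σ => .andR (h σ)
  | orL _ h => exact fun σ => .orL (h σ)
  | orR _ h => exact fun σ => .orR (h σ)
  | orE _ _ _ h h1 h2 => exact fun σ => .orE (h σ) (h1 σ) (h2 σ)
  | impI _ h => exact fun σ => .impI (h σ)
  | impE _ _ h1 h2 => exact fun σ => .impE (h1 σ) (h2 σ)
  | allI _ h =>
    intro Δ σ
    have := h σ.lift
    rw [Fm.subst_map_wk] at this
    exact .allI this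
  | allE t _ h => intro Δ σ; rw [Fm.inst_subst]; exact .allE _ (h σ)
  | exI t _ h => intro Δ σ; have := h σ; rw [Fm.inst_subst] at this; exact .exI _ this
  | exE _ _ h1 h2 =>
    intro Δ σ
    have := h2 σ.lift
    rw [List.map_cons, Fm.subst_map_wk, Fm.wk_subst_lift] at this
    exact .exE (h1 σ) this
  | botE _ h => exact fun σ => .botE (h σ)
  | em φ => exact fun σ => .em _

theorem Derives.cut (h : Derives H φ) (h' : Derives (φ :: H) ψ) : Derives H ψ :=
  .impE (.impI h') h

theorem Derives.wk (h : Derives H φ) : Derives (H.map Fm.wk) (φ.wk (σ := ρ)) := h.subst _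

theorem Derives.weaken (h : Derives [] φ) : Derives H φ := h.mono (List.nil_subset _)

theorem Derives.head : Derives (φ :: H) φ := .hyp List.mem_cons_self

theorem Derives.second : Derives (ψ :: φ :: H) φ :=
  .hyp (List.mem_cons_of_mem _ List.mem_cons_self)

/-- Proof by contradiction. -/
theorem Derives.byContra (h : Derives (φ.neg :: H) Fm.bot) : Derives H φ :=
  .orE (.em φ) .head (.botE h)

theorem Derives.allE_cons {φ : Fm (ρ :: Γ)} {σ : Sub Γ Δ} {H : List (Fm Δ)} (t : Tm Δ ρ)
    (h : Derives H ((Fm.all ρ φ).subst σ)) : Derives H (φ.subst (Sub.cons t σ)) := by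
  rw [← Fm.subst_lift_inst]; exact .allE t h

theorem Derives.exI_cons {φ : Fm (ρ :: Γ)} {σ : Sub Γ Δ} {H : List (Fm Δ)} (t : Tm Δ ρ)
    (h : Derives H (φ.subst (Sub.cons t σ))) : Derives H ((Fm.ex ρ φ).subst σ) := by
  rw [← Fm.subst_lift_inst] at h; exact .exI t h

theorem Derives.all_of_neg_ex_neg {φ : Fm (ρ :: Γ)} :
    Derives ((Fm.ex ρ φ.neg).neg :: H) (Fm.all ρ φ) := by
  refine .allI (.byContra (.impE (φ := (Fm.ex ρ φ.neg).wk) ?_ ?_))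
  · exact .hyp (List.mem_cons_of_mem _ List.mem_cons_self)
  · refine .exI_cons v0 ?_
    have : φ.neg.subst (Sub.cons v0 (Sub.shift ρ Γ)) = φ.neg := by
      conv_rhs => rw [← Fm.subst_id φ.neg]
      congr 1
      exact Sub.ext_cons rfl fun _ _ => rfl
    rw [this]
    exact .head

end Rules

/-- A closed term of each type. -/
def closedTm : (ρ : Ty) → Tm [] ρ
  | .nat => zero
  | .X => zeroX
  | .arr ρ τ => .con (.proj τ ρ) ⬝ closedTm τ

/-! ### Countability of the language -/

/-- Countability is needed because the Henkin construction treats one formula per stage. -/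
def Ty.code : Ty → ℕ
  | .nat => 0
  | .X => 1
  | .arr ρ τ => Nat.pair ρ.code τ.code + 2

theorem Ty.code_injective : Function.Injective Ty.code := by
  intro ρ
  induction ρ with
  | nat => intro τ h; cases τ <;> simp_all [Ty.code]
  | X => intro τ h; cases τ <;> simp_all [Ty.code]
  | arr ρ σ h1 h2 =>
    intro τ h
    cases τ with
    | nat => simp [Ty.code] at h
    | X => simp [Ty.code] at h
    | arr ρ' σ' =>
      simp only [Ty.code, Nat.add_right_cancel_iff, Nat.pair_eq_pair] at h
      rw [h1 h.1, h2 h.2]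

instance : Countable Ty := Ty.code_injective.countable

def Var.idx : {Γ : List Ty} → {ρ : Ty} → Var Γ ρ → ℕ
  | _, _, .zero => 0
  | _, _, .succ v => v.idx + 1

theorem Var.idx_injective {Γ : List Ty} {ρ ρ' : Ty} (v : Var Γ ρ) (v' : Var Γ ρ')
    (h : v.idx = v'.idx) : (⟨ρ, v⟩ : Σ ρ, Var Γ ρ) = ⟨ρ', v'⟩ := by
  induction v with
  | zero =>
    cases v' with
    | zero => rfl
    | succ v' => simp [Var.idx] at h
  | succ v ih =>
    cases v' with
    | zero => simp [Var.idx] at h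
    | succ v' =>
      cases ih v' (by simpa [Var.idx] using h)
      rfl

instance (Γ : List Ty) : Countable (Σ ρ, Var Γ ρ) :=
  Function.Injective.countable (f := fun v : Σ ρ, Var Γ ρ => v.2.idx)
    fun ⟨_, v⟩ ⟨_, v'⟩ h => Var.idx_injective v v' h

instance : Countable (Σ ρ, Con ρ) := by
  let simple : Fin 12 → Σ ρ, Con ρ :=
    ![⟨_, .zero⟩, ⟨_, .succ⟩, ⟨_, .zeroX⟩, ⟨_, .oneX⟩, ⟨_, .addX⟩, ⟨_, .negX⟩, ⟨_, .smulX⟩,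
      ⟨_, .normX⟩, ⟨_, .chi⟩, ⟨_, .res⟩, ⟨_, .gam⟩, ⟨_, .mGam⟩]
  let f : Fin 12 ⊕ Unit ⊕ (Ty × Ty) ⊕ (Ty × Ty × Ty) ⊕ (Σ ρs, Σ ρ, Var ρs ρ) → Σ ρ, Con ρ :=
    Sum.elim simple <| Sum.elim (fun _ => ⟨_, .cX⟩) <| Sum.elim (fun p => ⟨_, .proj p.1 p.2⟩) <|
      Sum.elim (fun p => ⟨_, .sigma p.1 p.2.1 p.2.2⟩) fun p => ⟨_, .recr p.1 p.2.2⟩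
  refine Function.Surjective.countable (f := f) ?_
  rintro ⟨_, c⟩
  cases c with
  | zero => exact ⟨.inl 0, rfl⟩
  | succ => exact ⟨.inl 1, rfl⟩
  | proj ρ τ => exact ⟨.inr (.inr (.inl ⟨ρ, τ⟩)), rfl⟩
  | sigma δ ρ τ => exact ⟨.inr (.inr (.inr (.inl ⟨δ, ρ, τ⟩))), rfl⟩
  | recr ρs i => exact ⟨.inr (.inr (.inr (.inr ⟨ρs, _, i⟩))), rfl⟩
  | zeroX => exact ⟨.inl 2, rfl⟩
  | oneX => exact ⟨.inl 3, rfl⟩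
  | addX => exact ⟨.inl 4, rfl⟩
  | negX => exact ⟨.inl 5, rfl⟩
  | smulX => exact ⟨.inl 6, rfl⟩
  | normX => exact ⟨.inl 7, rfl⟩
  | chi => exact ⟨.inl 8, rfl⟩
  | res => exact ⟨.inl 9, rfl⟩
  | gam => exact ⟨.inl 10, rfl⟩
  | mGam => exact ⟨.inl 11, rfl⟩
  | cX => exact ⟨.inr (.inl ()), rfl⟩

noncomputable def Con.code {ρ : Ty} (c : Con ρ) : ℕ :=
  (exists_injective_nat (Σ ρ, Con ρ)).choose ⟨ρ, c⟩

theorem Con.code_injective {ρ ρ' : Ty} (c : Con ρ) (c' : Con ρ') (h : c.code = c'.code) :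
    (⟨ρ, c⟩ : Σ ρ, Con ρ) = ⟨ρ', c'⟩ :=
  (exists_injective_nat (Σ ρ, Con ρ)).choose_spec h

noncomputable def Tm.code {Γ : List Ty} : {ρ : Ty} → Tm Γ ρ → ℕ
  | _, .var v => Nat.pair 0 v.idx
  | _, .con c => Nat.pair 1 c.code
  | _, .app f a => Nat.pair 2 (Nat.pair f.code a.code)

/-- The types are part of the conclusion because the type of `f ⬝ a` does not determine that of `a`;
the induction has to recover it from the codes. -/
theorem Tm.code_injective {Γ : List Ty} {ρ ρ' : Ty} (t : Tm Γ ρ) (t' : Tm Γ ρ')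
    (h : t.code = t'.code) : (⟨ρ, t⟩ : Σ ρ, Tm Γ ρ) = ⟨ρ', t'⟩ := by
  induction t generalizing ρ' with
  | var v =>
    cases t' <;> simp only [Tm.code, Nat.pair_eq_pair] at h
    · cases Var.idx_injective _ _ h.2; rfl
    all_goals omega
  | con c =>
    cases t' <;> simp only [Tm.code, Nat.pair_eq_pair] at h
    on_goal 2 => cases Con.code_injective _ _ h.2; rfl
    all_goals omega
  | app f a hf ha =>
    cases t' <;> simp only [Tm.code, Nat.pair_eq_pair] at h
    on_goal 3 => cases hf _ h.2.1; cases ha _ h.2.2; rfl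
    all_goals omega

noncomputable def Fm.code : {Γ : List Ty} → Fm Γ → ℕ
  | _, .eq s t => Nat.pair 0 (Nat.pair s.code t.code)
  | _, .and φ ψ => Nat.pair 1 (Nat.pair φ.code ψ.code)
  | _, .or φ ψ => Nat.pair 2 (Nat.pair φ.code ψ.code)
  | _, .imp φ ψ => Nat.pair 3 (Nat.pair φ.code ψ.code)
  | _, .all ρ φ => Nat.pair 4 (Nat.pair ρ.code φ.code)
  | _, .ex ρ φ => Nat.pair 5 (Nat.pair ρ.code φ.code)

theorem Fm.code_injective {Γ : List Ty} : Function.Injective (Fm.code (Γ := Γ)) := by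
  intro φ
  induction φ with
  | eq s t =>
    intro φ' h
    cases φ' <;> simp only [Fm.code, Nat.pair_eq_pair] at h
    on_goal 1 => cases Tm.code_injective _ _ h.2.1; cases Tm.code_injective _ _ h.2.2; rfl
    all_goals omega
  | and φ ψ h1 h2 =>
    intro φ' h
    cases φ' <;> simp only [Fm.code, Nat.pair_eq_pair] at h
    on_goal 2 => cases h1 h.2.1; cases h2 h.2.2; rfl
    all_goals omega
  | or φ ψ h1 h2 =>
    intro φ' h
    cases φ' <;> simp only [Fm.code, Nat.pair_eq_pair] at h
    on_goal 3 => cases h1 h.2.1; cases h2 h.2.2; rfl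
    all_goals omega
  | imp φ ψ h1 h2 =>
    intro φ' h
    cases φ' <;> simp only [Fm.code, Nat.pair_eq_pair] at h
    on_goal 4 => cases h1 h.2.1; cases h2 h.2.2; rfl
    all_goals omega
  | all ρ φ h1 =>
    intro φ' h
    cases φ' <;> simp only [Fm.code, Nat.pair_eq_pair] at h
    on_goal 5 => cases Ty.code_injective h.2.1; cases h1 h.2.2; rfl
    all_goals omega
  | ex ρ φ h1 =>
    intro φ' h
    cases φ' <;> simp only [Fm.code, Nat.pair_eq_pair] at h
    on_goal 6 => cases Ty.code_injective h.2.1; cases h1 h.2.2; rfl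
    all_goals omega

instance (Γ : List Ty) : Countable (Fm Γ) := Fm.code_injective.countable

instance (Γ : List Ty) : Nonempty (Fm Γ) := ⟨Fm.bot⟩

instance : Nonempty Ty := ⟨.nat⟩

/-! ### Structures and truth -/

/-- A structure for the language; `=_0` is interpreted by equality. -/
structure Str where
  D : Ty → Type
  app {ρ τ : Ty} : D (ρ ⇾ τ) → D ρ → D τ
  con {ρ : Ty} : Con ρ → D ρ

/-- Assignments of elements to the variables of a context. -/
abbrev Env (M : Str) (Γ : List Ty) : Type := ∀ ⦃ρ : Ty⦄, Var Γ ρ → M.D ρ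

namespace Env

variable {M : Str} {Γ : List Ty} {ρ : Ty}

def nil : Env M [] := fun _ v => nomatch v

def cons (d : M.D ρ) (e : Env M Γ) : Env M (ρ :: Γ)
  | _, .zero => d
  | _, .succ v => e v

theorem ext_cons {e e' : Env M (ρ :: Γ)} (h0 : e .zero = e' .zero)
    (h1 : ∀ ⦃α : Ty⦄ (v : Var Γ α), e v.succ = e' v.succ) : e = e' := by
  funext α v
  cases v with
  | zero => exact h0
  | succ v => exact h1 v

end Env

section Semantics

variable {M : Str} {Γ Δ : List Ty} {ρ τ : Ty}

def Tm.ev (e : Env M Γ) : {ρ : Ty} → Tm Γ ρ → M.D ρ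
  | _, .var v => e v
  | _, .con c => M.con c
  | _, .app f a => M.app (f.ev e) (a.ev e)

def Fm.sat : {Γ : List Ty} → Env M Γ → Fm Γ → Prop
  | _, e, .eq s t => s.ev e = t.ev e
  | _, e, .and φ ψ => φ.sat e ∧ ψ.sat e
  | _, e, .or φ ψ => φ.sat e ∨ ψ.sat e
  | _, e, .imp φ ψ => φ.sat e → ψ.sat e
  | _, e, .all ρ φ => ∀ d : M.D ρ, φ.sat (Env.cons d e)
  | _, e, .ex ρ φ => ∃ d : M.D ρ, φ.sat (Env.cons d e)

theorem Tm.ev_subst (e : Env M Δ) (σ : Sub Γ Δ) (t : Tm Γ ρ) :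
    (t.subst σ).ev e = t.ev fun _ v => (σ v).ev e := by
  induction t with
  | var v => rfl
  | con c => rfl
  | app f a hf ha => simp only [Tm.subst, Tm.ev, hf, ha]

theorem Tm.ev_wk (e : Env M Γ) (d : M.D ρ) (t : Tm Γ τ) : t.wk.ev (Env.cons d e) = t.ev e := by
  rw [Tm.wk, Tm.ev_subst]; rfl

theorem Tm.ev_emb (e : Env M Γ) (t : Tm [] ρ) : (t.emb (Γ := Γ)).ev e = t.ev Env.nil := by
  rw [Tm.emb, Tm.ev_subst]
  congr 1
  funext α v
  cases v

theorem Fm.sat_subst (φ : Fm Γ) : ∀ {Δ : List Ty} (e : Env M Δ) (σ : Sub Γ Δ),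
    (φ.subst σ).sat e ↔ φ.sat fun _ v => (σ v).ev e := by
  have lift : ∀ {Γ Δ : List Ty} {ρ : Ty} (e : Env M Δ) (σ : Sub Γ Δ) (d : M.D ρ),
      (fun _ v => ((Sub.lift (ρ := ρ) σ) v).ev (Env.cons d e) : Env M (ρ :: Γ)) =
        Env.cons d fun _ v => (σ v).ev e :=
    fun e σ d => Env.ext_cons rfl fun _ v => Tm.ev_wk e d (σ v)
  induction φ with
  | eq s t => intros; simp only [Fm.subst, Fm.sat, Tm.ev_subst]
  | and φ ψ h1 h2 => intros; simp only [Fm.subst, Fm.sat, h1, h2]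
  | or φ ψ h1 h2 => intros; simp only [Fm.subst, Fm.sat, h1, h2]
  | imp φ ψ h1 h2 => intros; simp only [Fm.subst, Fm.sat, h1, h2]
  | all ρ φ h => intros; simp only [Fm.subst, Fm.sat, h, lift]
  | ex ρ φ h => intros; simp only [Fm.subst, Fm.sat, h, lift]

/-- Models of the theorems of the system in which moreover falsity fails and provably equal terms
of an arbitrary type have the same value. -/
class Str.IsModel (M : Str) : Prop where
  not_bot : ¬ (Fm.bot (Γ := [])).sat (M := M) Env.nil
  sound : ∀ {Γ : List Ty} {φ : Fm Γ}, Derives [] φ → ∀ e : Env M Γ, φ.sat e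
  ext : ∀ {Γ : List Ty} {ρ : Ty} {s t : Tm Γ ρ}, Derives [] (eqT ρ s t) →
    ∀ e : Env M Γ, s.ev e = t.ev e

end Semantics

/-! ### Henkin theories -/

namespace Henkin

/-- Each triple of a type and two indices is met infinitely often. -/
noncomputable def sched (n : ℕ) : Ty × ℕ × ℕ :=
  (exists_surjective_nat (Ty × ℕ × ℕ)).choose n.unpair.1

/-- A formula over the context of stage `m` can be treated only at stage `m` or later, so a single
visit to its triple would not be enough. -/
theorem exists_sched (p : Ty × ℕ × ℕ) (m : ℕ) : ∃ n, m ≤ n ∧ sched n = p := by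
  obtain ⟨a, ha⟩ := (exists_surjective_nat (Ty × ℕ × ℕ)).choose_spec p
  refine ⟨Nat.pair a m, Nat.right_le_pair a m, ?_⟩
  rw [sched, Nat.unpair_pair]
  exact ha

variable (Γ₀ : List Ty)

/-- The increasing sequence of contexts. -/
noncomputable def cx : ℕ → List Ty
  | 0 => Γ₀
  | n + 1 => (sched n).1 :: cx n

variable {Γ₀}

/-- Weakening from a context to a later one. -/
noncomputable def up {n m : ℕ} (h : n ≤ m) : Sub (cx Γ₀ n) (cx Γ₀ m) :=
  Nat.leRec (motive := fun m _ => Sub (cx Γ₀ n) (cx Γ₀ m)) (Sub.id _)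
    (fun k _ σ => σ.comp (Sub.shift (sched k).1 (cx Γ₀ k))) h

theorem up_self {n : ℕ} (h : n ≤ n) : up (Γ₀ := Γ₀) h = Sub.id _ := Nat.leRec_self _ _

theorem up_succ {n m : ℕ} (h : n ≤ m) (h' : n ≤ m + 1) :
    up (Γ₀ := Γ₀) h' = (up h).comp (Sub.shift (sched m).1 (cx Γ₀ m)) := Nat.leRec_succ _ _ h

theorem up_comp_up {n m k : ℕ} (h : n ≤ m) (h' : m ≤ k) :
    (up (Γ₀ := Γ₀) h).comp (up h') = up (h.trans h') := by
  induction h' with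
  | refl => rw [up_self, Sub.comp_id]
  | @step k hk ih =>
    rw [up_succ hk, up_succ (h.trans hk), ← ih]
    funext α v
    exact (Tm.subst_subst _ _ _).symm

theorem tm_up_up {n m k : ℕ} (h : n ≤ m) (h' : m ≤ k) {ρ : Ty} (t : Tm (cx Γ₀ n) ρ) :
    (t.subst (up h)).subst (up h') = t.subst (up (h.trans h')) := by
  rw [Tm.subst_subst, up_comp_up]

theorem fm_up_up {n m k : ℕ} (h : n ≤ m) (h' : m ≤ k) (φ : Fm (cx Γ₀ n)) :
    (φ.subst (up h)).subst (up h') = φ.subst (up (h.trans h')) := by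
  rw [Fm.subst_subst, up_comp_up]

theorem fm_up_succ {n m : ℕ} (h : n ≤ m) (h' : n ≤ m + 1) (φ : Fm (cx Γ₀ n)) :
    φ.subst (up h') = (φ.subst (up h)).wk (σ := (sched m).1) := by
  rw [up_succ h]
  exact (Fm.subst_subst φ (up h) (Sub.shift _ _)).symm

noncomputable def decode (Γ : List Ty) : ℕ → Fm Γ := (exists_surjective_nat (Fm Γ)).choose

theorem decode_surjective (Γ : List Ty) : Function.Surjective (decode Γ) :=
  (exists_surjective_nat (Fm Γ)).choose_spec

/-- The formula whose existential quantification is decided at stage `n`. -/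
noncomputable def target (n : ℕ) : Fm ((sched n).1 :: cx Γ₀ n) :=
  if h : (sched n).2.1 ≤ n then
    (decode ((sched n).1 :: cx Γ₀ (sched n).2.1) (sched n).2.2).subst (up h).lift
  -- Here the scheduled context does not exist yet. Any formula serves, since the triple returns at
  -- a later stage.
  else Fm.bot

open Classical in
/-- One step of the construction: either a witness or the negation is added. -/
noncomputable def extend {Γ : List Ty} {ρ : Ty} (ψ : Fm (ρ :: Γ)) (H : List (Fm Γ)) :
    List (Fm (ρ :: Γ)) :=
  if Derives (Fm.ex ρ ψ :: H) Fm.bot then (Fm.ex ρ ψ).neg.wk :: H.map Fm.wk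
  else ψ :: H.map Fm.wk

/-- If `∃ ψ` contradicts `H`, then `H` already proves its negation. If it does not, a contradiction
from `ψ` at a fresh variable would, by elimination of `∃`, be one from `∃ ψ`. -/
theorem extend_consistent {Γ : List Ty} {ρ : Ty} (ψ : Fm (ρ :: Γ)) {H : List (Fm Γ)}
    (hH : ¬ Derives H Fm.bot) : ¬ Derives (extend ψ H) Fm.bot := by
  unfold extend
  split_ifs with h
  · intro hb
    have h1 : Derives (H.map Fm.wk) (Fm.bot (Γ := ρ :: Γ)) := Derives.cut h.impI.wk hb
    -- The contradiction lives in a context with one more variable; a closed term of type `ρ`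
    -- removes it, so every type must be inhabited.
    exact hH (Derives.allE (φ := Fm.bot) (closedTm ρ).emb (.allI h1))
  · intro hb
    refine h (.exE (ψ := Fm.bot) .head (hb.mono ?_))
    exact List.cons_subset_cons _ (List.subset_cons_self _ _)

theorem wk_subset_extend {Γ : List Ty} {ρ : Ty} (ψ : Fm (ρ :: Γ)) (H : List (Fm Γ)) :
    H.map Fm.wk ⊆ extend ψ H := by
  unfold extend
  split_ifs
  all_goals exact List.subset_cons_self _ _

variable (H₀ : List (Fm Γ₀))

noncomputable def hyps : (n : ℕ) → List (Fm (cx Γ₀ n))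
  | 0 => H₀
  | n + 1 => extend (target n) (hyps n)

theorem hyps_consistent (h : ¬ Derives H₀ Fm.bot) : ∀ n, ¬ Derives (hyps H₀ n) Fm.bot
  | 0 => h
  | n + 1 => extend_consistent _ (hyps_consistent h n)

/-- The theory of the construction: `φ` is derivable at a later stage. -/
def Th (n : ℕ) (φ : Fm (cx Γ₀ n)) : Prop :=
  ∃ m, ∃ h : n ≤ m, Derives (hyps H₀ m) (φ.subst (up h))

variable {H₀}

theorem derives_up {n m : ℕ} (h : n ≤ m) {φ : Fm (cx Γ₀ n)} (hφ : Derives (hyps H₀ n) φ) :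
    Derives (hyps H₀ m) (φ.subst (up h)) := by
  induction h with
  | refl => rw [up_self, Fm.subst_id]; exact hφ
  | @step k hk ih =>
    rw [fm_up_succ hk]
    exact ih.wk.mono (wk_subset_extend _ _)

theorem th_up {n m : ℕ} (h : n ≤ m) {φ : Fm (cx Γ₀ n)} : Th H₀ m (φ.subst (up h)) ↔ Th H₀ n φ := by
  constructor
  · rintro ⟨k, hk, hd⟩
    rw [fm_up_up] at hd
    exact ⟨k, h.trans hk, hd⟩
  · rintro ⟨k, hk, hd⟩
    refine ⟨max k m, le_max_right _ _, ?_⟩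
    have := derives_up (le_max_left k m) hd
    rw [fm_up_up] at this ⊢
    exact this

theorem th_of_derives {n : ℕ} {φ : Fm (cx Γ₀ n)} (h : Derives [] φ) : Th H₀ n φ :=
  ⟨n, le_rfl, by rw [up_self, Fm.subst_id]; exact h.weaken⟩

theorem th_mp {n : ℕ} {φ ψ : Fm (cx Γ₀ n)} (h : Th H₀ n (φ ⟹' ψ)) (h' : Th H₀ n φ) :
    Th H₀ n ψ := by
  obtain ⟨m, hm, hd⟩ := h
  obtain ⟨k, hk, hd'⟩ := h'
  have h1 := derives_up (le_max_left m k) hd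
  have h2 := derives_up (le_max_right m k) hd'
  rw [fm_up_up] at h1 h2
  exact ⟨max m k, hm.trans (le_max_left _ _), .impE h1 h2⟩

theorem th_closed {n : ℕ} {H : List (Fm (cx Γ₀ n))} {φ : Fm (cx Γ₀ n)} (h : Derives H φ)
    (hH : ∀ ψ ∈ H, Th H₀ n ψ) : Th H₀ n φ := by
  induction H generalizing φ with
  | nil => exact th_of_derives h
  | cons ψ H ih =>
    exact th_mp (ih h.impI fun χ hχ => hH χ (List.mem_cons_of_mem _ hχ))
      (hH ψ List.mem_cons_self)

theorem th_closed₁ {n : ℕ} {φ ψ : Fm (cx Γ₀ n)} (h : Derives [φ] ψ) (h1 : Th H₀ n φ) :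
    Th H₀ n ψ := th_closed h (by simpa using h1)

theorem th_closed₂ {n : ℕ} {φ ψ χ : Fm (cx Γ₀ n)} (h : Derives [φ, ψ] χ) (h1 : Th H₀ n φ)
    (h2 : Th H₀ n ψ) : Th H₀ n χ := th_closed h (by simpa using ⟨h1, h2⟩)

theorem not_th_bot (h : ¬ Derives H₀ Fm.bot) (n : ℕ) : ¬ Th H₀ n Fm.bot := by
  rintro ⟨m, hm, hd⟩
  exact hyps_consistent H₀ h m hd

/-- Some stage `k ≥ n` is scheduled for exactly this formula, and there `extend` has either named a
witness or added the negation. -/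
theorem exists_witness {n : ℕ} {ρ : Ty} (ψ : Fm (ρ :: cx Γ₀ n)) :
    (∃ m, ∃ h : n ≤ m, ∃ t : Tm (cx Γ₀ m) ρ, Th H₀ m (ψ.subst (Sub.cons t (up h)))) ∨
      Th H₀ n (Fm.ex ρ ψ).neg := by
  obtain ⟨j, hj⟩ := decode_surjective _ ψ
  obtain ⟨k, hk, hs⟩ := exists_sched (ρ, n, j) n
  -- The substitution is left abstract so that `ρ`, `n` and `j` can be replaced by the components of
  -- the schedule inside this claim only. Outside it, `σ .zero` is the witness.
  have ht : ∃ σ : Sub (ρ :: cx Γ₀ n) (cx Γ₀ (k + 1)),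
      σ = Sub.cons (σ .zero) (up (hk.trans k.le_succ)) ∧
      (Derives (hyps H₀ (k + 1)) (ψ.subst σ) ∨
        Derives (hyps H₀ (k + 1)) ((Fm.ex ρ ψ).neg.subst (up (hk.trans k.le_succ)))) := by
    obtain rfl : (sched k).1 = ρ := by rw [hs]
    obtain rfl : (sched k).2.1 = n := by rw [hs]
    obtain rfl : (sched k).2.2 = j := by rw [hs]
    have h1 : target (Γ₀ := Γ₀) k = ψ.subst (up hk).lift := by
      rw [target, dif_pos hk, hj]
    have h2 : Sub.cons v0 (up (Γ₀ := Γ₀) (hk.trans k.le_succ)) = (up hk).lift := by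
      rw [up_succ hk]; rfl
    refine ⟨(up hk).lift, by rw [← h2]; rfl, ?_⟩
    have h3 : hyps H₀ (k + 1) = extend (ψ.subst (up hk).lift) (hyps H₀ k) := by
      rw [← h1]; rfl
    rw [h3, extend]
    split_ifs with hc
    · right
      rw [fm_up_succ hk]
      exact .head
    · left
      exact .head
  obtain ⟨σ, hσ, h | h⟩ := ht
  · refine .inl ⟨k + 1, hk.trans k.le_succ, σ .zero, k + 1, le_rfl, ?_⟩
    rw [up_self, Fm.subst_id, ← hσ]
    exact h
  · exact .inr ⟨k + 1, _, h⟩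

/-- Deciding the vacuous quantification `∃ x, φ` decides `φ`, so the witnessing construction also
completes the theory. -/
theorem th_em {n : ℕ} (φ : Fm (cx Γ₀ n)) : Th H₀ n φ ∨ Th H₀ n φ.neg := by
  rcases exists_witness (H₀ := H₀) (ρ := nat) (n := n) φ.wk with ⟨m, h, t, ht⟩ | h
  · left
    rw [Fm.wk_subst_cons] at ht
    exact (th_up h).1 ht
  · right
    refine th_closed₁ (.impI (.impE (φ := .ex nat φ.wk) .second (.exI zero ?_))) h
    rw [Fm.wk_inst]
    exact .head

theorem not_th_iff (hc : ¬ Derives H₀ Fm.bot) {n : ℕ} {φ : Fm (cx Γ₀ n)} :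
    ¬ Th H₀ n φ ↔ Th H₀ n φ.neg :=
  ⟨fun h => (th_em φ).resolve_left h, fun h h' => not_th_bot hc n (th_mp h h')⟩

theorem th_and {n : ℕ} {φ ψ : Fm (cx Γ₀ n)} : Th H₀ n (φ.and ψ) ↔ Th H₀ n φ ∧ Th H₀ n ψ :=
  ⟨fun h => ⟨th_closed₁ (.andL .head) h, th_closed₁ (.andR .head) h⟩,
    fun h => th_closed₂ (.andI .head .second) h.1 h.2⟩

theorem th_or (hc : ¬ Derives H₀ Fm.bot) {n : ℕ} {φ ψ : Fm (cx Γ₀ n)} :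
    Th H₀ n (φ.or ψ) ↔ Th H₀ n φ ∨ Th H₀ n ψ := by
  constructor
  · intro h
    by_contra! hn
    rw [not_th_iff hc, not_th_iff hc] at hn
    refine not_th_bot hc n (th_closed (H := [φ.or ψ, φ.neg, ψ.neg]) (.orE .head ?_ ?_) ?_)
    · exact .impE (φ := φ) (.hyp (by simp [Fm.neg])) .head
    · exact .impE (φ := ψ) (.hyp (by simp [Fm.neg])) .head
    · simpa using ⟨h, hn.1, hn.2⟩
  · rintro (h | h)
    · exact th_closed₁ (.orL .head) h
    · exact th_closed₁ (.orR .head) h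

theorem th_imp (hc : ¬ Derives H₀ Fm.bot) {n : ℕ} {φ ψ : Fm (cx Γ₀ n)} :
    Th H₀ n (φ.imp ψ) ↔ (Th H₀ n φ → Th H₀ n ψ) := by
  refine ⟨th_mp, fun h => ?_⟩
  by_cases h1 : Th H₀ n φ
  · exact th_closed₁ (.impI .second) (h h1)
  · exact th_closed₁ (.impI (.botE (.impE (φ := φ) .second .head))) ((not_th_iff hc).1 h1)

theorem th_ex (hc : ¬ Derives H₀ Fm.bot) {n : ℕ} {ρ : Ty} {ψ : Fm (ρ :: cx Γ₀ n)} :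
    Th H₀ n (.ex ρ ψ) ↔
      ∃ m, ∃ h : n ≤ m, ∃ t : Tm (cx Γ₀ m) ρ, Th H₀ m (ψ.subst (Sub.cons t (up h))) := by
  constructor
  · intro h
    refine (exists_witness ψ).resolve_right fun h' => not_th_bot hc n (th_mp h' h)
  · rintro ⟨m, h, t, ht⟩
    exact (th_up h).1 (th_closed₁ (.exI_cons t .head) ht)

theorem th_all (hc : ¬ Derives H₀ Fm.bot) {n : ℕ} {ρ : Ty} {ψ : Fm (ρ :: cx Γ₀ n)} :
    Th H₀ n (.all ρ ψ) ↔
      ∀ m, ∀ h : n ≤ m, ∀ t : Tm (cx Γ₀ m) ρ, Th H₀ m (ψ.subst (Sub.cons t (up h))) := by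
  constructor
  · exact fun h m hm t => th_closed₁ (.allE_cons t .head) ((th_up hm).2 h)
  · intro h
    -- A failing universal formula has a named counterexample, which the assumption on all named
    -- terms excludes.
    rcases exists_witness (H₀ := H₀) ψ.neg with ⟨m, hm, t, ht⟩ | h'
    · exact (not_th_bot hc m (th_mp ht (h m hm t))).elim
    · exact th_closed₁ .all_of_neg_ex_neg h'

/-! ### The term model -/

variable (Γ₀ H₀)

/-- Terms over the contexts of the sequence. -/
def LTm (ρ : Ty) : Type := Σ n, Tm (cx Γ₀ n) ρ

variable {Γ₀}

/-- Two terms are identified if they are equal in every context of type `0`. -/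
def Rel {ρ : Ty} (a b : LTm Γ₀ ρ) : Prop :=
  ∀ k (h : a.1 ≤ k) (h' : b.1 ≤ k) (r : Tm (ρ :: cx Γ₀ k) nat),
    Th H₀ k (r.inst (a.2.subst (up h)) ≐ r.inst (b.2.subst (up h')))

theorem rel_up {ρ : Ty} {a b : LTm Γ₀ ρ} {k l : ℕ} (h : a.1 ≤ k) (h' : b.1 ≤ k) (hl : k ≤ l)
    (r : Tm (ρ :: cx Γ₀ k) nat)
    (H : Th H₀ l ((r.subst (up hl).lift).inst (a.2.subst (up (h.trans hl))) ≐
      (r.subst (up hl).lift).inst (b.2.subst (up (h'.trans hl))))) :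
    Th H₀ k (r.inst (a.2.subst (up h)) ≐ r.inst (b.2.subst (up h'))) := by
  refine (th_up hl).1 ?_
  simp only [Fm.subst, Tm.inst_subst, tm_up_up]
  exact H

theorem rel_refl {ρ : Ty} (a : LTm Γ₀ ρ) : Rel H₀ a a :=
  fun _ _ _ _ => th_of_derives (.arith (.eqRefl _))

theorem rel_symm {ρ : Ty} {a b : LTm Γ₀ ρ} (h : Rel H₀ a b) : Rel H₀ b a :=
  fun k h1 h2 r => th_closed₁ (.impE (.arith (.eqSymm _ _)) .head) (h k h2 h1 r)

theorem th_eq_trans {n : ℕ} {s t r : Tm (cx Γ₀ n) nat} (h : Th H₀ n (s ≐ t))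
    (h' : Th H₀ n (t ≐ r)) : Th H₀ n (s ≐ r) :=
  th_closed₂ (.impE (.arith (.eqTrans _ _ _)) (.andI .head .second)) h h'

theorem rel_trans {ρ : Ty} {a b c : LTm Γ₀ ρ} (h : Rel H₀ a b) (h' : Rel H₀ b c) :
    Rel H₀ a c := by
  intro k h1 h2 r
  refine rel_up H₀ h1 h2 (le_max_left k b.1) r ?_
  exact th_eq_trans H₀ (h _ _ (le_max_right _ _) _) (h' _ (le_max_right _ _) _ _)

def setoid (ρ : Ty) : Setoid (LTm Γ₀ ρ) := ⟨Rel H₀, rel_refl H₀, rel_symm H₀, rel_trans H₀⟩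

noncomputable def LTm.app {ρ τ : Ty} (f : LTm Γ₀ (ρ ⇾ τ)) (a : LTm Γ₀ ρ) : LTm Γ₀ τ :=
  ⟨max f.1 a.1, f.2.subst (up (le_max_left _ _)) ⬝ a.2.subst (up (le_max_right _ _))⟩

/-- Indiscernibility, unlike pointwise equality, is a congruence for free: a context around `f ⬝ a`
is a context around `f`, and one around `g ⬝ a` is a context around `a`. -/
theorem rel_app {ρ τ : Ty} {f g : LTm Γ₀ (ρ ⇾ τ)} {a b : LTm Γ₀ ρ} (hf : Rel H₀ f g)
    (ha : Rel H₀ a b) : Rel H₀ (f.app a) (g.app b) := by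
  have key : ∀ k (h1 : f.1 ≤ k) (h2 : g.1 ≤ k) (h3 : a.1 ≤ k) (h4 : b.1 ≤ k)
      (r : Tm (τ :: cx Γ₀ k) nat),
      Th H₀ k (r.inst (f.2.subst (up h1) ⬝ a.2.subst (up h3)) ≐
        r.inst (g.2.subst (up h2) ⬝ b.2.subst (up h4))) := by
    intro k h1 h2 h3 h4 r
    have e1 := hf k h1 h2 (r.subst (Sub.cons (v0 ⬝ (a.2.subst (up h3)).wk) (Sub.shift _ _)))
    have e2 := ha k h3 h4 (r.subst (Sub.cons ((g.2.subst (up h2)).wk ⬝ v0) (Sub.shift _ _)))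
    simp only [Tm.inst, Tm.subst_subst _ _ r, Sub.cons_comp, Tm.subst, Tm.wk_subst_cons,
      Sub.shift_comp_cons, Tm.subst_id, v0, Sub.cons_zero] at e1 e2
    exact th_eq_trans H₀ e1 e2
  intro k h h' r
  simp only [LTm.app, Tm.subst, tm_up_up] at h h' ⊢
  exact key k _ _ _ _ r

/-- The term model. -/
noncomputable def model : Str where
  D ρ := Quotient (setoid H₀ ρ)
  app := Quotient.map₂ LTm.app fun _ _ hf _ _ ha => rel_app H₀ hf ha
  con c := Quotient.mk _ (⟨0, .con c⟩ : LTm Γ₀ _)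

/-- The class of a term. -/
noncomputable def cl {n : ℕ} {ρ : Ty} (t : Tm (cx Γ₀ n) ρ) : (model H₀).D ρ :=
  Quotient.mk (setoid H₀ ρ) ⟨n, t⟩

theorem cl_up {n m : ℕ} (h : n ≤ m) {ρ : Ty} (t : Tm (cx Γ₀ n) ρ) :
    cl H₀ (t.subst (up h)) = cl H₀ t := by
  refine Quotient.sound (s := setoid H₀ ρ) ?_
  intro k h1 h2 r
  simp only [tm_up_up]
  exact th_of_derives (.arith (.eqRefl _))

theorem cl_eq {n : ℕ} {ρ : Ty} {s t : Tm (cx Γ₀ n) ρ} :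
    cl H₀ s = cl H₀ t ↔ ∀ k (h : n ≤ k) (r : Tm (ρ :: cx Γ₀ k) nat),
      Th H₀ k (r.inst (s.subst (up h)) ≐ r.inst (t.subst (up h))) :=
  ⟨fun h k hk r => Quotient.exact (s := setoid H₀ ρ) h k hk hk r,
    fun h => Quotient.sound (s := setoid H₀ ρ) fun k hk _ r => h k hk r⟩

/-- At type `0` the extensionality rule applies to the theorem `s = t → s = t`, whose premise is
quantifier-free. It yields `s = t → r[s] = r[t]`, which may then be used with a non-theorem `s = t`
of the theory. -/
theorem cl_eq_nat {n : ℕ} {s t : Tm (cx Γ₀ n) nat} :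
    cl H₀ s = cl H₀ t ↔ Th H₀ n (s ≐ t) := by
  rw [cl_eq]
  constructor
  · intro h
    have := h n le_rfl v0
    rwa [up_self, Tm.subst_id, Tm.subst_id] at this
  · intro h k hk r
    have h1 : Derives [] (s.subst (up hk) ≐ t.subst (up hk) ⟹'
        eqT nat (s.subst (up hk)) (t.subst (up hk))) := .impI .head
    exact th_mp (th_of_derives (.qfER (φ := s.subst (up hk) ≐ t.subst (up hk)) _ _ r trivial h1)) ((th_up hk).2 h)

/-- At higher types and at `X` the equation is not quantifier-free, so the rule is used with the
trivial premise `0 = 0`. This is why `s = t` must be derivable without assumptions. -/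
theorem cl_eq_of_derives {n : ℕ} {ρ : Ty} {s t : Tm (cx Γ₀ n) ρ} (h : Derives [] (eqT ρ s t)) :
    cl H₀ s = cl H₀ t := by
  rw [cl_eq]
  intro k hk r
  have h1 : Derives [] (eqT ρ (s.subst (up hk)) (t.subst (up hk))) := by
    rw [← eqT_subst]; exact h.subst (up hk)
  have h2 : Derives [] ((zero ≐ zero) ⟹' eqT ρ (s.subst (up hk)) (t.subst (up hk))) :=
    .impI h1.weaken
  exact th_of_derives (.impE (.qfER (φ := zero ≐ zero) _ _ r trivial h2) (.arith (.eqRefl _)))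

theorem exists_cl {ρ : Ty} (d : (model H₀).D ρ) : ∃ n, ∃ t : Tm (cx Γ₀ n) ρ, cl H₀ t = d := by
  obtain ⟨⟨n, t⟩, h⟩ := Quotient.exists_rep (s := setoid H₀ ρ) d
  exact ⟨n, t, h⟩

theorem exists_cl_env : ∀ {Γ : List Ty} (e : Env (model H₀) Γ),
    ∃ n, ∃ σ : Sub Γ (cx Γ₀ n), e = fun _ v => cl H₀ (σ v)
  | [], _ => ⟨0, Sub.nil, by funext _ v; cases v⟩
  | ρ :: Γ, e => by
    obtain ⟨n, σ, h⟩ := exists_cl_env fun _ v => e (Var.succ v)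
    obtain ⟨m, t, ht⟩ := exists_cl H₀ (e (ρ := ρ) .zero)
    refine ⟨max n m, Sub.cons (t.subst (up (le_max_right _ _)))
      (σ.comp (up (le_max_left _ _))), Env.ext_cons ?_ fun α v => ?_⟩
    · rw [Sub.cons_zero, cl_up, ht]
    · rw [Sub.cons_succ, Sub.comp, cl_up]
      exact congrFun (congrFun h α) v

theorem cl_app {n : ℕ} {ρ τ : Ty} (f : Tm (cx Γ₀ n) (ρ ⇾ τ)) (a : Tm (cx Γ₀ n) ρ) :
    (model H₀).app (cl H₀ f) (cl H₀ a) = cl H₀ (f ⬝ a) :=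
  cl_up H₀ (le_max_left n n) (f ⬝ a)

theorem ev_cl {Γ : List Ty} {n : ℕ} (σ : Sub Γ (cx Γ₀ n)) {ρ : Ty} (t : Tm Γ ρ) :
    t.ev (M := model H₀) (fun _ v => cl H₀ (σ v)) = cl H₀ (t.subst σ) := by
  induction t with
  | var v => rfl
  | con c => exact (cl_up H₀ (Nat.zero_le n) (.con c)).symm
  | app f a hf ha => rw [Tm.ev, hf, ha, cl_app, Tm.subst]

theorem env_cons_cl {Γ : List Ty} {n m : ℕ} (σ : Sub Γ (cx Γ₀ n)) {ρ : Ty} (h : n ≤ m)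
    (t : Tm (cx Γ₀ m) ρ) :
    (Env.cons (cl H₀ t) (fun _ v => cl H₀ (σ v)) : Env (model H₀) (ρ :: Γ)) =
      fun _ v => cl H₀ (Sub.cons t (σ.comp (up h)) v) :=
  Env.ext_cons rfl fun _ v => (cl_up H₀ h (σ v)).symm

variable {H₀}

/-- Each connective matches a closure property of the complete theory. In the quantifier cases every
element of the model is the class of a term at some stage, which is lifted to a stage above `n`. -/
theorem truth (hc : ¬ Derives H₀ Fm.bot) {Γ : List Ty} (φ : Fm Γ) :
    ∀ {n : ℕ} (σ : Sub Γ (cx Γ₀ n)),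
      φ.sat (M := model H₀) (fun _ v => cl H₀ (σ v)) ↔ Th H₀ n (φ.subst σ) := by
  induction φ with
  | eq s t => intro n σ; rw [Fm.sat, ev_cl, ev_cl, cl_eq_nat]; rfl
  | and φ ψ h1 h2 => intro n σ; rw [Fm.sat, h1, h2, Fm.subst, th_and]
  | or φ ψ h1 h2 => intro n σ; rw [Fm.sat, h1, h2, Fm.subst, th_or hc]
  | imp φ ψ h1 h2 => intro n σ; rw [Fm.sat, h1, h2, Fm.subst, th_imp hc]
  | all ρ φ h =>
    intro n σ
    rw [Fm.sat, Fm.subst, th_all hc]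
    simp only [Fm.subst_subst, Sub.lift_comp_cons]
    constructor
    · intro H m hm t
      have := H (cl H₀ t)
      rwa [env_cons_cl H₀ σ hm, h] at this
    · intro H d
      obtain ⟨m, t, rfl⟩ := exists_cl H₀ d
      have := H (max n m) (le_max_left _ _) (t.subst (up (le_max_right _ _)))
      rwa [← h, ← env_cons_cl, cl_up] at this
  | ex ρ φ h =>
    intro n σ
    rw [Fm.sat, Fm.subst, th_ex hc]
    simp only [Fm.subst_subst, Sub.lift_comp_cons]
    constructor
    · rintro ⟨d, hd⟩
      obtain ⟨m, t, rfl⟩ := exists_cl H₀ d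
      refine ⟨max n m, le_max_left _ _, t.subst (up (le_max_right _ _)), ?_⟩
      rwa [← h, ← env_cons_cl, cl_up]
    · rintro ⟨m, hm, t, ht⟩
      refine ⟨cl H₀ t, ?_⟩
      rwa [env_cons_cl H₀ σ hm, h]

theorem model_isModel (hc : ¬ Derives H₀ Fm.bot) : (model H₀).IsModel where
  not_bot h := by
    have h1 := (truth hc Fm.bot (n := 0) Sub.nil).1 h
    exact not_th_bot hc 0 h1
  sound h e := by
    obtain ⟨n, σ, rfl⟩ := exists_cl_env H₀ e
    exact (truth hc _ σ).2 (th_of_derives (h.subst σ))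
  ext h e := by
    obtain ⟨n, σ, rfl⟩ := exists_cl_env H₀ e
    rw [ev_cl, ev_cl]
    refine cl_eq_of_derives H₀ ?_
    rw [← eqT_subst]
    exact h.subst σ

end Henkin

/-- Completeness: what holds in all models is derivable. -/
theorem derives_of_valid {Γ : List Ty} {φ : Fm Γ}
    (h : ∀ M : Str, M.IsModel → ∀ e : Env M Γ, φ.sat e) : Derives [] φ := by
  refine .byContra (by_contra fun hc => ?_)
  -- The construction starts from the context `Γ` and the single assumption `¬ φ`; the free
  -- variables of `φ` denote their own classes.
  have h1 := h _ (Henkin.model_isModel hc) fun _ v => Henkin.cl _ (n := 0) (Sub.id Γ v)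
  have h2 : ∀ ψ : Fm Γ, ψ = φ.subst (Sub.id Γ) → Henkin.Th (Γ₀ := Γ) [φ.neg] 0 ψ := by
    rintro _ rfl
    exact (Henkin.truth hc φ (n := 0) (Sub.id Γ)).1 h1
  refine Henkin.not_th_bot hc 0
    (Henkin.th_mp (Γ₀ := Γ) (n := 0) (φ := φ) ⟨0, le_rfl, ?_⟩
      (h2 φ (Fm.subst_id φ).symm))
  rw [Henkin.up_self, Fm.subst_id]
  exact .head

/-! ### Combinators and recursion in models -/

infixl:90 " ⬩ " => Str.app _

section Model

variable {M : Str} {Γ : List Ty} {ρ τ δ : Ty}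

@[simp] theorem Env.cons_zero (d : M.D ρ) (e : Env M Γ) : Env.cons d e .zero = d := rfl

@[simp] theorem Env.cons_succ (d : M.D ρ) (e : Env M Γ) (v : Var Γ τ) :
    Env.cons d e v.succ = e v := rfl

section Variables

variable {a b c d e : Ty}

@[simp] theorem ev_v0 (w : Env M (a :: Γ)) : v0.ev w = w .zero := rfl
@[simp] theorem ev_v1 (w : Env M (b :: a :: Γ)) : v1.ev w = w (.succ .zero) := rfl
@[simp] theorem ev_v2 (w : Env M (c :: b :: a :: Γ)) : v2.ev w = w (.succ (.succ .zero)) := rfl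
@[simp] theorem ev_v3 (w : Env M (d :: c :: b :: a :: Γ)) :
    v3.ev w = w (.succ (.succ (.succ .zero))) := rfl
@[simp] theorem ev_v4 (w : Env M (e :: d :: c :: b :: a :: Γ)) :
    v4.ev w = w (.succ (.succ (.succ (.succ .zero)))) := rfl

end Variables

@[simp] theorem ev_app (e : Env M Γ) (f : Tm Γ (ρ ⇾ τ)) (a : Tm Γ ρ) :
    (f ⬝ a).ev e = f.ev e ⬩ a.ev e := rfl

@[simp] theorem ev_con (e : Env M Γ) (c : Con ρ) : (Tm.con c : Tm Γ ρ).ev e = M.con c := rfl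

attribute [simp] Fm.sat Tm.ev_wk

instance : Zero (M.D nat) := ⟨M.con .zero⟩

/-- The successor in a model. -/
def sc (a : M.D nat) : M.D nat := M.con .succ ⬩ a

instance : One (M.D nat) := ⟨sc 0⟩

@[simp] theorem con_zero : M.con .zero = 0 := rfl
@[simp] theorem ev_zero (e : Env M Γ) : (zero : Tm Γ nat).ev e = 0 := rfl
@[simp] theorem ev_succ (e : Env M Γ) (s : Tm Γ nat) : (succ s).ev e = sc (s.ev e) := rfl

/-- Recursion of type `0`. -/
def recV (x y : M.D nat) (z : M.D (nat ⇾ nat ⇾ nat)) : M.D nat :=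
  M.app (ρ := nat ⇾ nat ⇾ nat) (M.app (ρ := nat) (τ := (nat ⇾ nat ⇾ nat) ⇾ nat)
    (M.app (ρ := nat) (τ := nat ⇾ (nat ⇾ nat ⇾ nat) ⇾ nat) (M.con (.recr [nat] .zero)) x) y) z

@[simp] theorem ev_recN (e : Env M Γ) (x y : Tm Γ nat) (z : Tm Γ (nat ⇾ nat ⇾ nat)) :
    (recN x y z).ev e = recV (x.ev e) (y.ev e) (z.ev e) := rfl

instance : Add (M.D nat) := ⟨fun a b => addC.ev Env.nil ⬩ a ⬩ b⟩
instance : Mul (M.D nat) := ⟨fun a b => mulC.ev Env.nil ⬩ a ⬩ b⟩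
instance : _root_.Sub (M.D nat) := ⟨fun a b => subC.ev Env.nil ⬩ a ⬩ b⟩

/-- The predecessor in a model. -/
def pd (a : M.D nat) : M.D nat := predC.ev Env.nil ⬩ a

@[simp] theorem ev_add (e : Env M Γ) (s t : Tm Γ nat) : (add s t).ev e = s.ev e + t.ev e := by
  rw [add, ev_app, ev_app, Tm.ev_emb]; rfl

@[simp] theorem ev_mul (e : Env M Γ) (s t : Tm Γ nat) : (mul s t).ev e = s.ev e * t.ev e := by
  rw [mul, ev_app, ev_app, Tm.ev_emb]; rfl

@[simp] theorem ev_sub (e : Env M Γ) (s t : Tm Γ nat) : (sub s t).ev e = s.ev e - t.ev e := by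
  rw [sub, ev_app, ev_app, Tm.ev_emb]; rfl

@[simp] theorem ev_pred (e : Env M Γ) (s : Tm Γ nat) : (pred s).ev e = pd (s.ev e) := by
  rw [pred, ev_app, Tm.ev_emb]; rfl

namespace Arith

theorem add_def (a b : M.D nat) : a + b = addC.ev Env.nil ⬩ a ⬩ b := rfl
theorem mul_def (a b : M.D nat) : a * b = mulC.ev Env.nil ⬩ a ⬩ b := rfl
theorem sub_def (a b : M.D nat) : a - b = subC.ev Env.nil ⬩ a ⬩ b := rfl

end Arith

@[simp] theorem sat_neg (φ : Fm Γ) [hM : M.IsModel] (e : Env M Γ) : φ.neg.sat e ↔ ¬ φ.sat e := by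
  have h : ¬ (Fm.bot (Γ := Γ)).sat e := hM.not_bot
  rw [Fm.neg, Fm.sat]
  tauto

variable [M.IsModel]

-- The axiom is only a pointwise equation at type `ρ`. It becomes an identity because it is a
-- theorem, by the field `ext`.
@[simp] theorem app_proj (a : M.D ρ) (b : M.D τ) : M.con (.proj ρ τ) ⬩ a ⬩ b = a :=
  Str.IsModel.ext (.arith (.proj v0 v1)) (Env.cons a (Env.cons b Env.nil))

@[simp] theorem app_sigma (a : M.D (δ ⇾ ρ ⇾ τ)) (b : M.D (δ ⇾ ρ)) (c : M.D δ) :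
    M.con (.sigma δ ρ τ) ⬩ a ⬩ b ⬩ c = a ⬩ c ⬩ (b ⬩ c) :=
  Str.IsModel.ext (.arith (.sigma v0 v1 v2)) (Env.cons a (Env.cons b (Env.cons c Env.nil)))

@[simp] theorem ev_lam_app (e : Env M Γ) (t : Tm (ρ :: Γ) τ) (d : M.D ρ) :
    t.lam.ev e ⬩ d = t.ev (Env.cons d e) := by
  -- Induction on a term needs its context to be a variable, so the index `ρ :: Γ` is generalized.
  obtain ⟨Γ', hΓ⟩ : ∃ Γ', Γ' = ρ :: Γ := ⟨_, rfl⟩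
  have key : ∀ {τ : Ty} (t : Tm Γ' τ),
      (hΓ ▸ t : Tm (ρ :: Γ) τ).lam.ev e ⬩ d = (hΓ ▸ t : Tm (ρ :: Γ) τ).ev (Env.cons d e) := by
    intro τ t
    induction t with
    | var v =>
      subst hΓ
      cases v with
      | zero => exact (app_sigma _ _ _).trans (app_proj _ _)
      | succ v => exact app_proj _ _
    | con c => subst hΓ; exact app_proj _ _
    | app f a hf ha =>
      subst hΓ
      exact (app_sigma _ _ _).trans (congrArg₂ _ hf ha)
  subst hΓ
  exact key t

theorem sc_ne_zero (a : M.D nat) : sc a ≠ 0 :=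
  (sat_neg _ _).1
    (Str.IsModel.sound (Derives.arith (ArithAx.succNe v0)) (Env.cons a Env.nil))

theorem sc_injective {a b : M.D nat} (h : sc a = sc b) : a = b :=
  Str.IsModel.sound (φ := _ ⟹' _) (Derives.arith (ArithAx.succInj v0 v1))
    (Env.cons a (Env.cons b Env.nil)) h

/-- Induction for definable predicates. -/
theorem nat_induct {P : M.D nat → Prop} (φ : Fm (nat :: Γ)) (e : Env M Γ)
    (hφ : ∀ n, φ.sat (Env.cons n e) ↔ P n) (h0 : P 0) (hs : ∀ n, P n → P (sc n)) (n : M.D nat) :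
    P n := by
  have h := Str.IsModel.sound (Derives.arith (ArithAx.induction φ)) e
  simp only [Fm.sat, Fm.inst, Fm.sat_subst] at h
  refine (hφ n).1 (h ⟨?_, ?_⟩ n)
  · convert (hφ 0).2 h0 using 1
    exact Env.ext_cons rfl fun _ _ => rfl
  · intro d hd
    convert (hφ _).2 (hs d ((hφ d).1 hd)) using 1
    exact Env.ext_cons rfl fun _ _ => rfl

@[simp] theorem recV_zero (y : M.D nat) (z : M.D (nat ⇾ nat ⇾ nat)) : recV 0 y z = y :=
  Str.IsModel.ext (.arith (.recZero [nat] .zero (Sub.cons v0 Sub.nil) (Sub.cons v1 Sub.nil)))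
    (Env.cons y (Env.cons z Env.nil))

@[simp] theorem recV_sc (x y : M.D nat) (z : M.D (nat ⇾ nat ⇾ nat)) :
    recV (sc x) y z = z ⬩ recV x y z ⬩ x :=
  Str.IsModel.ext
    (.arith (.recSucc [nat] .zero v2 (Sub.cons v0 Sub.nil) (Sub.cons v1 Sub.nil)))
    (Env.cons y (Env.cons z (Env.cons x Env.nil)))

/-- Step functionals that agree pointwise may be different elements. This occurs whenever the same
abstraction is evaluated in two environments, since bound variables it does not use still enter its
combinator term. -/
theorem recV_congr {z z' : M.D (nat ⇾ nat ⇾ nat)} (h : ∀ p i, z ⬩ p ⬩ i = z' ⬩ p ⬩ i)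
    (y x : M.D nat) : recV x y z = recV x y z' := by
  refine nat_induct (P := fun x => recV x y z = recV x y z')
    (.eq (recN v0 v1 v2) (recN v0 v1 v3))
    (Env.cons y (Env.cons z (Env.cons z' Env.nil))) (by simp) (by simp) (fun n hn => ?_) x
  rw [recV_sc, recV_sc, hn, h]

/-! ### Arithmetic in models -/

namespace Arith

theorem pd_eq (a : M.D nat) : pd a = recV a 0 ((lam (lam v0) : Tm [nat] _).ev
    (Env.cons a Env.nil)) := by
  simp [pd, predC]

@[simp] theorem pd_zero : pd (0 : M.D nat) = 0 := by simp [pd_eq]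
@[simp] theorem pd_sc (a : M.D nat) : pd (sc a) = a := by simp [pd_eq]

theorem add_zero' (a : M.D nat) : a + 0 = a := by simp [add_def, addC]
theorem add_sc (a b : M.D nat) : a + sc b = sc (a + b) := by
  simp [add_def, addC]
  rw [recV_congr]
  simp
theorem mul_zero' (a : M.D nat) : a * 0 = 0 := by simp [mul_def, mulC]
theorem mul_sc (a b : M.D nat) : a * sc b = a * b + a := by
  simp [mul_def, mulC]
  rw [recV_congr]
  simp
theorem sub_zero' (a : M.D nat) : a - 0 = a := by simp [sub_def, subC]
theorem sub_sc (a b : M.D nat) : a - sc b = pd (a - b) := by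
  simp [sub_def, subC]
  rw [recV_congr]
  simp

end Arith

end Model

/-! ### The natural numbers of a model as a discretely ordered commutative semiring -/

namespace Arith

variable {M : Str}

theorem one_eq_sc : (1 : M.D nat) = sc 0 := rfl

instance : LE (M.D nat) := ⟨fun a b => a - b = 0⟩

theorem le_def {a b : M.D nat} : a ≤ b ↔ a - b = 0 := Iff.rfl

variable [M.IsModel]

theorem zero_add' (a : M.D nat) : 0 + a = a :=
  nat_induct (P := fun a => 0 + a = a) (add zero v0 ≐ v0) Env.nil (by simp) (add_zero' 0)
    (fun n hn => by rw [add_sc, hn]) a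

theorem sc_add (a b : M.D nat) : sc a + b = sc (a + b) :=
  nat_induct (P := fun b => sc a + b = sc (a + b)) (add (succ v1) v0 ≐ succ (add v1 v0))
    (Env.cons a Env.nil) (by simp) (by simp only [add_zero'])
    (fun n hn => by rw [add_sc, hn, add_sc]) b

theorem add_comm' (a b : M.D nat) : a + b = b + a :=
  nat_induct (P := fun b => a + b = b + a) (add v1 v0 ≐ add v0 v1)
    (Env.cons a Env.nil) (by simp) (by simp only [add_zero', zero_add'])
    (fun n hn => by rw [add_sc, hn, sc_add]) b

theorem add_assoc' (a b c : M.D nat) : a + b + c = a + (b + c) :=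
  nat_induct (P := fun c => a + b + c = a + (b + c)) (add (add v1 v2) v0 ≐ add v1 (add v2 v0))
    (Env.cons a (Env.cons b Env.nil)) (by simp) (by simp only [add_zero'])
    (fun n hn => by simp only [add_sc, hn]) c

instance : AddCommMonoid (M.D nat) where
  add_assoc := add_assoc'
  zero_add := zero_add'
  add_zero := add_zero'
  add_comm := add_comm'
  nsmul := nsmulRec

theorem sc_eq (a : M.D nat) : sc a = a + 1 := by rw [one_eq_sc, add_sc, add_zero]

theorem zero_mul' (a : M.D nat) : 0 * a = 0 :=
  nat_induct (P := fun a => 0 * a = 0) (mul zero v0 ≐ zero) Env.nil (by simp) (mul_zero' 0)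
    (fun n hn => by rw [mul_sc, hn, add_zero]) a

theorem sc_mul (a b : M.D nat) : sc a * b = a * b + b :=
  nat_induct (P := fun b => sc a * b = a * b + b) (mul (succ v1) v0 ≐ add (mul v1 v0) v0)
    (Env.cons a Env.nil) (by simp) (by simp only [mul_zero', add_zero])
    (fun n hn => by rw [mul_sc, hn, mul_sc, add_sc, add_sc, add_right_comm]) b

theorem mul_comm' (a b : M.D nat) : a * b = b * a :=
  nat_induct (P := fun b => a * b = b * a) (mul v1 v0 ≐ mul v0 v1)
    (Env.cons a Env.nil) (by simp) (by simp only [mul_zero', zero_mul'])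
    (fun n hn => by rw [mul_sc, hn, sc_mul]) b

theorem mul_add' (a b c : M.D nat) : a * (b + c) = a * b + a * c :=
  nat_induct (P := fun c => a * (b + c) = a * b + a * c)
    (mul v1 (add v2 v0) ≐ add (mul v1 v2) (mul v1 v0))
    (Env.cons a (Env.cons b Env.nil)) (by simp) (by simp only [mul_zero', add_zero])
    (fun n hn => by simp only [add_sc, mul_sc, hn, add_assoc]) c

theorem mul_assoc' (a b c : M.D nat) : a * b * c = a * (b * c) :=
  nat_induct (P := fun c => a * b * c = a * (b * c)) (mul (mul v1 v2) v0 ≐ mul v1 (mul v2 v0))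
    (Env.cons a (Env.cons b Env.nil)) (by simp) (by simp only [mul_zero'])
    (fun n hn => by simp only [mul_sc, hn, mul_add']) c

theorem mul_one' (a : M.D nat) : a * 1 = a := by
  rw [one_eq_sc, mul_sc, mul_zero', zero_add]

instance : CommSemiring (M.D nat) where
  left_distrib := mul_add'
  right_distrib a b c := by rw [mul_comm', mul_add', mul_comm' c, mul_comm' c]
  zero_mul := zero_mul'
  mul_zero := mul_zero'
  mul_assoc := mul_assoc'
  one_mul a := by rw [mul_comm', mul_one']
  mul_one := mul_one'
  mul_comm := mul_comm'
  npow := npowRec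

theorem eq_zero_or_sc (a : M.D nat) : a = 0 ∨ ∃ b, a = sc b :=
  nat_induct (P := fun a => a = 0 ∨ ∃ b, a = sc b) (.or (v0 ≐ zero) (.ex nat (v1 ≐ succ v0)))
    Env.nil (by simp) (.inl rfl) (fun n _ => .inr ⟨n, rfl⟩) a

theorem zero_sub' (a : M.D nat) : 0 - a = 0 :=
  nat_induct (P := fun a => 0 - a = 0) (sub zero v0 ≐ zero) Env.nil (by simp) (sub_zero' 0)
    (fun n hn => by rw [sub_sc, hn, pd_zero]) a

theorem sc_sub_sc (a b : M.D nat) : sc a - sc b = a - b :=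
  nat_induct (P := fun b => sc a - sc b = a - b) (sub (succ v1) (succ v0) ≐ sub v1 v0)
    (Env.cons a Env.nil) (by simp) (by rw [sub_sc, sub_zero', sub_zero', pd_sc])
    (fun n hn => by rw [sub_sc, hn, sub_sc]) b

theorem add_sub (a b : M.D nat) : a + b - b = a :=
  nat_induct (P := fun b => a + b - b = a) (sub (add v1 v0) v0 ≐ v1)
    (Env.cons a Env.nil) (by simp) (by rw [add_zero, sub_zero'])
    (fun n hn => by rw [add_sc, sc_sub_sc, hn]) b

theorem sub_add_self (a b : M.D nat) : a - (a + b) = 0 :=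
  nat_induct (P := fun a => a - (a + b) = 0) (sub v0 (add v0 v1) ≐ zero)
    (Env.cons b Env.nil) (by simp) (zero_sub' _)
    (fun n hn => by rw [sc_add, sc_sub_sc, hn]) a

/-- Both sides are the maximum of `a` and `b`. The induction on `b` must quantify over all `a`,
since its step passes to the predecessor of `a`. From this identity come the description of `≤` by
addition and the laws of truncated subtraction. -/
theorem add_sub_comm (a b : M.D nat) : a + (b - a) = b + (a - b) := by
  refine nat_induct (P := fun b => ∀ a, a + (b - a) = b + (a - b))
    (.all nat (add v0 (sub v1 v0) ≐ add v1 (sub v0 v1))) Env.nil (by simp)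
    (fun a => by rw [zero_sub', sub_zero', add_comm]) (fun n hn a => ?_) b a
  obtain rfl | ⟨a, rfl⟩ := eq_zero_or_sc a
  · rw [zero_sub', sub_zero', add_comm]
  · rw [sc_sub_sc, sc_sub_sc, sc_add, sc_add, hn]

theorem sub_eq_zero_total (a b : M.D nat) : a - b = 0 ∨ b - a = 0 := by
  refine nat_induct (P := fun b => ∀ a, a - b = 0 ∨ b - a = 0)
    (.all nat (.or (sub v0 v1 ≐ zero) (sub v1 v0 ≐ zero))) Env.nil (by simp)
    (fun a => .inr (zero_sub' a)) (fun n hn a => ?_) b a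
  obtain rfl | ⟨a, rfl⟩ := eq_zero_or_sc a
  · exact .inl (zero_sub' _)
  · simpa only [sc_sub_sc] using hn a

theorem eq_zero_of_add {a b : M.D nat} (h : a + b = 0) : b = 0 := by
  obtain rfl | ⟨b, rfl⟩ := eq_zero_or_sc b
  · rfl
  · rw [add_sc] at h
    exact (sc_ne_zero _ h).elim

instance : IsCancelAdd (M.D nat) where
  add_right_cancel c a b h := by
    rw [← add_sub a c, ← add_sub b c]
    exact congrArg (· - c) h
  add_left_cancel c a b h := by
    rw [← add_sub a c, ← add_sub b c, add_comm a, add_comm b]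
    exact congrArg (· - c) h

theorem le_iff_exists {a b : M.D nat} : a ≤ b ↔ ∃ c, b = a + c := by
  constructor
  · intro h
    have := add_sub_comm a b
    rw [le_def.1 h, add_zero] at this
    exact ⟨_, this.symm⟩
  · rintro ⟨c, rfl⟩
    exact sub_add_self a c

noncomputable instance : LinearOrder (M.D nat) where
  le_refl a := le_iff_exists.2 ⟨0, (add_zero a).symm⟩
  le_trans a b c := by
    simp only [le_iff_exists]
    rintro ⟨d, rfl⟩ ⟨d', rfl⟩
    exact ⟨d + d', add_assoc _ _ _⟩
  le_antisymm a b := by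
    simp only [le_iff_exists]
    rintro ⟨d, rfl⟩ ⟨d', h⟩
    rw [add_assoc] at h
    have h1 : d + d' = 0 := (left_eq_add.1 h)
    rw [add_comm] at h1
    rw [eq_zero_of_add h1, add_zero]
  le_total := sub_eq_zero_total
  toDecidableLE := Classical.decRel _

instance : CanonicallyOrderedAdd (M.D nat) where
  exists_add_of_le h := le_iff_exists.1 h
  le_self_add _ b := le_iff_exists.2 ⟨b, rfl⟩
  le_add_self _ b := le_iff_exists.2 ⟨b, add_comm _ _⟩

instance : IsOrderedCancelAddMonoid (M.D nat) where
  add_le_add_left a b h c := by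
    obtain ⟨d, rfl⟩ := le_iff_exists.1 h
    exact le_iff_exists.2 ⟨d, by abel⟩
  le_of_add_le_add_left a b c h := by
    obtain ⟨d, hd⟩ := le_iff_exists.1 h
    exact le_iff_exists.2 ⟨d, by rw [add_assoc] at hd; exact add_left_cancel hd⟩

theorem lt_iff_exists {a b : M.D nat} : a < b ↔ ∃ c, b = a + sc c := by
  constructor
  · intro h
    obtain ⟨c, rfl⟩ := le_iff_exists.1 h.le
    obtain rfl | ⟨c, rfl⟩ := eq_zero_or_sc c
    · simp at h
    · exact ⟨c, rfl⟩
  · rintro ⟨c, rfl⟩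
    refine lt_of_le_of_ne (le_iff_exists.2 ⟨_, rfl⟩) fun h => ?_
    exact sc_ne_zero c (left_eq_add.1 h)

theorem lt_sc_iff {a b : M.D nat} : a < sc b ↔ a ≤ b := by
  rw [lt_iff_exists, le_iff_exists]
  simp only [add_sc]
  exact ⟨fun ⟨c, h⟩ => ⟨c, sc_injective h⟩, fun ⟨c, h⟩ => ⟨c, congrArg sc h⟩⟩

theorem sc_pos (a : M.D nat) : 0 < sc a := pos_iff_ne_zero.2 (sc_ne_zero a)

instance : Nontrivial (M.D nat) := ⟨0, 1, (sc_ne_zero 0).symm⟩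

instance : IsStrictOrderedRing (M.D nat) where
  mul_lt_mul_of_pos_left a ha b c h := by
    obtain ⟨d, rfl⟩ := lt_iff_exists.1 h
    obtain ⟨k, rfl⟩ := lt_iff_exists.1 ha
    rw [zero_add, mul_add]
    refine lt_add_of_pos_right _ ?_
    rw [mul_sc, add_sc]
    exact sc_pos _
  mul_lt_mul_of_pos_right a ha b c h := by
    obtain ⟨d, rfl⟩ := lt_iff_exists.1 h
    obtain ⟨k, rfl⟩ := lt_iff_exists.1 ha
    rw [zero_add, add_mul]
    refine lt_add_of_pos_right _ ?_
    rw [mul_sc, add_sc]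
    exact sc_pos _
  zero_le_one := zero_le

instance : OrderedSub (M.D nat) where
  tsub_le_iff_right a b c := by
    constructor
    · intro h
      have h1 := add_sub_comm b a
      calc a ≤ a + (b - a) := le_self_add
        _ = b + (a - b) := h1.symm
        _ ≤ c + b := by rw [add_comm]; exact add_le_add_left h b
    · intro h
      rcases sub_eq_zero_total a b with h1 | h1
      · rw [h1]; exact zero_le
      · have h2 := add_sub_comm b a
        rw [h1, add_zero, add_comm] at h2
        rw [← h2] at h
        exact le_of_add_le_add_right h

theorem pd_eq_sub (a : M.D nat) : pd a = a - 1 := by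
  rw [one_eq_sc, sub_sc, sub_zero']

end Arith

section Defined

variable {M : Str} {Γ : List Ty}

@[simp] theorem sat_leN (e : Env M Γ) (s t : Tm Γ nat) : (leN s t).sat e ↔ s.ev e ≤ t.ev e := by
  simp [leN, Arith.le_def]

end Defined

/-! ### Pairing and bounded search in models -/

section Definitions

variable {M : Str} {Γ : List Ty}

def powV (a : M.D nat) : M.D nat := powC.ev Env.nil ⬩ a
def caseV (a b c : M.D nat) : M.D nat := caseC.ev Env.nil ⬩ a ⬩ b ⬩ c
def bminV (P : M.D Ty.one) (n : M.D nat) : M.D nat := bminC.ev Env.nil ⬩ P ⬩ n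
def triV (a : M.D nat) : M.D nat := triC.ev Env.nil ⬩ a
def pairV (a b : M.D nat) : M.D nat := pairC.ev Env.nil ⬩ a ⬩ b
def diagV (a : M.D nat) : M.D nat := diagC.ev Env.nil ⬩ a
def fstV (a : M.D nat) : M.D nat := fstC.ev Env.nil ⬩ a
def sndV (a : M.D nat) : M.D nat := sndC.ev Env.nil ⬩ a
def parV (a : M.D nat) : M.D nat := parC.ev Env.nil ⬩ a
def halfV (a : M.D nat) : M.D nat := halfC.ev Env.nil ⬩ a

variable (e : Env M Γ)

@[simp] theorem ev_pow (s : Tm Γ nat) : (pow s).ev e = powV (s.ev e) := by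
  rw [pow, ev_app, Tm.ev_emb]; rfl

@[simp] theorem ev_caseZ (s t u : Tm Γ nat) :
    (caseZ s t u).ev e = caseV (s.ev e) (t.ev e) (u.ev e) := by
  rw [caseZ, ev_app, ev_app, ev_app, Tm.ev_emb]; rfl

@[simp] theorem ev_bmin (P : Tm Γ Ty.one) (s : Tm Γ nat) :
    (bmin P s).ev e = bminV (P.ev e) (s.ev e) := by
  rw [bmin, ev_app, ev_app, Tm.ev_emb]; rfl

@[simp] theorem ev_tri (s : Tm Γ nat) : (tri s).ev e = triV (s.ev e) := by
  rw [tri, ev_app, Tm.ev_emb]; rfl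

@[simp] theorem ev_pair (s t : Tm Γ nat) : (pair s t).ev e = pairV (s.ev e) (t.ev e) := by
  rw [pair, ev_app, ev_app, Tm.ev_emb]; rfl

@[simp] theorem ev_diag (s : Tm Γ nat) : (diag s).ev e = diagV (s.ev e) := by
  rw [diag, ev_app, Tm.ev_emb]; rfl

@[simp] theorem ev_fst (s : Tm Γ nat) : (fst s).ev e = fstV (s.ev e) := by
  rw [fst, ev_app, Tm.ev_emb]; rfl

@[simp] theorem ev_snd (s : Tm Γ nat) : (snd s).ev e = sndV (s.ev e) := by
  rw [snd, ev_app, Tm.ev_emb]; rfl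

@[simp] theorem ev_par (s : Tm Γ nat) : (par s).ev e = parV (s.ev e) := by
  rw [par, ev_app, Tm.ev_emb]; rfl

@[simp] theorem ev_half (s : Tm Γ nat) : (half s).ev e = halfV (s.ev e) := by
  rw [half, ev_app, Tm.ev_emb]; rfl

@[simp] theorem ev_nOne : (nOne : Tm Γ nat).ev e = 1 := rfl

end Definitions

section Specifications

variable {M : Str} [M.IsModel] {Γ : List Ty}

open Arith

@[simp] theorem ev_nTwo (e : Env M Γ) : (nTwo : Tm Γ nat).ev e = 2 := by
  rw [← one_add_one_eq_two, ← sc_eq]; rfl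

theorem powV_zero : powV (0 : M.D nat) = 1 := by simp [powV, powC]

theorem powV_sc (a : M.D nat) : powV (sc a) = 2 * powV a := by
  rw [two_mul]
  simp [powV, powC]
  rw [recV_congr]
  simp

@[simp] theorem caseV_zero (a b : M.D nat) : caseV 0 a b = a := by simp [caseV, caseC]

@[simp] theorem caseV_sc (c a b : M.D nat) : caseV (sc c) a b = b := by simp [caseV, caseC]

theorem caseV_pos {c : M.D nat} (h : c ≠ 0) (a b : M.D nat) : caseV c a b = b := by
  obtain rfl | ⟨d, rfl⟩ := eq_zero_or_sc c
  · exact (h rfl).elim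
  · exact caseV_sc d a b

theorem bminV_zero (P : M.D Ty.one) : bminV P 0 = 0 := by simp [bminV, bminC]

theorem bminV_sc (P : M.D Ty.one) (n : M.D nat) :
    bminV P (sc n) = caseV (P ⬩ bminV P n) (bminV P n) (sc (bminV P n)) := by
  have h : bminV P n = recV n 0
      ((lam (lam (caseZ (v3 ⬝ v1) v1 (succ v1))) : Tm [nat, Ty.one] _).ev
        (Env.cons (sc n) (Env.cons P Env.nil))) := by
    simp [bminV, bminC]
    exact recV_congr (by simp) _ _
  conv_lhs => simp [bminV, bminC]
  rw [h]

/-- The search stays at a zero of `P` once it has reached one and advances otherwise; while it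
advances, its value is the bound itself. -/
theorem bminV_spec (P : M.D Ty.one) (n : M.D nat) : bminV P n ≤ n ∧
    (bminV P n = n ∨ P ⬩ bminV P n = 0) ∧ ∀ j, j < bminV P n → P ⬩ j ≠ 0 := by
  refine nat_induct (P := fun n => bminV P n ≤ n ∧
    (bminV P n = n ∨ P ⬩ bminV P n = 0) ∧ ∀ j, j < bminV P n → P ⬩ j ≠ 0)
    (leN (bmin v1 v0) v0 ⩑ .or (bmin v1 v0 ≐ v0) (v1 ⬝ bmin v1 v0 ≐ zero) ⩑
      .all nat ((leN (bmin v2 v1) v0).neg ⟹' (v2 ⬝ v0 ≐ zero).neg)) (Env.cons P Env.nil)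
    (by simp) (by simp [bminV_zero]) (fun n ⟨h1, h2, h3⟩ => ?_) n
  rw [bminV_sc]
  by_cases h : P ⬩ bminV P n = 0
  · rw [h, caseV_zero]
    exact ⟨h1.trans (by rw [sc_eq]; exact le_self_add), .inr h, h3⟩
  · rw [caseV_pos h]
    have h4 := h2.resolve_right h
    refine ⟨by rw [h4], .inl (by rw [h4]), fun j hj => ?_⟩
    rw [lt_sc_iff] at hj
    rcases hj.lt_or_eq with hj | rfl
    · exact h3 j hj
    · exact h

theorem triV_sc (a : M.D nat) : triV (sc a) = triV a + sc a := by
  simp [triV, triC]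
  rw [recV_congr]
  simp

theorem le_triV (a : M.D nat) : a ≤ triV a := by
  obtain rfl | ⟨a, rfl⟩ := eq_zero_or_sc a
  · exact zero_le
  · rw [triV_sc]; exact le_add_self

theorem triV_mono_add (a b : M.D nat) : triV a ≤ triV (a + b) :=
  nat_induct (P := fun b => triV a ≤ triV (a + b)) (leN (tri v1) (tri (add v1 v0)))
    (Env.cons a Env.nil) (by simp) (by rw [add_zero])
    (fun n hn => by rw [add_sc, triV_sc]; exact hn.trans le_self_add) b

theorem triV_mono {a b : M.D nat} (h : a ≤ b) : triV a ≤ triV b := by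
  obtain ⟨c, rfl⟩ := le_iff_exists.1 h
  exact triV_mono_add a c

theorem pairV_eq (a b : M.D nat) : pairV a b = triV (a + b) + a := by simp [pairV, pairC]

/-- The diagonal is found by searching below `x`, and this bound is large enough because `s ≤ triV s
≤ x`. A search value below `s` is thus not the default value, and it would contradict monotonicity
of `triV`. -/
theorem diagV_eq_of {x s : M.D nat} (h1 : triV s ≤ x) (h2 : x < triV (sc s)) :
    diagV x = s := by
  have h : diagV x = bminV ((lam (sub (succ v1) (tri (succ v0))) : Tm [nat] _).ev
      (Env.cons x Env.nil)) x := by simp [diagV, diagC]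
  have hP : ∀ j, (lam (sub (succ v1) (tri (succ v0))) : Tm [nat] _).ev
      (Env.cons x Env.nil) ⬩ j = 0 ↔ x < triV (sc j) := by
    intro j
    simp only [ev_lam_app, ev_sub, ev_succ, ev_tri, ev_v0, ev_v1, Env.cons_succ, Env.cons_zero]
    rw [← le_def, ← not_lt, lt_sc_iff, not_le]
  obtain ⟨h3, h4, h5⟩ := bminV_spec ((lam (sub (succ v1) (tri (succ v0))) : Tm [nat] _).ev
      (Env.cons x Env.nil)) x
  simp only [← h, hP, ne_eq] at h3 h4 h5
  rcases lt_trichotomy (diagV x) s with h6 | h6 | h6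
  · have h7 : diagV x < x := h6.trans_le ((le_triV s).trans h1)
    have h8 := h4.resolve_left h7.ne
    have h9 : sc (diagV x) ≤ s := by rw [← not_lt, lt_sc_iff, not_le]; exact h6
    exact absurd h8 (not_lt.2 ((triV_mono h9).trans h1))
  · exact h6
  · exact absurd h2 (h5 s h6)

theorem diagV_pairV (a b : M.D nat) : diagV (pairV a b) = a + b := by
  rw [pairV_eq]
  refine diagV_eq_of le_self_add ?_
  rw [triV_sc]
  exact add_lt_add_right (lt_sc_iff.2 le_self_add) _

@[simp] theorem fstV_pairV (a b : M.D nat) : fstV (pairV a b) = a := by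
  have : fstV (pairV a b) = pairV a b - triV (diagV (pairV a b)) := by simp [fstV, fstC]
  rw [this, diagV_pairV, pairV_eq, add_tsub_cancel_left]

@[simp] theorem sndV_pairV (a b : M.D nat) : sndV (pairV a b) = b := by
  have : sndV (pairV a b) = diagV (pairV a b) - fstV (pairV a b) := by simp [sndV, sndC]
  rw [this, diagV_pairV, fstV_pairV, add_tsub_cancel_left]

theorem parV_zero : parV (0 : M.D nat) = 0 := by simp [parV, parC]

theorem parV_sc (a : M.D nat) : parV (sc a) = 1 - parV a := by
  simp [parV, parC]
  rw [recV_congr]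
  simp

theorem halfV_zero : halfV (0 : M.D nat) = 0 := by simp [halfV, halfC]

theorem halfV_sc (a : M.D nat) : halfV (sc a) = halfV a + parV a := by
  simp [halfV, halfC]
  rw [recV_congr]
  simp

theorem par_half_two_mul (a : M.D nat) : parV (2 * a) = 0 ∧ halfV (2 * a) = a := by
  refine nat_induct (P := fun a => parV (2 * a) = 0 ∧ halfV (2 * a) = a)
    (par (mul nTwo v0) ≐ zero ⩑ half (mul nTwo v0) ≐ v0) Env.nil (by simp)
    (by simp [parV_zero, halfV_zero]) (fun n hn => ?_) a
  have h : 2 * sc n = sc (sc (2 * n)) := by simp only [sc_eq]; ring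
  rw [h, parV_sc, parV_sc, halfV_sc, halfV_sc, parV_sc, hn.1, hn.2]
  refine ⟨by simp, ?_⟩
  rw [sc_eq]; simp

theorem parV_cases (a : M.D nat) : parV a = 0 ∨ parV a = 1 := by
  refine nat_induct (P := fun a => parV a = 0 ∨ parV a = 1)
    (.or (par v0 ≐ zero) (par v0 ≐ nOne)) Env.nil (by simp)
    (.inl parV_zero) (fun n hn => ?_) a
  rw [parV_sc]
  rcases hn with h | h <;> simp [h]

/-- The second bound carries the induction at odd numbers, and it is the one needed for codes of
negative rationals in `abs_qval_le`. -/
theorem halfV_le (a : M.D nat) : halfV a ≤ a ∧ halfV a + parV a ≤ a := by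
  refine nat_induct (P := fun a => halfV a ≤ a ∧ halfV a + parV a ≤ a)
    (leN (half v0) v0 ⩑ leN (add (half v0) (par v0)) v0) Env.nil (by simp)
    (by simp [halfV_zero, parV_zero]) (fun n hn => ?_) a
  rw [parV_sc, halfV_sc]
  rcases parV_cases n with h | h
  · rw [h, sc_eq]
    exact ⟨by rw [add_zero]; exact hn.1.trans le_self_add,
      by rw [add_zero, tsub_zero]; exact add_le_add_left hn.1 1⟩
  · have := hn.2
    rw [h] at this ⊢
    rw [sc_eq, tsub_self, add_zero]
    exact ⟨this.trans le_self_add, this.trans le_self_add⟩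

end Specifications

/-! ### The ordered field of fractions of an ordered semiring -/

section Differences

variable (N : Type*) [CommSemiring N] [LinearOrder N] [IsStrictOrderedRing N]

/-- As `N` may be nonstandard, its rationals have to be built from it: formal differences, then
fractions. Cancellation in `N` makes this simple relation transitive. -/
def diffSetoid : Setoid (N × N) where
  r p q := p.1 + q.2 = q.1 + p.2
  iseqv :=
    { refl := fun _ => rfl
      symm := fun h => h.symm
      trans := fun {p q r} h h' => by
        refine add_right_cancel (b := q.1 + q.2) ?_
        calc p.1 + r.2 + (q.1 + q.2) = (p.1 + q.2) + (q.1 + r.2) := by ring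
          _ = (q.1 + p.2) + (r.1 + q.2) := by rw [h, h']
          _ = r.1 + p.2 + (q.1 + q.2) := by ring }

/-- The ring of formal differences. -/
def Diff : Type _ := Quotient (diffSetoid N)

variable {N}

namespace Diff

def mk (a b : N) : Diff N := Quotient.mk (diffSetoid N) (a, b)

theorem mk_eq {a b c d : N} : mk a b = mk c d ↔ a + d = c + b :=
  ⟨fun h => Quotient.exact (s := diffSetoid N) h, fun h => Quotient.sound (s := diffSetoid N) h⟩

theorem ind {P : Diff N → Prop} (h : ∀ a b, P (mk a b)) (x : Diff N) : P x :=
  Quotient.ind (s := diffSetoid N) (fun p => h p.1 p.2) x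

instance : Zero (Diff N) := ⟨mk 0 0⟩
instance : One (Diff N) := ⟨mk 1 0⟩

instance : Neg (Diff N) :=
  ⟨Quotient.map (fun p => (p.2, p.1)) fun p q (h : p.1 + q.2 = q.1 + p.2) => by
    change p.2 + q.1 = q.2 + p.1
    rw [add_comm, ← h, add_comm]⟩

instance : Add (Diff N) :=
  ⟨Quotient.map₂ (fun p q => (p.1 + q.1, p.2 + q.2))
    fun p q (h : p.1 + q.2 = q.1 + p.2) r s (h' : r.1 + s.2 = s.1 + r.2) => by
      change p.1 + r.1 + (q.2 + s.2) = q.1 + s.1 + (p.2 + r.2)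
      calc p.1 + r.1 + (q.2 + s.2) = (p.1 + q.2) + (r.1 + s.2) := by ring
        _ = q.1 + s.1 + (p.2 + r.2) := by rw [h, h']; ring⟩

instance : Mul (Diff N) :=
  ⟨Quotient.map₂ (fun p q => (p.1 * q.1 + p.2 * q.2, p.1 * q.2 + p.2 * q.1))
    fun p q (h : p.1 + q.2 = q.1 + p.2) r s (h' : r.1 + s.2 = s.1 + r.2) => by
      change p.1 * r.1 + p.2 * r.2 + (q.1 * s.2 + q.2 * s.1) =
        q.1 * s.1 + q.2 * s.2 + (p.1 * r.2 + p.2 * r.1)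
      -- The added terms let both sides be regrouped around `p.1 + q.2`, `q.1 + p.2`, `r.1 + s.2`
      -- and `s.1 + r.2`, to which the hypotheses apply.
      refine add_right_cancel (b := q.2 * r.1 + q.1 * r.2 + (q.1 * r.1 + q.2 * r.2)) ?_
      calc _ = (p.1 + q.2) * r.1 + (q.1 + p.2) * r.2 + q.1 * (r.1 + s.2) + q.2 * (s.1 + r.2) := by
            ring
        _ = (q.1 + p.2) * r.1 + (p.1 + q.2) * r.2 + q.1 * (s.1 + r.2) + q.2 * (r.1 + s.2) := by
            rw [h, h']
        _ = _ := by ring⟩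

theorem mk_add (a b c d : N) : mk a b + mk c d = mk (a + c) (b + d) := rfl
theorem mk_mul (a b c d : N) : mk a b * mk c d = mk (a * c + b * d) (a * d + b * c) := rfl
theorem neg_mk (a b : N) : -mk a b = mk b a := rfl
theorem zero_def : (0 : Diff N) = mk 0 0 := rfl
theorem one_def : (1 : Diff N) = mk 1 0 := rfl

instance : CommRing (Diff N) where
  add_assoc x y z := by
    induction x using ind; induction y using ind; induction z using ind
    simp only [mk_add, add_assoc]
  zero_add x := by induction x using ind; simp only [zero_def, mk_add, zero_add]
  add_zero x := by induction x using ind; simp only [zero_def, mk_add, add_zero]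
  add_comm x y := by
    induction x using ind; induction y using ind
    simp only [mk_add, mk_eq]; ring
  left_distrib x y z := by
    induction x using ind; induction y using ind; induction z using ind
    simp only [mk_add, mk_mul, mk_eq]; ring
  right_distrib x y z := by
    induction x using ind; induction y using ind; induction z using ind
    simp only [mk_add, mk_mul, mk_eq]; ring
  zero_mul x := by
    induction x using ind
    simp only [zero_def, mk_mul, mk_eq]; ring
  mul_zero x := by
    induction x using ind
    simp only [zero_def, mk_mul, mk_eq]; ring
  mul_assoc x y z := by
    induction x using ind; induction y using ind; induction z using ind
    simp only [mk_mul, mk_eq]; ring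
  one_mul x := by
    induction x using ind
    simp only [one_def, mk_mul, mk_eq]; ring
  mul_one x := by
    induction x using ind
    simp only [one_def, mk_mul, mk_eq]; ring
  mul_comm x y := by
    induction x using ind; induction y using ind
    simp only [mk_mul, mk_eq]; ring
  neg_add_cancel x := by
    induction x using ind
    simp only [neg_mk, mk_add, zero_def, mk_eq]; ring
  nsmul := nsmulRec
  zsmul := zsmulRec
  npow := npowRec

/-- The inclusion of the semiring. -/
def of : N →+* Diff N where
  toFun a := mk a 0
  map_zero' := rfl
  map_one' := rfl
  map_add' a b := by rw [mk_add, add_zero]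
  map_mul' a b := by rw [mk_mul, mk_eq]; ring

theorem of_injective : Function.Injective (of (N := N)) := fun a b h => by
  simpa using mk_eq.1 h

variable [CanonicallyOrderedAdd N]

/-- Subtraction of the smaller entry is possible in a canonically ordered semiring. This reduces
zero divisors and signs in the ring to questions in `N`. -/
theorem eq_of_or_neg (x : Diff N) : ∃ a : N, x = of a ∨ x = -of a := by
  induction x using ind with
  | h a b =>
    rcases le_total b a with h | h
    · obtain ⟨c, rfl⟩ := exists_add_of_le h
      exact ⟨c, .inl (mk_eq.2 (by ring))⟩
    · obtain ⟨c, rfl⟩ := exists_add_of_le h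
      refine ⟨c, .inr ?_⟩
      change _ = -mk c 0
      rw [neg_mk, mk_eq]; ring

instance : IsDomain (Diff N) := by
  have : NoZeroDivisors (Diff N) := ⟨fun {x y} h => by
    have key : ∀ a b : N, of a * of b = 0 → of a = 0 ∨ of b = 0 := by
      intro a b h
      rw [← map_mul, map_eq_zero_iff _ of_injective] at h
      rcases mul_eq_zero.1 h with rfl | rfl
      · exact .inl (map_zero _)
      · exact .inr (map_zero _)
    obtain ⟨a, rfl | rfl⟩ := eq_of_or_neg x <;> obtain ⟨b, rfl | rfl⟩ := eq_of_or_neg y <;>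
      simpa using key a b (by simpa using h)⟩
  have : Nontrivial (Diff N) := of_injective.nontrivial
  exact NoZeroDivisors.to_isDomain _

end Diff

/-- The field of fractions. -/
abbrev Frac (N : Type*) [CommSemiring N] [LinearOrder N] [IsStrictOrderedRing N]
    [CanonicallyOrderedAdd N] : Type _ := FractionRing (Diff N)

variable [CanonicallyOrderedAdd N]

namespace Frac

/-- The inclusion of the semiring. -/
noncomputable def of : N →+* Frac N := (algebraMap (Diff N) (Frac N)).comp Diff.of

theorem of_injective : Function.Injective (of (N := N)) :=
  (IsFractionRing.injective (Diff N) (Frac N)).comp Diff.of_injective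

theorem of_ne_zero {a : N} (h : a ≠ 0) : of a ≠ 0 := (map_ne_zero_iff _ of_injective).2 h

theorem exists_eq (x : Frac N) : ∃ a b : N, b ≠ 0 ∧ (x = of a / of b ∨ x = -(of a / of b)) := by
  obtain ⟨p, q, hq, rfl⟩ := IsFractionRing.div_surjective (A := Diff N) x
  have hq := nonZeroDivisors.ne_zero hq
  obtain ⟨a, ha⟩ := Diff.eq_of_or_neg p
  obtain ⟨b, hb⟩ := Diff.eq_of_or_neg q
  refine ⟨a, b, ?_, ?_⟩
  · rintro rfl
    rcases hb with rfl | rfl <;> simp at hq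
  · rcases ha with rfl | rfl <;> rcases hb with rfl | rfl <;> simp [of, neg_div, div_neg]

/-- The nonnegative fractions. -/
noncomputable def cone : RingCone (Frac N) where
  carrier := {x | ∃ a b : N, b ≠ 0 ∧ x = of a / of b}
  zero_mem' := ⟨0, 1, one_ne_zero, by simp⟩
  one_mem' := ⟨1, 1, one_ne_zero, by simp⟩
  add_mem' := by
    rintro _ _ ⟨a, b, hb, rfl⟩ ⟨c, d, hd, rfl⟩
    refine ⟨a * d + b * c, b * d, mul_ne_zero hb hd, ?_⟩
    rw [div_add_div _ _ (of_ne_zero hb) (of_ne_zero hd)]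
    simp
  mul_mem' := by
    rintro _ _ ⟨a, b, hb, rfl⟩ ⟨c, d, hd, rfl⟩
    exact ⟨a * c, b * d, mul_ne_zero hb hd, by simp [div_mul_div_comm]⟩
  eq_zero_of_mem_of_neg_mem' := by
    rintro _ ⟨a, b, hb, rfl⟩ ⟨c, d, hd, h⟩
    have h1 : of a / of b + of c / of d = 0 := by rw [← h]; ring
    rw [div_add_div _ _ (of_ne_zero hb) (of_ne_zero hd), div_eq_zero_iff] at h1
    have h2 := h1.resolve_right (mul_ne_zero (of_ne_zero hb) (of_ne_zero hd))
    rw [← map_mul, ← map_mul, ← map_add, map_eq_zero_iff _ of_injective] at h2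
    have h3 : a * d = 0 := le_antisymm (by rw [← h2]; exact le_self_add) zero_le
    rcases mul_eq_zero.1 h3 with rfl | h4
    · simp
    · exact (hd h4).elim

theorem mem_cone {x : Frac N} : x ∈ cone (N := N) ↔ ∃ a b : N, b ≠ 0 ∧ x = of a / of b := Iff.rfl

instance : HasMemOrNegMem (cone (N := N)) where
  mem_or_neg_mem x := by
    obtain ⟨a, b, hb, rfl | rfl⟩ := exists_eq x
    · exact .inl ⟨a, b, hb, rfl⟩
    · exact .inr ⟨a, b, hb, by simp⟩

open Classical in
noncomputable instance : LinearOrder (Frac N) := .mkOfAddGroupCone (cone (N := N))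

instance : IsOrderedRing (Frac N) := .mkOfCone (cone (N := N))

instance : IsStrictOrderedRing (Frac N) := IsOrderedRing.toIsStrictOrderedRing _

theorem nonneg_iff {x : Frac N} : 0 ≤ x ↔ ∃ a b : N, b ≠ 0 ∧ x = of a / of b := by
  rw [← mem_cone]
  have h : 0 ≤ x ↔ x - 0 ∈ cone (N := N) := Iff.rfl
  rw [h, sub_zero]

theorem of_nonneg (a : N) : 0 ≤ of a := nonneg_iff.2 ⟨a, 1, one_ne_zero, by simp⟩

theorem of_le {a b : N} : of a ≤ of b ↔ a ≤ b := by
  have key : ∀ {a b : N}, a ≤ b → of a ≤ of b := by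
    intro a b h
    obtain ⟨c, rfl⟩ := exists_add_of_le h
    rw [map_add]
    exact le_add_of_nonneg_right (of_nonneg c)
  refine ⟨fun h => ?_, key⟩
  rcases le_total a b with h' | h'
  · exact h'
  · exact (of_injective (le_antisymm h (key h'))).le

theorem of_pos {a : N} (h : a ≠ 0) : 0 < of a := lt_of_le_of_ne (of_nonneg a) (of_ne_zero h).symm

/-- By discreteness the numerator of a positive fraction is at least `1`. This is the Archimedean
property relative to `N`. -/
theorem exists_inv_le (h1 : ∀ a : N, a ≠ 0 → 1 ≤ a) {x : Frac N} (hx : 0 < x) :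
    ∃ b : N, b ≠ 0 ∧ (of b)⁻¹ ≤ x := by
  obtain ⟨a, b, hb, rfl⟩ := nonneg_iff.1 hx.le
  have ha : a ≠ 0 := by rintro rfl; simp at hx
  refine ⟨b, hb, ?_⟩
  rw [inv_eq_one_div, ← map_one (of (N := N))]
  exact div_le_div_of_nonneg_right (of_le.2 (h1 a ha)) (of_nonneg b)

end Frac

end Differences

open Arith

/-! ### Rational numbers in models -/

section Definitions

variable {M : Str} {Γ : List Ty}

def qposV (a : M.D nat) : M.D nat := qposC.ev Env.nil ⬩ a
def qnegPartV (a : M.D nat) : M.D nat := qnegPartC.ev Env.nil ⬩ a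
def qencV (p n d : M.D nat) : M.D nat := qencC.ev Env.nil ⬩ p ⬩ n ⬩ d
def qaddV (a b : M.D nat) : M.D nat := qaddC.ev Env.nil ⬩ a ⬩ b
def qnegV (a : M.D nat) : M.D nat := qnegC.ev Env.nil ⬩ a
def qmulV (a b : M.D nat) : M.D nat := qmulC.ev Env.nil ⬩ a ⬩ b
def qabsV (a : M.D nat) : M.D nat := qabsC.ev Env.nil ⬩ a
def qinvV (a : M.D nat) : M.D nat := qinvC.ev Env.nil ⬩ a
def qleV (a b : M.D nat) : M.D nat := qleC.ev Env.nil ⬩ a ⬩ b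
def qtwoV (a : M.D nat) : M.D nat := qtwoC.ev Env.nil ⬩ a

variable (e : Env M Γ)

@[simp] theorem ev_qpos (s : Tm Γ nat) : (qpos s).ev e = qposV (s.ev e) := by
  rw [qpos, ev_app, Tm.ev_emb]; rfl

@[simp] theorem ev_qnegPart (s : Tm Γ nat) : (qnegPart s).ev e = qnegPartV (s.ev e) := by
  rw [qnegPart, ev_app, Tm.ev_emb]; rfl

@[simp] theorem ev_qden (s : Tm Γ nat) : (qden s).ev e = sc (sndV (s.ev e)) := by
  rw [qden, ev_succ, ev_snd]

@[simp] theorem ev_qenc (s t u : Tm Γ nat) :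
    (qenc s t u).ev e = qencV (s.ev e) (t.ev e) (u.ev e) := by
  rw [qenc, ev_app, ev_app, ev_app, Tm.ev_emb]; rfl

@[simp] theorem ev_qadd (s t : Tm Γ nat) : (qadd s t).ev e = qaddV (s.ev e) (t.ev e) := by
  rw [qadd, ev_app, ev_app, Tm.ev_emb]; rfl

@[simp] theorem ev_qneg (s : Tm Γ nat) : (qneg s).ev e = qnegV (s.ev e) := by
  rw [qneg, ev_app, Tm.ev_emb]; rfl

@[simp] theorem ev_qmul (s t : Tm Γ nat) : (qmul s t).ev e = qmulV (s.ev e) (t.ev e) := by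
  rw [qmul, ev_app, ev_app, Tm.ev_emb]; rfl

@[simp] theorem ev_qabs (s : Tm Γ nat) : (qabs s).ev e = qabsV (s.ev e) := by
  rw [qabs, ev_app, Tm.ev_emb]; rfl

@[simp] theorem ev_qinv (s : Tm Γ nat) : (qinv s).ev e = qinvV (s.ev e) := by
  rw [qinv, ev_app, Tm.ev_emb]; rfl

@[simp] theorem ev_qle (s t : Tm Γ nat) : (qle s t).ev e = qleV (s.ev e) (t.ev e) := by
  rw [qle, ev_app, ev_app, Tm.ev_emb]; rfl

@[simp] theorem ev_qtwo (s : Tm Γ nat) : (qtwo s).ev e = qtwoV (s.ev e) := by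
  rw [qtwo, ev_app, Tm.ev_emb]; rfl

end Definitions

variable {M : Str} [M.IsModel] {Γ : List Ty}

variable (M) in
/-- The field of rational numbers of a model. -/
def RatV : Type := Frac (M.D nat)

noncomputable instance : Field (RatV M) := inferInstanceAs (Field (Frac (M.D nat)))
noncomputable instance : LinearOrder (RatV M) := inferInstanceAs (LinearOrder (Frac (M.D nat)))
instance : IsStrictOrderedRing (RatV M) :=
  inferInstanceAs (IsStrictOrderedRing (Frac (M.D nat)))

/-- The inclusion of the natural numbers of a model. -/
noncomputable def inc : M.D nat →+* RatV M := Frac.of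

theorem inc_le {a b : M.D nat} : inc a ≤ inc b ↔ a ≤ b := Frac.of_le
theorem inc_nonneg (a : M.D nat) : 0 ≤ inc a := Frac.of_nonneg a
theorem inc_pos {a : M.D nat} (h : a ≠ 0) : 0 < inc a := Frac.of_pos h

theorem one_le_of_ne_zero {a : M.D nat} (h : a ≠ 0) : 1 ≤ a := by
  obtain rfl | ⟨b, rfl⟩ := eq_zero_or_sc a
  · exact (h rfl).elim
  · rw [sc_eq]; exact le_add_self

theorem exists_inv_inc_le {x : RatV M} (hx : 0 < x) : ∃ b : M.D nat, b ≠ 0 ∧ (inc b)⁻¹ ≤ x :=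
  Frac.exists_inv_le (fun _ => one_le_of_ne_zero) hx

theorem inc_sub_sub (a b : M.D nat) : inc (a - b) - inc (b - a) = inc a - inc b := by
  have h := congrArg inc (add_sub_comm b a)
  simp only [map_add] at h
  linear_combination h

/-- The rational number with code `c`. -/
noncomputable def qval (c : M.D nat) : RatV M :=
  (inc (qposV c) - inc (qnegPartV c)) / inc (sc (sndV c))

theorem qposV_eq (a : M.D nat) : qposV a = halfV (fstV a) * (1 - parV (fstV a)) := by
  simp [qposV, qposC]

theorem qnegPartV_eq (a : M.D nat) : qnegPartV a = sc (halfV (fstV a)) * parV (fstV a) := by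
  simp [qnegPartV, qnegPartC]

theorem qposV_pair_even (a b : M.D nat) : qposV (pairV (2 * a) b) = a := by
  rw [qposV_eq, fstV_pairV, (par_half_two_mul a).1, (par_half_two_mul a).2, tsub_zero, mul_one]

theorem qnegPartV_pair_even (a b : M.D nat) : qnegPartV (pairV (2 * a) b) = 0 := by
  rw [qnegPartV_eq, fstV_pairV, (par_half_two_mul a).1, mul_zero]

theorem qval_pair_even (a b : M.D nat) : qval (pairV (2 * a) b) = inc a / inc (sc b) := by
  rw [qval, qposV_pair_even, qnegPartV_pair_even, sndV_pairV, map_zero, sub_zero]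

theorem qval_pair_odd (a b : M.D nat) :
    qval (pairV (sc (2 * a)) b) = -inc (sc a) / inc (sc b) := by
  rw [qval, qposV_eq, qnegPartV_eq, fstV_pairV, sndV_pairV, parV_sc, halfV_sc,
    (par_half_two_mul a).1, (par_half_two_mul a).2]
  simp

theorem qposV_or_qnegPartV (c : M.D nat) : qposV c = 0 ∨ qnegPartV c = 0 := by
  rw [qposV_eq, qnegPartV_eq]
  rcases parV_cases (fstV c) with h | h <;> simp [h]

theorem qencV_eq (p n d : M.D nat) : qencV p n d =
    pairV (caseV (n - p) (2 * (p - n)) (pd (2 * (n - p)))) (pd d) := by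
  simp [qencV, qencC]

theorem sc_pd {d : M.D nat} (h : d ≠ 0) : sc (pd d) = d := by
  obtain rfl | ⟨b, rfl⟩ := eq_zero_or_sc d
  · exact (h rfl).elim
  · rw [pd_sc]

/-- All operations on codes end with this encoder, so after this lemma they are checked by field
algebra alone. -/
theorem qval_qencV (p n : M.D nat) {d : M.D nat} (hd : d ≠ 0) :
    qval (qencV p n d) = (inc p - inc n) / inc d := by
  rw [qencV_eq, ← inc_sub_sub]
  obtain h | ⟨k, hk⟩ := eq_zero_or_sc (n - p)
  · rw [h, caseV_zero, qval_pair_even, sc_pd hd, map_zero, sub_zero]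
  · have h1 : p - n = 0 := by
      rw [tsub_eq_zero_iff_le]
      refine le_of_not_ge fun h => ?_
      rw [tsub_eq_zero_of_le h] at hk
      exact sc_ne_zero k hk.symm
    -- The numerator `-(k + 1)` has the odd code `2 k + 1`, which is the predecessor of `2 (k + 1)`.
    have h2 : pd (2 * sc k) = sc (2 * k) := by
      have : 2 * sc k = sc (sc (2 * k)) := by simp only [sc_eq]; ring
      rw [this, pd_sc]
    rw [hk, caseV_sc, h2, qval_pair_odd, sc_pd hd, h1, map_zero, zero_sub]

theorem inc_sc_ne_zero (a : M.D nat) : inc (sc a) ≠ 0 := (inc_pos (sc_ne_zero a)).ne'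

theorem qval_qaddV (a b : M.D nat) : qval (qaddV a b) = qval a + qval b := by
  have h : qaddV a b = qencV (qposV a * sc (sndV b) + qposV b * sc (sndV a))
      (qnegPartV a * sc (sndV b) + qnegPartV b * sc (sndV a)) (sc (sndV a) * sc (sndV b)) := by
    simp [qaddV, qaddC]
  rw [h, qval_qencV _ _ (mul_ne_zero (sc_ne_zero _) (sc_ne_zero _)), qval, qval,
    div_add_div _ _ (inc_sc_ne_zero _) (inc_sc_ne_zero _)]
  simp only [map_add, map_mul]
  congr 1
  ring

theorem qval_qnegV (a : M.D nat) : qval (qnegV a) = -qval a := by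
  have h : qnegV a = qencV (qnegPartV a) (qposV a) (sc (sndV a)) := by simp [qnegV, qnegC]
  rw [h, qval_qencV _ _ (sc_ne_zero _), qval, ← neg_div, neg_sub]

theorem qval_qmulV (a b : M.D nat) : qval (qmulV a b) = qval a * qval b := by
  have h : qmulV a b = qencV (qposV a * qposV b + qnegPartV a * qnegPartV b)
      (qposV a * qnegPartV b + qnegPartV a * qposV b) (sc (sndV a) * sc (sndV b)) := by
    simp [qmulV, qmulC]
  rw [h, qval_qencV _ _ (mul_ne_zero (sc_ne_zero _) (sc_ne_zero _)), qval, qval,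
    div_mul_div_comm]
  simp only [map_add, map_mul]
  congr 1
  ring

theorem abs_qval (a : M.D nat) :
    |qval a| = (inc (qposV a) + inc (qnegPartV a)) / inc (sc (sndV a)) := by
  rw [qval, abs_div, abs_of_nonneg (inc_nonneg (sc (sndV a)))]
  congr 1
  rcases qposV_or_qnegPartV a with h | h
  · rw [h, map_zero, zero_sub, zero_add, abs_neg, abs_of_nonneg (inc_nonneg _)]
  · rw [h, map_zero, sub_zero, add_zero, abs_of_nonneg (inc_nonneg _)]

theorem qabsV_eq (a : M.D nat) :
    qabsV a = qencV (qposV a + qnegPartV a) 0 (sc (sndV a)) := by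
  simp [qabsV, qabsC]

theorem qval_qabsV (a : M.D nat) : qval (qabsV a) = |qval a| := by
  rw [qabsV_eq, qval_qencV _ _ (sc_ne_zero _), abs_qval, map_add, map_zero, sub_zero]

theorem qleV_eq_zero {a b : M.D nat} : qleV a b = 0 ↔ qval a ≤ qval b := by
  have h : qleV a b = (qposV a * sc (sndV b) + qnegPartV b * sc (sndV a)) -
      (qposV b * sc (sndV a) + qnegPartV a * sc (sndV b)) := by
    simp [qleV, qleC]
  rw [h, ← le_def, ← inc_le, qval, qval,
    div_le_div_iff₀ (inc_pos (sc_ne_zero _)) (inc_pos (sc_ne_zero _))]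
  simp only [map_add, map_mul]
  constructor <;> intro h <;> linarith

theorem powV_ne_zero (a : M.D nat) : powV a ≠ 0 := by
  refine nat_induct (P := fun a => powV a ≠ 0) (pow v0 ≐ zero).neg Env.nil (by simp)
    (by rw [powV_zero]; exact one_ne_zero) (fun n hn => ?_) a
  rw [powV_sc]
  exact mul_ne_zero two_ne_zero hn

/-- The rational number `2 ^ (-a)`. -/
noncomputable def tw (a : M.D nat) : RatV M := (inc (powV a))⁻¹

theorem tw_pos (a : M.D nat) : 0 < tw a := inv_pos.2 (inc_pos (powV_ne_zero a))

theorem tw_zero : tw (0 : M.D nat) = 1 := by rw [tw, powV_zero, map_one, inv_one]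

theorem tw_sc (a : M.D nat) : tw (sc a) = tw a / 2 := by
  rw [tw, powV_sc, map_mul, map_ofNat, mul_inv, tw]
  ring

theorem qval_qtwoV (a : M.D nat) : qval (qtwoV a) = tw a := by
  have h : qtwoV a = pairV (2 * 1) (pd (powV a)) := by simp [qtwoV, qtwoC]
  rw [h, qval_pair_even, sc_pd (powV_ne_zero a), map_one, one_div, tw]

theorem le_powV (a : M.D nat) : sc a ≤ powV a := by
  refine nat_induct (P := fun a => sc a ≤ powV a) (leN (succ v0) (pow v0)) Env.nil (by simp)
    (by rw [powV_zero]; exact le_rfl) (fun n hn => ?_) a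
  rw [powV_sc, two_mul, sc_eq]
  exact add_le_add hn (one_le_of_ne_zero (powV_ne_zero n))

/-- Since `b < 2 ^ b`, also for nonstandard `b`, the powers `2 ^ (-b)` come below every positive
rational of the model. -/
theorem exists_tw_le {x : RatV M} (hx : 0 < x) : ∃ b : M.D nat, tw b ≤ x := by
  obtain ⟨b, hb, h⟩ := exists_inv_inc_le hx
  refine ⟨b, le_trans (inv_anti₀ (inc_pos hb) (inc_le.2 ?_)) h⟩
  exact le_trans (by rw [sc_eq]; exact le_self_add) (le_powV b)

theorem tw_antitone {a b : M.D nat} (h : a ≤ b) : tw b ≤ tw a := by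
  obtain ⟨c, rfl⟩ := le_iff_exists.1 h
  have : powV a ≤ powV (a + c) := by
    refine nat_induct (P := fun c => powV a ≤ powV (a + c)) (leN (pow v1) (pow (add v1 v0)))
      (Env.cons a Env.nil) (by simp) (by rw [add_zero]) (fun n hn => ?_) c
    rw [add_sc, powV_sc, two_mul]
    exact hn.trans le_self_add
  exact inv_anti₀ (inc_pos (powV_ne_zero a)) (inc_le.2 this)

theorem tw_add (a b : M.D nat) : tw (a + b) = tw a * tw b := by
  have : powV (a + b) = powV a * powV b := by
    refine nat_induct (P := fun b => powV (a + b) = powV a * powV b)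
      (pow (add v1 v0) ≐ mul (pow v1) (pow v0)) (Env.cons a Env.nil) (by simp)
      (by rw [add_zero, powV_zero, mul_one]) (fun n hn => ?_) b
    rw [add_sc, powV_sc, powV_sc, hn]
    ring
  rw [tw, this, map_mul, mul_inv, tw, tw]

theorem abs_qval_le (a : M.D nat) : |qval a| ≤ inc (fstV a) := by
  rw [abs_qval, ← map_add]
  have h1 : qposV a + qnegPartV a ≤ fstV a := by
    rw [qposV_eq, qnegPartV_eq]
    have h := halfV_le (fstV a)
    rcases parV_cases (fstV a) with h' | h'
    · simpa [h'] using h.1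
    · rw [h'] at h
      simpa [h', sc_eq] using h.2
  refine (div_le_self (inc_nonneg _) ?_).trans (inc_le.2 h1)
  rw [← map_one inc, inc_le]
  exact one_le_of_ne_zero (sc_ne_zero _)

open Filter

/-! ### Real numbers in models -/

section Definitions

variable {M : Str} {Γ : List Ty}

def hatV (f : M.D Ty.one) (n : M.D nat) : M.D nat := hatC.ev Env.nil ⬩ f ⬩ n
def rratV (q : M.D nat) : M.D Ty.one := rratC.ev Env.nil ⬩ q
def raddV (f g : M.D Ty.one) : M.D Ty.one := raddC.ev Env.nil ⬩ f ⬩ g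
def rabsV (f : M.D Ty.one) : M.D Ty.one := rabsC.ev Env.nil ⬩ f
def rmulV (f g : M.D Ty.one) : M.D Ty.one := rmulC.ev Env.nil ⬩ f ⬩ g
def rinvV (l : M.D nat) (f : M.D Ty.one) : M.D Ty.one := rinvC.ev Env.nil ⬩ l ⬩ f
def shiftV (f g : M.D Ty.one) : M.D nat := shiftC.ev Env.nil ⬩ f ⬩ g

variable (e : Env M Γ)

@[simp] theorem ev_hat (f : Tm Γ Ty.one) (s : Tm Γ nat) :
    (hat f s).ev e = hatV (f.ev e) (s.ev e) := by
  rw [hat, ev_app, ev_app, Tm.ev_emb]; rfl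

@[simp] theorem ev_rrat (s : Tm Γ nat) : (rrat s).ev e = rratV (s.ev e) := by
  rw [rrat, ev_app, Tm.ev_emb]; rfl

@[simp] theorem ev_radd (s t : Tm Γ Ty.one) : (radd s t).ev e = raddV (s.ev e) (t.ev e) := by
  rw [radd, ev_app, ev_app, Tm.ev_emb]; rfl

@[simp] theorem ev_rabs (s : Tm Γ Ty.one) : (rabs s).ev e = rabsV (s.ev e) := by
  rw [rabs, ev_app, Tm.ev_emb]; rfl

@[simp] theorem ev_rmul (s t : Tm Γ Ty.one) : (rmul s t).ev e = rmulV (s.ev e) (t.ev e) := by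
  rw [rmul, ev_app, ev_app, Tm.ev_emb]; rfl

@[simp] theorem ev_rinv (l : Tm Γ nat) (s : Tm Γ Ty.one) :
    (rinv l s).ev e = rinvV (l.ev e) (s.ev e) := by
  rw [rinv, ev_app, ev_app, Tm.ev_emb]; rfl

@[simp] theorem ev_shift (s t : Tm Γ Ty.one) : (shift s t).ev e = shiftV (s.ev e) (t.ev e) := by
  rw [shift, ev_app, ev_app, Tm.ev_emb]; rfl

@[simp] theorem ev_rtwo (s : Tm Γ nat) : (rtwo s).ev e = rratV (qtwoV (s.ev e)) := by
  rw [rtwo, ev_rrat, ev_qtwo]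

variable (M) in
def rzeroV : M.D Ty.one := rratV (pairV ((nTwo : Tm [] nat).ev Env.nil * 0) 0)

variable (M) in
def roneV : M.D Ty.one := rratV (pairV ((nTwo : Tm [] nat).ev Env.nil * 1) 0)

@[simp] theorem ev_rzero : (rzero : Tm Γ Ty.one).ev e = rzeroV M := by
  simp only [rzero, qnat, ev_rrat, ev_pair, ev_mul]; rfl

@[simp] theorem ev_rone : (rone : Tm Γ Ty.one).ev e = roneV M := by
  simp only [rone, qnat, ev_rrat, ev_pair, ev_mul]; rfl

end Definitions

variable {M : Str} [M.IsModel] {Γ : List Ty}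

@[simp] theorem rratV_app (q n : M.D nat) : rratV q ⬩ n = q := by simp [rratV, rratC]

/-- The sequence of rational approximations of the real number represented by `f`. -/
noncomputable def seq (f : M.D Ty.one) (n : M.D nat) : RatV M := qval (hatV f n)

/-- The function whose zeros are the indices at which `f` does not converge fast. -/
def badV (f : M.D Ty.one) : M.D Ty.one :=
  (lam (qle (qtwo (succ v0)) (qabs (qsub (v1 ⬝ v0) (v1 ⬝ succ v0)))) : Tm [Ty.one] _).ev
    (Env.cons f Env.nil)

theorem badV_app (f : M.D Ty.one) (j : M.D nat) :
    badV f ⬩ j = 0 ↔ tw (sc j) ≤ |qval (f ⬩ j) - qval (f ⬩ sc j)| := by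
  simp [badV, qsub, qleV_eq_zero, qval_qtwoV, qval_qabsV, qval_qaddV, qval_qnegV, sub_eq_add_neg]

theorem bminV_congr {P P' : M.D Ty.one} (h : ∀ n, P ⬩ n = P' ⬩ n) (n : M.D nat) :
    bminV P n = bminV P' n := by
  refine nat_induct (P := fun n => bminV P n = bminV P' n) (bmin v1 v0 ≐ bmin v2 v0)
    (Env.cons P (Env.cons P' Env.nil)) (by simp) (by simp only [bminV_zero]) (fun n hn => ?_) n
  rw [bminV_sc, bminV_sc, hn, h]

/-- In the definition the searched predicate is abstracted in an environment containing `n`; `badV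
f` is the same predicate without it, so that searches for different `n` can be compared. -/
theorem hatV_eq (f : M.D Ty.one) (n : M.D nat) : hatV f n = f ⬩ bminV (badV f) n := by
  have h : hatV f n = f ⬩ bminV ((lam (qle (qtwo (succ v0))
      (qabs (qsub (v2 ⬝ v0) (v2 ⬝ succ v0)))) : Tm [nat, Ty.one] _).ev
        (Env.cons n (Env.cons f Env.nil))) n := by
    simp [hatV, hatC]
  rw [h]
  refine congrArg (M.app f) (bminV_congr (fun n => ?_) n)
  simp only [badV, qsub, ev_lam_app, ev_qle, ev_qtwo, ev_qabs, ev_qadd, ev_qneg, ev_app, ev_succ,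
    ev_v0, ev_v1, ev_v2, Env.cons_zero, Env.cons_succ]

theorem seq_zero (f : M.D Ty.one) : seq f 0 = qval (f ⬩ 0) := by
  rw [seq, hatV_eq, bminV_zero]

theorem abs_seq_sub_seq_sc (f : M.D Ty.one) (n : M.D nat) :
    |seq f n - seq f (sc n)| < tw (sc n) := by
  rw [seq, seq, hatV_eq, hatV_eq, bminV_sc]
  -- Either a bad index has been reached and the sequence is constant from there, or the search
  -- value is `n` itself and `n` is a good index.
  by_cases h : badV f ⬩ bminV (badV f) n = 0
  · rw [h, caseV_zero, sub_self, abs_zero]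
    exact tw_pos _
  · rw [caseV_pos h]
    have h1 := (bminV_spec (badV f) n).2.1.resolve_right h
    rw [h1] at h ⊢
    rw [badV_app, not_le] at h
    exact h

theorem hatV_eq_of_fast {f : M.D Ty.one}
    (h : ∀ n, |qval (f ⬩ n) - qval (f ⬩ sc n)| < tw (sc n)) (n : M.D nat) :
    hatV f n = f ⬩ n := by
  rw [hatV_eq]
  congr 1
  refine (bminV_spec (badV f) n).2.1.resolve_right ?_
  rw [badV_app, not_le]
  exact h _

@[simp] theorem sat_leQ (e : Env M Γ) (s t : Tm Γ nat) :
    (leQ s t).sat e ↔ qval (s.ev e) ≤ qval (t.ev e) := by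
  simp [leQ, qleV_eq_zero]

@[simp] theorem sat_ltQ (e : Env M Γ) (s t : Tm Γ nat) :
    (ltQ s t).sat e ↔ qval (s.ev e) < qval (t.ev e) := by
  simp [ltQ]

/-- A telescoping sum; the sharp bound is what the induction preserves. It is an internal induction,
so `c` may be nonstandard. -/
theorem abs_seq_sub_add (f : M.D Ty.one) (n c : M.D nat) :
    |seq f n - seq f (n + c)| ≤ tw n - tw (n + c) := by
  refine nat_induct (P := fun c => |seq f n - seq f (n + c)| ≤ tw n - tw (n + c))
    (leQ (qabs (qsub (hat v1 v2) (hat v1 (add v2 v0)))) (qsub (qtwo v2) (qtwo (add v2 v0))))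
    (Env.cons f (Env.cons n Env.nil)) ?_ ?_ (fun c hc => ?_) c
  · intro c
    simp [qsub, qval_qabsV, qval_qaddV, qval_qnegV, qval_qtwoV, seq, sub_eq_add_neg]
  · simp
  · have h := abs_seq_sub_seq_sc f (n + c)
    rw [add_sc, tw_sc] at *
    have := abs_sub_le (seq f n) (seq f (n + c)) (seq f (sc (n + c)))
    linarith

theorem abs_seq_sub_le (f : M.D Ty.one) {n m : M.D nat} (h : n ≤ m) :
    |seq f n - seq f m| ≤ tw n := by
  obtain ⟨c, rfl⟩ := le_iff_exists.1 h
  have := abs_seq_sub_add f n c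
  have := tw_pos (n + c)
  linarith

theorem abs_seq_le (f : M.D Ty.one) (n : M.D nat) : |seq f n| ≤ inc (fstV (f ⬩ 0)) + 1 := by
  have h := abs_seq_sub_le f (zero_le (a := n))
  have h1 := abs_qval_le (f ⬩ 0)
  rw [← seq_zero] at h1
  rw [tw_zero, abs_sub_comm] at h
  have := abs_sub_abs_le_abs_sub (seq f n) (seq f 0)
  linarith

/-! #### Operations -/

@[simp] theorem seq_rratV (q n : M.D nat) : seq (rratV q) n = qval q := by
  rw [seq, hatV_eq, rratV_app]

theorem seq_rzeroV (n : M.D nat) : seq (rzeroV M) n = 0 := by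
  rw [rzeroV, seq_rratV, ev_nTwo, qval_pair_even, map_zero, zero_div]

theorem seq_rtwo (a n : M.D nat) : seq (rratV (qtwoV a)) n = tw a := by
  rw [seq_rratV, qval_qtwoV]

theorem seq_roneV (n : M.D nat) : seq (roneV M) n = 1 := by
  rw [roneV, seq_rratV, ev_nTwo, qval_pair_even, ← one_eq_sc, map_one, div_one]

theorem seq_raddV (f g : M.D Ty.one) (n : M.D nat) :
    seq (raddV f g) n = seq f (sc n) + seq g (sc n) := by
  have h : ∀ n, raddV f g ⬩ n = qaddV (hatV f (sc n)) (hatV g (sc n)) := by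
    intro n; simp [raddV, raddC]
  have h1 : ∀ n, qval (raddV f g ⬩ n) = seq f (sc n) + seq g (sc n) := by
    intro n; rw [h, qval_qaddV]; rfl
  rw [seq, hatV_eq_of_fast, h1]
  intro n
  rw [h1, h1]
  have h2 := abs_lt.1 (abs_seq_sub_seq_sc f (sc n))
  have h3 := abs_lt.1 (abs_seq_sub_seq_sc g (sc n))
  rw [tw_sc] at h2 h3
  rw [abs_lt]
  constructor <;> linarith [h2.1, h2.2, h3.1, h3.2]

theorem shiftV_eq (f g : M.D Ty.one) : shiftV f g = fstV (f ⬩ 0) + fstV (g ⬩ 0) + 2 := by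
  simp [shiftV, shiftC]

/-- The outer `hat` does nothing because the product converges fast: all approximations of `f` and
`g` are bounded by `F + 1` and `G + 1`, where `F` and `G` are the first components of the initial
codes, and the shift `F + G + 2` provides a factor `2 ^ s` that absorbs the sum of these bounds. -/
theorem seq_rmulV (f g : M.D Ty.one) (n : M.D nat) :
    seq (rmulV f g) n = seq f (n + shiftV f g) * seq g (n + shiftV f g) := by
  have h : ∀ n, qval (rmulV f g ⬩ n) = seq f (n + shiftV f g) * seq g (n + shiftV f g) := by
    intro n
    rw [seq, seq, ← qval_qmulV]
    simp [rmulV, rmulC]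
  rw [seq, hatV_eq_of_fast, h]
  intro n
  rw [h, h, sc_add]
  set s := shiftV f g
  set a := n + s
  have hf := abs_seq_le f a
  have hg := abs_seq_le g (sc a)
  have hf' := abs_seq_sub_seq_sc f a
  have hg' := abs_seq_sub_seq_sc g a
  have hs : inc (fstV (f ⬩ 0)) + 1 + (inc (fstV (g ⬩ 0)) + 1) ≤ inc (powV s) := by
    have h1 : inc s = inc (fstV (f ⬩ 0)) + 1 + (inc (fstV (g ⬩ 0)) + 1) := by
      rw [show s = _ from shiftV_eq f g, map_add, map_add, map_ofNat]; ring
    rw [← h1, inc_le]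
    exact le_trans (by rw [sc_eq]; exact le_self_add) (le_powV s)
  have ht : tw (sc a) = tw (sc n) * tw s := by rw [← tw_add, sc_add]
  have hp : inc (powV s) * tw s = 1 := mul_inv_cancel₀ (inc_pos (powV_ne_zero s)).ne'
  have hn := tw_pos (sc n)
  have ha := tw_pos (sc a)
  have hF := inc_nonneg (fstV (f ⬩ 0))
  have hG := inc_nonneg (fstV (g ⬩ 0))
  calc |seq f a * seq g a - seq f (sc a) * seq g (sc a)|
      = |seq f a * (seq g a - seq g (sc a)) + seq g (sc a) * (seq f a - seq f (sc a))| := by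
        congr 1; ring
    _ ≤ |seq f a| * |seq g a - seq g (sc a)| + |seq g (sc a)| * |seq f a - seq f (sc a)| := by
        refine (abs_add_le _ _).trans ?_
        rw [abs_mul, abs_mul]
    _ < (inc (fstV (f ⬩ 0)) + 1) * tw (sc a) + (inc (fstV (g ⬩ 0)) + 1) * tw (sc a) := by
        refine add_lt_add_of_lt_of_le ?_ ?_
        · exact mul_lt_mul' hf hg' (abs_nonneg _) (by linarith)
        · exact mul_le_mul hg hf'.le (abs_nonneg _) (by linarith)
    _ = (inc (fstV (f ⬩ 0)) + 1 + (inc (fstV (g ⬩ 0)) + 1)) * tw (sc a) := by ring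
    _ ≤ inc (powV s) * tw (sc a) := mul_le_mul_of_nonneg_right hs ha.le
    _ = tw (sc n) := by rw [ht, mul_left_comm, hp, mul_one]

/-! #### Order -/

/-- `f ≤ g` as real numbers. -/
def RLe (f g : M.D Ty.one) : Prop :=
  ∀ ε : RatV M, 0 < ε → ∀ᶠ n in atTop, seq f n ≤ seq g n + ε

/-- Links the index-by-index definition of `≤_ℝ` with the version up to errors, in which estimates
can be combined without tracking indices. -/
theorem rle_iff {f g : M.D Ty.one} :
    RLe f g ↔ ∀ n, seq f (sc n) - seq g (sc n) < tw n := by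
  constructor
  · intro h n
    by_contra! hn
    -- At index `p` the strict estimates leave a gap larger than `2 ^ (-n) / 2`. Beyond `p` each
    -- sequence moves by at most `2 ^ (-n) / 4`, so a fixed positive gap remains.
    set p := sc (sc n)
    have hf := abs_lt.1 (abs_seq_sub_seq_sc f (sc n))
    have hg := abs_lt.1 (abs_seq_sub_seq_sc g (sc n))
    have hp : tw p = tw n / 4 := by rw [tw_sc, tw_sc]; ring
    have hd : 0 < seq f p - seq g p - tw n / 2 := by linarith [hf.1, hf.2, hg.1, hg.2]
    obtain ⟨m, hm, hpm⟩ :=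
      ((h ((seq f p - seq g p - tw n / 2) / 2) (by linarith)).and (eventually_ge_atTop p)).exists
    have h1 := abs_le.1 (abs_seq_sub_le f hpm)
    have h2 := abs_le.1 (abs_seq_sub_le g hpm)
    linarith [h1.1, h1.2, h2.1, h2.2]
  · intro h ε hε
    obtain ⟨b, hb⟩ := exists_tw_le (half_pos hε)
    filter_upwards [eventually_ge_atTop (sc b)] with m hm
    have h1 := abs_le.1 (abs_seq_sub_le f hm)
    have h2 := abs_le.1 (abs_seq_sub_le g hm)
    rw [tw_sc] at h1 h2
    linarith [h b, h1.1, h1.2, h2.1, h2.2]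

@[simp] theorem sat_ltR (e : Env M Γ) (s t : Tm Γ Ty.one) :
    (ltR s t).sat e ↔ ∃ n, tw n ≤ seq (t.ev e) (sc n) - seq (s.ev e) (sc n) := by
  simp [ltR, qsub, qval_qtwoV, qval_qaddV, qval_qnegV, seq, sub_eq_add_neg]

@[simp] theorem sat_leR (e : Env M Γ) (s t : Tm Γ Ty.one) :
    (leR s t).sat e ↔ RLe (s.ev e) (t.ev e) := by
  rw [rle_iff]
  simp [leR]

@[simp] theorem sat_eqR (e : Env M Γ) (s t : Tm Γ Ty.one) :
    (eqR s t).sat e ↔ RLe (s.ev e) (t.ev e) ∧ RLe (t.ev e) (s.ev e) := by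
  simp only [rle_iff, ← forall_and]
  have : ∀ a b c : RatV M, |a - b| < c ↔ a - b < c ∧ b - a < c := by
    intro a b c
    rw [abs_lt]
    constructor
    · rintro ⟨h1, h2⟩; constructor <;> linarith
    · rintro ⟨h1, h2⟩; constructor <;> linarith
  simp [eqR, qsub, qval_qtwoV, qval_qabsV, qval_qaddV, qval_qnegV, seq, ← sub_eq_add_neg, this]

theorem eventually_abs_seq_sub_le (f : M.D Ty.one) (c : M.D nat) {ε : RatV M} (hε : 0 < ε) :
    ∀ᶠ n in atTop, |seq f n - seq f (n + c)| ≤ ε := by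
  obtain ⟨b, hb⟩ := exists_tw_le hε
  filter_upwards [eventually_ge_atTop b] with n hn
  exact (abs_seq_sub_le f le_self_add).trans ((tw_antitone hn).trans hb)

theorem eventually_seq_raddV (f g : M.D Ty.one) {ε : RatV M} (hε : 0 < ε) :
    ∀ᶠ n in atTop, |seq (raddV f g) n - (seq f n + seq g n)| ≤ ε := by
  filter_upwards [eventually_abs_seq_sub_le f 1 (half_pos hε),
    eventually_abs_seq_sub_le g 1 (half_pos hε)] with n hf hg
  rw [seq_raddV, sc_eq]
  rw [abs_le] at *
  constructor <;> linarith [hf.1, hf.2, hg.1, hg.2]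

/-- The bound `B` depends on `f` alone, which is what makes multiplication by a scalar a bounded map
of `X`. -/
theorem exists_abs_seq_rmulV_le (f : M.D Ty.one) : ∃ B : RatV M, 0 < B ∧
    ∀ (g : M.D Ty.one) (ε : RatV M), 0 < ε →
      ∀ᶠ n in atTop, |seq (rmulV f g) n| ≤ B * |seq g n| + ε := by
  have hB : 0 < inc (fstV (f ⬩ 0)) + 1 := by linarith [inc_nonneg (fstV (f ⬩ 0))]
  refine ⟨_, hB, fun g ε hε => ?_⟩
  filter_upwards [eventually_abs_seq_sub_le g (shiftV f g) (div_pos hε hB)] with n hg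
  rw [seq_rmulV, abs_mul]
  have h1 := abs_seq_le f (n + shiftV f g)
  have h2 : |seq g (n + shiftV f g)| ≤ |seq g n| + ε / (inc (fstV (f ⬩ 0)) + 1) := by
    have := abs_sub_abs_le_abs_sub (seq g (n + shiftV f g)) (seq g n)
    rw [abs_sub_comm] at this
    linarith
  calc _ ≤ (inc (fstV (f ⬩ 0)) + 1) * (|seq g n| + ε / (inc (fstV (f ⬩ 0)) + 1)) :=
        mul_le_mul h1 h2 (abs_nonneg _) hB.le
    _ = _ := by rw [mul_add, mul_div_cancel₀ _ hB.ne']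

/-! #### The unit -/

theorem qencV_one : qencV (1 : M.D nat) 0 1 = pairV (2 * 1) 0 := by
  rw [qencV_eq, zero_sub', sub_zero', caseV_zero, one_eq_sc, pd_sc]

theorem hatV_roneV (n : M.D nat) : hatV (roneV M) n = pairV (2 * 1) 0 := by
  rw [hatV_eq, roneV, rratV_app, ev_nTwo]

/-- Equality of the codes, not merely of the rationals they represent, is needed to obtain
`rabsV_roneV` as an identity of elements. -/
theorem rabsV_roneV_app (n : M.D nat) : rabsV (roneV M) ⬩ n = roneV M ⬩ n := by
  have : rabsV (roneV M) ⬩ n = qabsV (hatV (roneV M) n) := by simp [rabsV, rabsC]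
  rw [this, hatV_roneV, qabsV_eq, qposV_pair_even, qnegPartV_pair_even, sndV_pairV, add_zero,
    ← one_eq_sc, qencV_one, roneV, rratV_app, ev_nTwo]

theorem rinvV_roneV_app (l n : M.D nat) : rinvV l (roneV M) ⬩ n = roneV M ⬩ n := by
  have h : ∃ k, rinvV l (roneV M) ⬩ n = qinvV (hatV (roneV M) k) :=
    ⟨n + (2 * l + 2), by simp [rinvV, rinvC]⟩
  have h1 : ∀ a : M.D nat, qinvV a = qencV (caseV (qposV a) 0 (sc (sndV a)))
      (caseV (qnegPartV a) 0 (sc (sndV a))) (qposV a + qnegPartV a) := by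
    intro a; simp [qinvV, qinvC]
  obtain ⟨k, hk⟩ := h
  rw [hk, hatV_roneV, h1, qposV_pair_even, qnegPartV_pair_even, sndV_pairV, caseV_zero,
    caseV_pos one_ne_zero, add_zero, ← one_eq_sc, qencV_one, roneV, rratV_app, ev_nTwo]

/-! ### The normed space in a model -/

/-- Pointwise equality in one model does not make two elements identical. If it holds in all models,
however, it is derivable by completeness, and derivable equations are identities. -/
theorem ev_eq_of_valid {Γ : List Ty} {ρ : Ty} {s t : Tm Γ ρ}
    (h : ∀ (M : Str) [M.IsModel] (e : Env M Γ), (eqT ρ s t).sat e) {M : Str} [M.IsModel]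
    (e : Env M Γ) : s.ev e = t.ev e :=
  Str.IsModel.ext (derives_of_valid fun M _ e => h M e) e

section Definitions

variable {M : Str} {Γ : List Ty}

instance : Zero (M.D X) := ⟨M.con .zeroX⟩
instance : Add (M.D X) := ⟨fun x y => M.con .addX ⬩ x ⬩ y⟩
instance : Neg (M.D X) := ⟨fun x => M.con .negX ⬩ x⟩
instance : _root_.Sub (M.D X) := ⟨fun x y => x + -y⟩

def smulV (r : M.D Ty.one) (x : M.D X) : M.D X := M.con .smulX ⬩ r ⬩ x
def normV (x : M.D X) : M.D Ty.one := M.con .normX ⬩ x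
def resV (γ : M.D Ty.one) (x : M.D X) : M.D X := M.con .res ⬩ γ ⬩ x
def chiV (x y : M.D X) : M.D nat := M.con .chi ⬩ x ⬩ y

variable (e : Env M Γ)

@[simp] theorem ev_addX (s t : Tm Γ X) : (addX s t).ev e = s.ev e + t.ev e := rfl
@[simp] theorem ev_subX (s t : Tm Γ X) : (subX s t).ev e = s.ev e - t.ev e := rfl
@[simp] theorem ev_smulX (r : Tm Γ Ty.one) (t : Tm Γ X) :
    (smulX r t).ev e = smulV (r.ev e) (t.ev e) := rfl
@[simp] theorem ev_normX (t : Tm Γ X) : (normX t).ev e = normV (t.ev e) := rfl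
@[simp] theorem ev_resA (r : Tm Γ Ty.one) (t : Tm Γ X) :
    (resA r t).ev e = resV (r.ev e) (t.ev e) := rfl
@[simp] theorem app_chi (x y : M.D X) : M.con .chi ⬩ x ⬩ y = chiV x y := rfl
@[simp] theorem sat_memA (s t : Tm Γ X) :
    (memA s t).sat e ↔ chiV (t.ev e) (s.ev e) = 0 := Iff.rfl

end Definitions

variable {M : Str} [M.IsModel] {Γ : List Ty}

theorem ev_eq_of_eqX {s t : Tm Γ X} (h : NormAx (eqX s t)) (e : Env M Γ) : s.ev e = t.ev e :=
  Str.IsModel.ext (ρ := X) (.norm h) e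

/-- The group laws are theorems, hence literal identities and not just equalities up to distance
zero. Rewriting with them under `χ_A` is therefore legitimate without extensionality of `A`. -/
instance : AddCommGroup (M.D X) where
  add_assoc x y z := ev_eq_of_eqX (.addAssoc v0 v1 v2)
    (Env.cons x (Env.cons y (Env.cons z Env.nil)))
  add_comm x y := ev_eq_of_eqX (.addComm v0 v1) (Env.cons x (Env.cons y Env.nil))
  add_zero x := ev_eq_of_eqX (.addZero v0) (Env.cons x Env.nil)
  zero_add x := (ev_eq_of_eqX (.addComm v0 v1)
      (Env.cons 0 (Env.cons x Env.nil))).trans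
    (ev_eq_of_eqX (.addZero v0) (Env.cons x Env.nil))
  neg_add_cancel x := (ev_eq_of_eqX (.addComm v0 v1)
      (Env.cons (-x) (Env.cons x Env.nil))).trans
    (ev_eq_of_eqX (.addNeg v0) (Env.cons x Env.nil))
  nsmul := nsmulRec
  zsmul := zsmulRec

theorem smulV_add (r : M.D Ty.one) (x y : M.D X) : smulV r (x + y) = smulV r x + smulV r y :=
  ev_eq_of_eqX (.smulAdd v0 v1 v2) (Env.cons r (Env.cons x (Env.cons y Env.nil)))

theorem smulV_zero (r : M.D Ty.one) : smulV r (0 : M.D X) = 0 := by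
  have h := smulV_add r (0 : M.D X) 0
  rw [add_zero] at h
  exact left_eq_add.1 h

theorem smulV_sub (r : M.D Ty.one) (x y : M.D X) : smulV r (x - y) = smulV r x - smulV r y := by
  rw [eq_sub_iff_add_eq, ← smulV_add, sub_add_cancel]

theorem roneV_smulV (x : M.D X) : smulV (roneV M) x = x := by
  rw [← ev_rone (Env.cons x Env.nil)]
  exact ev_eq_of_eqX (.oneSmul v0) (Env.cons x Env.nil)

theorem rabsV_roneV : rabsV (roneV M) = roneV M := by
  have h : (rabs rone : Tm [] Ty.one).ev (M := M) Env.nil = (rone : Tm [] Ty.one).ev Env.nil :=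
    ev_eq_of_valid (fun M _ e => by simp [eqT, rabsV_roneV_app]) _
  simpa using h

theorem rinvV_roneV (l : M.D nat) : rinvV l (roneV M) = roneV M := by
  have h : (rinv v0 rone : Tm [nat] Ty.one).ev (Env.cons l Env.nil) =
      (rone : Tm [nat] Ty.one).ev (Env.cons l Env.nil) :=
    ev_eq_of_valid (fun M _ e => by simp [eqT, rinvV_roneV_app]) _
  simpa using h

/-! #### The norm -/

/-- `‖x‖ ≤ q` for a rational number `q`. -/
def NormLe (x : M.D X) (q : RatV M) : Prop :=
  ∀ ε : RatV M, 0 < ε → ∀ᶠ n in atTop, seq (normV x) n ≤ q + ε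

theorem normV_triangle (x y z : M.D X) :
    RLe (normV (x - z)) (raddV (normV (x - y)) (normV (y - z))) := by
  have := Str.IsModel.sound (.norm (.normTriangle v0 v1 v2))
    (Env.cons x (Env.cons y (Env.cons z Env.nil)))
  simpa using this

theorem eventually_norm_add (x y : M.D X) {ε : RatV M} (hε : 0 < ε) :
    ∀ᶠ n in atTop, seq (normV (x + y)) n ≤ seq (normV x) n + seq (normV y) n + ε := by
  have h := normV_triangle x 0 (-y)
  simp only [sub_neg_eq_add, sub_zero, zero_add] at h
  filter_upwards [h _ (half_pos hε), eventually_seq_raddV (normV x) (normV y) (half_pos hε)]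
    with n h1 h2
  linarith [(abs_le.1 h2).2]

theorem rle_norm_neg (x : M.D X) : RLe (normV (-x)) (normV x) := by
  have := Str.IsModel.sound (.norm (.normSymm v0 v1)) (Env.cons 0 (Env.cons x Env.nil))
  simp only [sat_eqR, ev_normX, ev_subX, ev_v0, ev_v1, Env.cons_zero, Env.cons_succ, zero_sub,
    sub_zero] at this
  exact this.1

theorem eventually_abs_norm_zero {ε : RatV M} (hε : 0 < ε) :
    ∀ᶠ n in atTop, |seq (normV (0 : M.D X)) n| ≤ ε := by
  have := Str.IsModel.sound (.norm (.normSelf v0)) (Env.cons (0 : M.D X) Env.nil)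
  simp only [sat_eqR, ev_normX, ev_subX, ev_v0, Env.cons_zero, sub_zero, ev_rzero] at this
  filter_upwards [this.1 ε hε, this.2 ε hε] with n h1 h2
  rw [seq_rzeroV] at h1 h2
  rw [abs_le]
  constructor <;> linarith

/-- Nonnegativity is not among the axioms; it follows from `0 = ‖x + (-x)‖ ≤ 2 ‖x‖`. -/
theorem eventually_norm_nonneg (x : M.D X) {ε : RatV M} (hε : 0 < ε) :
    ∀ᶠ n in atTop, -ε ≤ seq (normV x) n := by
  filter_upwards [eventually_norm_add x (-x) (show 0 < ε / 3 by linarith),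
    rle_norm_neg x (ε / 3) (by linarith),
    eventually_abs_norm_zero (M := M) (show 0 < ε / 3 by linarith)] with n h1 h2 h3
  rw [add_neg_cancel] at h1
  linarith [(abs_le.1 h3).1]

theorem NormLe.neg {x : M.D X} {q : RatV M} (h : NormLe x q) : NormLe (-x) q := by
  intro ε hε
  filter_upwards [rle_norm_neg x _ (half_pos hε), h _ (half_pos hε)] with n h1 h2
  linarith

theorem NormLe.add {x y : M.D X} {p q : RatV M} (hx : NormLe x p) (hy : NormLe y q) :
    NormLe (x + y) (p + q) := by
  intro ε hε
  have h3 : 0 < ε / 3 := by linarith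
  filter_upwards [eventually_norm_add x y h3, hx _ h3, hy _ h3] with n h1 h2 h3
  linarith

theorem normLe_zero : NormLe (0 : M.D X) 0 := by
  intro ε hε
  filter_upwards [eventually_abs_norm_zero (M := M) hε] with n h
  linarith [(abs_le.1 h).2]

theorem NormLe.mono {x : M.D X} {p q : RatV M} (hx : NormLe x p) (h : p ≤ q) : NormLe x q := by
  intro ε hε
  filter_upwards [hx ε hε] with n h
  linarith

/-- The homogeneity axiom is taken with second vector `0`. A rational bound is enough both for
vectors of norm zero and for limits. -/
theorem exists_normLe_smulV (r : M.D Ty.one) : ∃ B : RatV M, 0 < B ∧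
    ∀ (x : M.D X) (q : RatV M), NormLe x q → NormLe (smulV r x) (B * q) := by
  obtain ⟨B, hB, h⟩ := exists_abs_seq_rmulV_le (rabsV r)
  refine ⟨B, hB, fun x q hx ε hε => ?_⟩
  have h1 := Str.IsModel.sound (.norm (.normSmul v0 v1 v2))
    (Env.cons r (Env.cons x (Env.cons (0 : M.D X) Env.nil)))
  simp only [sat_eqR, ev_normX, ev_subX, ev_smulX, ev_rmul, ev_rabs, ev_v0, ev_v1, ev_v2,
    Env.cons_zero, Env.cons_succ, sub_zero, smulV_zero] at h1
  have hδ : 0 < ε / (4 * B) := div_pos hε (by linarith)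
  filter_upwards [h1.1 (ε / 8) (by linarith), h (normV x) (ε / 8) (by linarith),
    hx _ hδ, eventually_norm_nonneg x hδ] with n h2 h3 h4 h5
  have h6 : |seq (normV x) n| ≤ q + 3 * (ε / (4 * B)) := by
    rw [abs_le]
    constructor <;> linarith
  have h7 : B * |seq (normV x) n| ≤ B * q + 3 * (ε / 4) := by
    refine (mul_le_mul_of_nonneg_left h6 hB.le).trans (le_of_eq ?_)
    field_simp
  have h8 := (abs_le.1 h3).2
  linarith

@[simp] theorem sat_eqX (e : Env M Γ) (s t : Tm Γ X) :
    (eqX s t).sat e ↔ NormLe (s.ev e - t.ev e) 0 := by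
  simp only [eqX, sat_eqR, ev_normX, ev_subX, ev_rzero]
  constructor
  · intro h ε hε
    filter_upwards [h.1 ε hε] with n hn
    rwa [seq_rzeroV] at hn
  · intro h
    refine ⟨fun ε hε => ?_, fun ε hε => ?_⟩
    · filter_upwards [h ε hε] with n hn
      rwa [seq_rzeroV]
    · filter_upwards [eventually_norm_nonneg _ hε] with n hn
      rw [seq_rzeroV]
      linarith

theorem rle_rtwo_iff {x : M.D X} {k : M.D nat} :
    RLe (normV x) (rratV (qtwoV k)) ↔ NormLe x (tw k) := by
  simp only [RLe, NormLe, seq_rtwo]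

/-- The triangle inequality is used once on each side: `‖a‖ ≤ ‖a'‖ + ‖a - a'‖` and `‖b'‖ ≤ ‖b‖ + ‖b'
- b‖`. -/
theorem rle_norm_of_approx {a b : M.D X}
    (h : ∀ q : RatV M, 0 < q → ∃ a' b' : M.D X, RLe (normV a') (normV b') ∧
      NormLe (a - a') q ∧ NormLe (b' - b) q) : RLe (normV a) (normV b) := by
  intro ε hε
  -- Seven errors add up: one from `a' ≤ b'`, two from each approximation (its `q` and its own
  -- error), and one from each triangle inequality.
  have h7 : 0 < ε / 7 := by linarith
  obtain ⟨a', b', h1, h2, h3⟩ := h (ε / 7) h7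
  filter_upwards [h1 _ h7, h2 _ h7, h3 _ h7, eventually_norm_add a' (a - a') h7,
    eventually_norm_add b (b' - b) h7] with n h1 h2 h3 h4 h5
  rw [add_sub_cancel] at h4 h5
  linarith

/-! ### The principles in a model -/

theorem sat_extensionality : (extensionality).sat (M := M) Env.nil ↔ ∀ x y x' y' : M.D X,
    NormLe (x - x') 0 → NormLe (y - y') 0 → chiV x y = chiV x' y' := by
  simp [extensionality]

theorem sat_strongResolvent : (strongResolvent).sat (M := M) Env.nil ↔
    ∀ (x p : M.D X) (γ : M.D Ty.one) (l : M.D nat),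
      (∃ n, tw n ≤ seq γ (sc n) - seq (rratV (qtwoV l)) (sc n)) → NormLe (p - resV γ x) 0 →
        chiV p (smulV (rinvV l γ) (x - p)) = 0 := by
  simp [strongResolvent]

theorem sat_maximalAccretivity : (maximalAccretivity).sat (M := M) Env.nil ↔
    ∀ x u : M.D X, (∀ (y v : M.D X) (r : M.D Ty.one), chiV y v = 0 →
      RLe (normV (x - y)) (normV (x - y + smulV (rabsV r) (u - v)))) → chiV x u = 0 := by
  simp [maximalAccretivity]

theorem sat_strongResolventOne : (strongResolventOne).sat (M := M) Env.nil ↔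
    ∀ x p : M.D X, NormLe (p - resV (roneV M) x) 0 → chiV p (x - p) = 0 := by
  simp [strongResolventOne]

theorem sat_maximalAccretivityOne : (maximalAccretivityOne).sat (M := M) Env.nil ↔
    ∀ x u : M.D X, (∀ y v : M.D X, chiV y v = 0 →
      RLe (normV (x - y)) (normV (x - y + (u - v)))) → chiV x u = 0 := by
  simp [maximalAccretivityOne]

theorem sat_converges (e : Env M Γ) (z : Tm Γ (nat ⇾ X)) (x : Tm Γ X) :
    (converges z x).sat e ↔
      ∀ k, ∃ N, ∀ m, N ≤ m → NormLe (z.ev e ⬩ m - x.ev e) (tw k) := by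
  simp [converges, rle_rtwo_iff]

theorem sat_closedGraph : (closedGraph).sat (M := M) Env.nil ↔
    ∀ (x y : M.D X) (xs ys : M.D (nat ⇾ X)),
      (∀ k, ∃ N, ∀ m, N ≤ m → NormLe (xs ⬩ m - x) (tw k)) →
      (∀ k, ∃ N, ∀ m, N ≤ m → NormLe (ys ⬩ m - y) (tw k)) →
      (∀ n, chiV (xs ⬩ n) (ys ⬩ n) = 0) → chiV x y = 0 := by
  simp [closedGraph, sat_converges]

/-! ### The operator axioms in a model -/

theorem chiV_resV (γ : M.D Ty.one) (x : M.D X) (l : M.D nat)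
    (h : ∃ n, tw n ≤ seq γ (sc n) - seq (rratV (qtwoV l)) (sc n)) :
    chiV (resV γ x) (smulV (rinvV l γ) (x - resV γ x)) = 0 := by
  have := Str.IsModel.sound (.operator (.resolvent v0 v1 v2))
    (Env.cons γ (Env.cons x (Env.cons l Env.nil)))
  simp only [Fm.sat, sat_ltR, sat_memA, ev_rtwo, ev_smulX, ev_rinv, ev_subX, ev_resA, ev_v0, ev_v1,
    ev_v2, Env.cons_zero, Env.cons_succ] at this
  exact this h

theorem chiV_le_one (x y : M.D X) : chiV x y ≤ 1 := by
  have := Str.IsModel.sound (.operator (.chiLe v0 v1)) (Env.cons x (Env.cons y Env.nil))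
  simpa using this

theorem accretiveV {x y u v : M.D X} (hu : chiV x u = 0) (hv : chiV y v = 0)
    (r : M.D Ty.one) :
    RLe (normV (x - y)) (normV (x - y + smulV (rabsV r) (u - v))) := by
  have := Str.IsModel.sound (.operator (.accretive v0 v1 v2 v3 v4))
    (Env.cons x (Env.cons y (Env.cons u (Env.cons v (Env.cons r Env.nil)))))
  simp only [Fm.sat, sat_leR, sat_memA, ev_normX, ev_addX, ev_subX, ev_smulX, ev_rabs, ev_v0,
    ev_v1, ev_v2, ev_v3, ev_v4, Env.cons_zero, Env.cons_succ] at this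
  exact this ⟨hu, hv⟩

/-- The parameter of the reciprocal of `1` is `l = 1`; with `l = 0` the strict inequality `1 > 2 ^
(-l)` would fail. -/
theorem half_lt_roneV :
    ∃ n, tw n ≤ seq (roneV M) (sc n) - seq (rratV (qtwoV (1 : M.D nat))) (sc n) := by
  refine ⟨1, ?_⟩
  rw [seq_roneV, seq_rtwo, one_eq_sc, tw_sc, tw_zero]
  norm_num

/-- The factor `1⁻¹` may be dropped inside `χ_A` because `1⁻¹` and `1` are the same element, as are
`1 · v` and `v`. -/
theorem chiV_resV_one (x : M.D X) :
    chiV (resV (roneV M) x) (x - resV (roneV M) x) = 0 := by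
  have := chiV_resV (roneV M) x 1 half_lt_roneV
  rwa [rinvV_roneV, roneV_smulV] at this

/-! ### The cycle of implications between the six principles -/

section Principles

variable (M)

theorem strongResolvent_of_extensionality (h : (extensionality).sat (M := M) Env.nil) :
    (strongResolvent).sat (M := M) Env.nil := by
  rw [sat_extensionality] at h
  rw [sat_strongResolvent]
  intro x p γ l hγ hp
  rw [← chiV_resV γ x l hγ]
  refine h _ _ _ _ hp ?_
  -- The two second arguments of `χ_A` differ by `γ⁻¹` times a vector of norm zero, which has norm
  -- zero by boundedness.
  obtain ⟨B, -, hB⟩ := exists_normLe_smulV (rinvV l γ)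
  rw [← smulV_sub, sub_sub_sub_cancel_left, ← neg_sub p]
  have := hB _ _ hp.neg
  rwa [mul_zero] at this

theorem strongResolventOne_of_strongResolvent (h : (strongResolvent).sat (M := M) Env.nil) :
    (strongResolventOne).sat (M := M) Env.nil := by
  rw [sat_strongResolvent] at h
  rw [sat_strongResolventOne]
  intro x p hp
  have := h x p (roneV M) 1 half_lt_roneV hp
  rwa [rinvV_roneV, roneV_smulV] at this

theorem maximalAccretivityOne_of_strongResolventOne
    (h : (strongResolventOne).sat (M := M) Env.nil) :
    (maximalAccretivityOne).sat (M := M) Env.nil := by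
  rw [sat_strongResolventOne] at h
  rw [sat_maximalAccretivityOne]
  intro x u hu
  -- With `y = J_1 (x + u)` and `v = x + u - y` the vector `x - y + (u - v)` vanishes, so the
  -- premise gives `‖x - y‖ ≤ 0`. The strong resolvent axiom then applies at the points `x + u` and
  -- `x`.
  have h1 := hu _ _ (chiV_resV_one (x + u))
  have h2 : x - resV (roneV M) (x + u) + (u - (x + u - resV (roneV M) (x + u))) = 0 := by abel
  rw [h2] at h1
  have h3 := h (x + u) x fun ε hε => by
    filter_upwards [h1 _ (half_pos hε), normLe_zero (M := M) _ (half_pos hε)] with n h4 h5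
    linarith
  rwa [add_sub_cancel_left] at h3

theorem maximalAccretivity_of_maximalAccretivityOne
    (h : (maximalAccretivityOne).sat (M := M) Env.nil) :
    (maximalAccretivity).sat (M := M) Env.nil := by
  rw [sat_maximalAccretivityOne] at h
  rw [sat_maximalAccretivity]
  intro x u hu
  refine h x u fun y v hv => ?_
  have := hu y v (roneV M) hv
  rwa [rabsV_roneV, roneV_smulV] at this

theorem closedGraph_of_maximalAccretivity (h : (maximalAccretivity).sat (M := M) Env.nil) :
    (closedGraph).sat (M := M) Env.nil := by
  rw [sat_maximalAccretivity] at h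
  rw [sat_closedGraph]
  intro x y xs ys hx hy hA
  refine h x y fun x' y' r hA' => rle_norm_of_approx fun q hq => ?_
  obtain ⟨B, hB, hr⟩ := exists_normLe_smulV (rabsV r)
  -- The error `q` is shared: `q / 2` for the `x_n`, and `q / 2` for the `y_n` after multiplication
  -- by the scalar, hence the accuracy `q / 2 / B` for the latter.
  obtain ⟨k, hk⟩ := exists_tw_le (half_pos hq)
  obtain ⟨l, hl⟩ := exists_tw_le (div_pos (half_pos hq) hB)
  obtain ⟨N, hN⟩ := hx k
  obtain ⟨N', hN'⟩ := hy l
  have hn := hN _ (le_max_left N N')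
  have hn' := hN' _ (le_max_right N N')
  refine ⟨_, _, accretiveV (hA (max N N')) hA' r, ?_, ?_⟩
  · rw [sub_sub_sub_cancel_right, ← neg_sub]
    exact hn.neg.mono (by linarith)
  · rw [add_sub_add_comm, sub_sub_sub_cancel_right, ← smulV_sub, sub_sub_sub_cancel_right]
    refine (hn.add (hr _ _ hn')).mono ?_
    have : B * tw l ≤ q / 2 := by
      calc B * tw l ≤ B * (q / 2 / B) := mul_le_mul_of_nonneg_left hl hB.le
        _ = q / 2 := mul_div_cancel₀ _ hB.ne'
    linarith

/-- Constant sequences at `x`, `y` also converge to any points `x'`, `y'` at distance zero from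
them, so membership transfers. As `χ_A` only takes the values `0` and `1`, this gives equality of
its values. -/
theorem extensionality_of_closedGraph (h : (closedGraph).sat (M := M) Env.nil) :
    (extensionality).sat (M := M) Env.nil := by
  rw [sat_closedGraph] at h
  rw [sat_extensionality]
  have key : ∀ x y x' y' : M.D X, NormLe (x - x') 0 → NormLe (y - y') 0 → chiV x y = 0 →
      chiV x' y' = 0 := by
    intro x y x' y' hx hy hA
    -- The constant sequence is the projector applied to `x`; its terms are identical to `x`, so
    -- `χ_A` at them is unchanged.
    refine h x' y' (M.con (.proj X nat) ⬩ x) (M.con (.proj X nat) ⬩ y) (fun k => ⟨0, fun m _ => ?_⟩)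
      (fun k => ⟨0, fun m _ => ?_⟩) fun n => ?_
    · rw [app_proj]; exact hx.mono (tw_pos k).le
    · rw [app_proj]; exact hy.mono (tw_pos k).le
    · rw [app_proj, app_proj]; exact hA
  intro x y x' y' hx hy
  by_cases h0 : chiV x y = 0
  · rw [h0, key x y x' y' hx hy h0]
  · have h1 : chiV x' y' ≠ 0 := fun h1 =>
      h0 (key x' y' x y (by rw [← neg_sub]; exact hx.neg) (by rw [← neg_sub]; exact hy.neg) h1)
    rw [le_antisymm (chiV_le_one x y) (one_le_of_ne_zero h0),
      le_antisymm (chiV_le_one x' y') (one_le_of_ne_zero h1)]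

theorem sat_principle_iff (i : Fin 6) :
    (principle i).sat (M := M) Env.nil ↔ (extensionality).sat (M := M) Env.nil := by
  have h12 := strongResolvent_of_extensionality M
  have h24 := strongResolventOne_of_strongResolvent M
  have h45 := maximalAccretivityOne_of_strongResolventOne M
  have h53 := maximalAccretivity_of_maximalAccretivityOne M
  have h36 := closedGraph_of_maximalAccretivity M
  have h61 := extensionality_of_closedGraph M
  fin_cases i
  · exact Iff.rfl
  · exact ⟨fun h => h61 (h36 (h53 (h45 (h24 h)))), h12⟩
  · exact ⟨fun h => h61 (h36 h), fun h => h53 (h45 (h24 (h12 h)))⟩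
  · exact ⟨fun h => h61 (h36 (h53 (h45 h))), fun h => h24 (h12 h)⟩
  · exact ⟨fun h => h61 (h36 (h53 h)), fun h => h45 (h24 (h12 h))⟩
  · exact ⟨h61, fun h => h36 (h53 (h45 (h24 (h12 h))))⟩

end Principles

end AccretiveSystem

theorem mainTheorem3 :
    ∀ i j : Fin 6, AccretiveSystem.Provable
      ((AccretiveSystem.principle i).iff (AccretiveSystem.principle j)) := by
  intro i j
  refine AccretiveSystem.derives_of_valid fun M _ e => ?_
  have he : e = AccretiveSystem.Env.nil := by funext ρ v; cases v
  subst he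
  have hi := AccretiveSystem.sat_principle_iff M i
  have hj := AccretiveSystem.sat_principle_iff M j
  exact ⟨fun h => hj.2 (hi.1 h), fun h => hi.2 (hj.1 h)⟩
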